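/- **Setting.** Let $K,L,N_0$ be positive integers with $L<K$, $\frac L4<N_0<\frac K2$, $L\ge 4$, and either $N_0\ge 4$, or $N_0=3$ and $L\le 9$. Let $V=\mathbb T_K\times\mathbb T_L$ be the discrete torus ($\mathbb T_M=\mathbb Z/M\mathbb Z$) with its set $E$ of unordered nearest-neighbour bonds. Let $\Omega$ be the set of $\eta\in\{0,1\}^V$ with $\sum_x\eta(x)=LN_0$, and let $\mathbb H(\eta)=-\sum_{\{x,y\}\in E}\eta(x)\eta(y)$. Write $\eta\sim\xi$ if $\eta\ne\xi$ and $\xi$ is obtained from $\eta$ by exchanging the states at the two ends of a bond. For $k\in\mathbb T_K$ let $\boldsymbol{\sigma^k}\in\Omega$ be the configuration equal to $1$ exactly on the columns $\{k+i\}\times\mathbb T_L$, $0\le i\le N_0-1$. **Landscape.** For $\mathcal A\subseteq\Omega$ let $\mathcal F(\mathcal A)$ be the set of minimizers of $\mathbb H$ in $\mathcal A$, $\partial\mathcal A$ the set of $\eta\notin\mathcal A$ adjacent to an element of $\mathcal A$, and $\partial^\star\mathcal A=\mathcal F(\partial\mathcal A)$. Let $\Phi(\mathcal A,\mathcal B)$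 be the minimum over paths from $\mathcal A$ to $\mathcal B$ of the maximum of $\mathbb H$ along the path. Put $\mathcal S=\mathcal F(\Omega)$, $\overline\Phi=\max_{s,s'\in\mathcal S}\Phi(s,s')$ and $\overline\Omega=\{\eta:\Phi(\mathcal S,\eta)\le\overline\Phi\}$. A stable plateau is a nonempty connected set $\mathcal P$ on which $\mathbb H$ is constant, with value $\mathbb H(\mathcal P)$, and such that $\mathbb H>\mathbb H(\mathcal P)$ on $\partial\mathcal P$. A cycle is a nonempty connected set $\mathcal C$ with $\max_{\mathcal C}\mathbb H<\min_{\partial\mathcal C}\mathbb H$; its depth is $\Gamma^{\mathcal C}=\min_{\partial\mathcal C}\mathbb H-\min_{\mathcal C}\mathbb H$. **Jumps between cycles.** Let $\mathscr C$ be a collection of at least two disjoint cycles in $\overline\Omega$ and let $\Gamma^\star>0$. Put $\mathscr C^\star=\{\mathcal C\in\mathscr C:\Gamma^{\mathcal C}\ge\Gamma^\star\}$, $\mathscr C^\sharp=\mathscr C\setminus\mathscr C^\star$, $\Delta=\overline\Omega\setminus\bigcup_{\mathcal C\in\mathscr C}\mathcal C$ and $\mathscr P^{\mathscr C^\star}=\{\mathcal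 F(\mathcal C):\mathcal C\in\mathscr C^\star\}$. On $\Delta\cup\{\mathcal F(\mathcal C):\mathcal C\in\mathscr C\}$ (each cycle $\mathcal C$ contracted to the one vertex $\mathcal F(\mathcal C)$) consider the continuous-time Markov chain with the following rates, for $\eta,\xi\in\Delta$ and $\mathcal C\in\mathscr C$: * $\mathfrak R(\eta,\xi)=1$ if $\eta\sim\xi$ and $\mathbb H(\xi)\le\mathbb H(\eta)$; * $\mathfrak R(\eta,\mathcal F(\mathcal C))=|\{\zeta\in\mathcal C:\eta\sim\zeta\}|$ if $\eta\in\partial\mathcal C$; * $\mathfrak R(\mathcal F(\mathcal C),\eta)=|\mathcal F(\mathcal C)|^{-1}|\{\zeta\in\mathcal C:\eta\sim\zeta\}|$ if $\Gamma^{\mathcal C}\le\Gamma^\star$ and $\eta\in\partial^\star\mathcal C$; * all other rates are $0$. With $\mathcal T_{\mathcal A}$ the hitting time of $\mathcal A$ and $\mathbf P_\eta$ the law of this chain started at $\eta$, define for $\mathcal C,\mathcal C'\in\mathscr C^\star$ $$\mathfrak R^{\star}(\mathcal F(\mathcal C),\mathcal F(\mathcal C'))=\sum_{\eta\in\Delta}\mathfrak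 R(\mathcal F(\mathcal C),\eta)\,\mathbf P_\eta\big[\mathcal T_{\mathcal F(\mathcal C')}=\mathcal T_{\mathscr P^{\mathscr C^\star}}<\infty\big].$$ **Hierarchy.** Let $\mathscr P^{\star,1}$ be the set of stable plateaux contained in $\overline\Omega$, and let $\mathscr D^1=\emptyset$. Given a level $h\ge1$ with collections $\mathscr P^{\star,h}$, $|\mathscr P^{\star,h}|\ge2$, and $\mathscr D^h$, put for $\mathcal P\in\mathscr P^{\star,h}$ $$\Gamma_{\mathcal P}=\Phi\Big(\mathcal P,\bigcup_{\mathcal P'\in\mathscr P^{\star,h},\,\mathcal P'\ne\mathcal P}\mathcal P'\Big)-\mathbb H(\mathcal P),\qquad \Gamma^{\star,h}=\min_{\mathcal P\in\mathscr P^{\star,h}}\Gamma_{\mathcal P},\qquad \mathcal V_{\mathcal P}=\{\eta\in\Omega:\Phi(\mathcal P,\eta)-\mathbb H(\mathcal P)<\Gamma_{\mathcal P}\},$$ and let $\mathscr C^h$ consist of all $\mathcal V_{\mathcal P}$, $\mathcal P\in\mathscr P^{\star,h}$, and of all $\mathcal C\in\mathscr D^h$ disjoint from every $\mathcal V_{\mathcal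 P}$. Let $\mathfrak R^{\star,h}$ be the rate $\mathfrak R^\star$ constructed above from $(\mathscr C^h,\Gamma^{\star,h})$. The elements of $\mathscr P^{\star,h+1}$ are the unions $\bigcup_{\mathcal P\in\mathscr A}\mathcal P$ over the closed irreducible components $\mathscr A$ of the Markov chain with rates $\mathfrak R^{\star,h}$, and $\mathscr D^{h+1}$ consists of the cycles in $(\mathscr C^h)^\star$ whose bottom is transient for this chain and of the cycles in $(\mathscr C^h)^\sharp$. **Theorem.** The collections $\mathscr P^{\star,1},\mathscr P^{\star,2},\mathscr P^{\star,3}$ all have at least two elements (so that the construction reaches level $3$), and for all distinct $k,k'\in\mathbb T_K$ the sets $\{\boldsymbol{\sigma^k}\}$ and $\{\boldsymbol{\sigma^{k'}}\}$ belong to $\mathscr P^{\star,3}$ and $$\mathfrak R^{\star,3}(\{\boldsymbol{\sigma^k}\},\{\boldsymbol{\sigma^{k'}}\})>0.$$ -/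

import Mathlib

open scoped BigOperators

namespace Metastable

section General

/-! ### Energy landscapes on a finite graph

`G` is the edge structure on the finite state space `Ω` and `H` is the Hamiltonian. -/

variable {Ω : Type*} (G : SimpleGraph Ω) (H : Ω → ℝ)

/-- The minimum of the energy over the (finite, nonempty) set `A`; for a set with constant energy
this is the common energy value. -/
noncomputable def minEnergy (A : Set Ω) : ℝ := sInf (H '' A)

/-- The bottom `𝓕(A)`: the energy minimizers in `A`. -/
def bottom (A : Set Ω) : Set Ω := {ξ | ξ ∈ A ∧ ∀ ζ ∈ A, H ξ ≤ H ζ}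

/-- The outer boundary `∂A`. -/
def outerBoundary (A : Set Ω) : Set Ω := {η | η ∉ A ∧ ∃ ξ ∈ A, G.Adj η ξ}

/-- The height of a path: the maximal energy along it. -/
noncomputable def pathHeight {η ξ : Ω} (w : G.Walk η ξ) : ℝ := sSup (H '' {x | x ∈ w.support})

/-- The communication height `Φ(A, B)`: the minimal height of a path from `A` to `B`. -/
noncomputable def commHeight (A B : Set Ω) : ℝ :=
  sInf {t | ∃ η ∈ A, ∃ ξ ∈ B, ∃ w : G.Walk η ξ, t = pathHeight G H w}

/-- The set `𝓢` of ground states. -/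
def groundStates : Set Ω := bottom H Set.univ

/-- The maximal communication height between two ground states. -/
noncomputable def maxBarrier : ℝ :=
  sSup {t | ∃ s ∈ groundStates H, ∃ s' ∈ groundStates H, t = commHeight G H {s} {s'}}

/-- The states reachable from the ground states by paths of height at most `maxBarrier`. -/
def reachable : Set Ω := {η | commHeight G H (groundStates H) {η} ≤ maxBarrier G H}

/-- Stable plateaux: nonempty connected sets of constant energy, all of whose boundary states have
strictly larger energy. -/
def IsStablePlateau (P : Set Ω) : Prop :=
  (G.induce P).Connected ∧ (∀ η ∈ P, ∀ ξ ∈ P, H η = H ξ) ∧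
    ∀ ζ ∈ outerBoundary G P, ∀ η ∈ P, H η < H ζ

/-- The depth of a cycle `C`. -/
noncomputable def depth (C : Set Ω) : ℝ := minEnergy H (outerBoundary G C) - minEnergy H C

/-! ### Markovian jumps between cycles

Below `𝒞` is a collection of disjoint cycles and `Γ` is a positive number. -/

/-- The cycles of depth at least `Γ`. -/
def deepCycles (𝒞 : Set (Set Ω)) (Γ : ℝ) : Set (Set Ω) := {C | C ∈ 𝒞 ∧ Γ ≤ depth G H C}

/-- The cycles of depth smaller than `Γ`. -/
def shallowCycles (𝒞 : Set (Set Ω)) (Γ : ℝ) : Set (Set Ω) := {C | C ∈ 𝒞 ∧ depth G H C < Γ}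

/-- The reachable states outside all cycles of `𝒞`. -/
def outside (𝒞 : Set (Set Ω)) : Set Ω := reachable G H \ ⋃₀ 𝒞

/-- The cycle of `𝒞` with bottom `P` (it is unique, as the cycles are nonempty and disjoint). -/
def cycleOf (𝒞 : Set (Set Ω)) (P : Set Ω) : Set Ω := ⋃₀ {C | C ∈ 𝒞 ∧ bottom H C = P}

open scoped Classical in
/-- The transition rate of the induced chain on the contracted graph, in which every cycle
`C ∈ 𝒞` is contracted to the single vertex `𝓕(C)`. A state `η` outside the cycles is the vertex
`Sum.inl η` and the contracted cycle `C` is the vertex `Sum.inr (𝓕(C))`; the elements of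
`Ω ⊕ Set Ω` that are not of one of these two forms are isolated. -/
noncomputable def contractedRate (𝒞 : Set (Set Ω)) (Γ : ℝ) : Ω ⊕ Set Ω → Ω ⊕ Set Ω → ℝ
  | Sum.inl η, Sum.inl ξ =>
      if η ∈ outside G H 𝒞 ∧ ξ ∈ outside G H 𝒞 ∧ G.Adj η ξ ∧ H ξ ≤ H η then 1 else 0
  | Sum.inl η, Sum.inr P =>
      if η ∈ outside G H 𝒞 ∧ P ∈ bottom H '' 𝒞 ∧ η ∈ outerBoundary G (cycleOf H 𝒞 P) then
        ({ζ | ζ ∈ cycleOf H 𝒞 P ∧ G.Adj η ζ}.ncard : ℝ)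
      else 0
  | Sum.inr P, Sum.inl η =>
      if η ∈ outside G H 𝒞 ∧ P ∈ bottom H '' 𝒞 ∧ depth G H (cycleOf H 𝒞 P) ≤ Γ ∧
          η ∈ bottom H (outerBoundary G (cycleOf H 𝒞 P)) then
        (P.ncard : ℝ)⁻¹ * ({ζ | ζ ∈ cycleOf H 𝒞 P ∧ G.Adj η ζ}.ncard : ℝ)
      else 0
  | Sum.inr _, Sum.inr _ => 0

end General

section MarkovChain

variable {X : Type*} [Fintype X] (R : X → X → ℝ)

/-- The jump probabilities of the continuous-time Markov chain with rates `R` (all zero at an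
absorbing state, where no jump takes place). -/
noncomputable def jumpProb (x y : X) : ℝ := R x y / ∑ z, R x z

open scoped Classical in
/-- The probability that the chain with rates `R` started at `x` visits the set `A` within its
first `n` jumps (time zero included) and that the state at the hitting time `𝒯_A` is `y`; computed
by conditioning on the first jump. -/
noncomputable def hitWithin (A : Set X) (y : X) : ℕ → X → ℝ
  | 0, x => if x ∈ A ∧ x = y then 1 else 0
  | n + 1, x =>
      if x ∈ A then (if x = y then 1 else 0)
      else ∑ z, jumpProb R x z * hitWithin A y n z

/-- For `y ∈ A`, the probability `𝐏_x[𝒯_y = 𝒯_A < ∞]` that the chain with rates `R` started at `x`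
hits `A` at the state `y`. It is the limit of the nondecreasing sequence of the probabilities that
this happens within `n` jumps. -/
noncomputable def hitProb (A : Set X) (y x : X) : ℝ := ⨆ n : ℕ, hitWithin R A y n x

/-- A closed irreducible component of the chain with rates `R` on the states `S`: a nonempty
subset of `S` which consists, for each of its elements, of exactly the states that can be reached
from this element by jumps of positive rate. -/
def IsIrreducibleComponent {X : Type*} (R : X → X → ℝ) (S 𝒜 : Set X) : Prop :=
  𝒜.Nonempty ∧ 𝒜 ⊆ S ∧
    ∀ x ∈ 𝒜, 𝒜 = {y | Relation.ReflTransGen (fun a b => a ∈ S ∧ b ∈ S ∧ 0 < R a b) x y}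

end MarkovChain

section Hierarchy

variable {Ω : Type*} [Fintype Ω] (G : SimpleGraph Ω) (H : Ω → ℝ)

open scoped Classical in
/-- The transition rate, between the bottoms `P` and `P'` of two cycles of depth at least `Γ`, of
the trace on these bottoms of the induced chain on the contracted graph. -/
noncomputable def traceRate (𝒞 : Set (Set Ω)) (Γ : ℝ) (P P' : Set Ω) : ℝ :=
  if P ∈ bottom H '' deepCycles G H 𝒞 Γ ∧ P' ∈ bottom H '' deepCycles G H 𝒞 Γ then
    ∑ η : Ω, if η ∈ outside G H 𝒞 then
      contractedRate G H 𝒞 Γ (Sum.inr P) (Sum.inl η) *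
        hitProb (contractedRate G H 𝒞 Γ) (Sum.inr '' (bottom H '' deepCycles G H 𝒞 Γ))
          (Sum.inr P') (Sum.inl η)
      else 0
  else 0

/-! ### The hierarchy

A level is described by the collection `𝓠` of its metastable sets and by the collection `𝒟` of
cycles left over from the previous level (transient cycles and shallow cycles). -/

/-- The depth `Γ_P` of `P` relative to the other elements of `𝓠`. -/
noncomputable def relDepth (𝓠 : Set (Set Ω)) (P : Set Ω) : ℝ :=
  commHeight G H P (⋃₀ (𝓠 \ {P})) - minEnergy H P

/-- The smallest relative depth `Γ^⋆` of an element of `𝓠`. -/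
noncomputable def minDepth (𝓠 : Set (Set Ω)) : ℝ := sInf (relDepth G H 𝓠 '' 𝓠)

/-- The valley `𝓥_P` of `P`. -/
def valley (𝓠 : Set (Set Ω)) (P : Set Ω) : Set Ω :=
  {η | commHeight G H P {η} - minEnergy H P < relDepth G H 𝓠 P}

/-- The collection of cycles of the level: the valleys of the elements of `𝓠` and those cycles
left over from the previous level that do not meet these valleys. -/
def levelCycles (𝓠 𝒟 : Set (Set Ω)) : Set (Set Ω) :=
  valley G H 𝓠 '' 𝓠 ∪ {C | C ∈ 𝒟 ∧ ∀ P ∈ 𝓠, Disjoint C (valley G H 𝓠 P)}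

/-- The irreducible components of the trace chain of the level. -/
def levelComponents (𝓠 𝒟 : Set (Set Ω)) : Set (Set (Set Ω)) :=
  {𝒜 | IsIrreducibleComponent (traceRate G H (levelCycles G H 𝓠 𝒟) (minDepth G H 𝓠))
    (bottom H '' deepCycles G H (levelCycles G H 𝓠 𝒟) (minDepth G H 𝓠)) 𝒜}

/-- The pair `(𝓠, 𝒟)` of level `n + 1`. At level one, `𝓠` consists of the stable plateaux in the
reachable set and `𝒟` is empty. At the next level, the elements of `𝓠` are the unions over the
irreducible components of the trace chain, and `𝒟` consists of the deep cycles whose bottom is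
transient (that is, in no irreducible component) and of the shallow cycles. -/
def stage : ℕ → Set (Set Ω) × Set (Set Ω)
  | 0 => ({P | IsStablePlateau G H P ∧ P ⊆ reachable G H}, ∅)
  | n + 1 =>
      ((fun 𝒜 => ⋃₀ 𝒜) '' levelComponents G H (stage n).1 (stage n).2,
        {C | C ∈ deepCycles G H (levelCycles G H (stage n).1 (stage n).2)
              (minDepth G H (stage n).1) ∧
            bottom H C ∉ ⋃₀ levelComponents G H (stage n).1 (stage n).2} ∪
          shallowCycles G H (levelCycles G H (stage n).1 (stage n).2) (minDepth G H (stage n).1))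

/-- The collection `𝒫^{⋆,h}` of level `h ≥ 1`. -/
def starPlateaux (h : ℕ) : Set (Set Ω) := (stage G H (h - 1)).1

/-- The limiting transition rate `ℜ^{⋆,h}(P, P')` of level `h ≥ 1`. -/
noncomputable def starRate (h : ℕ) (P P' : Set Ω) : ℝ :=
  traceRate G H (levelCycles G H (stage G H (h - 1)).1 (stage G H (h - 1)).2)
    (minDepth G H (stage G H (h - 1)).1) P P'

end Hierarchy

end Metastable

namespace Kawasaki

/-! ### The Ising lattice gas with Kawasaki dynamics on the periodic lattice -/

/-- The sites of the `K × L` discrete torus; the first coordinate is the column. -/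
abbrev Site (K L : ℕ) : Type := ZMod K × ZMod L

/-- The nearest-neighbour graph of the torus. -/
def torus (K L : ℕ) : SimpleGraph (Site K L) :=
  SimpleGraph.fromRel fun x y => y = (x.1 + 1, x.2) ∨ y = (x.1, x.2 + 1)

variable (K L : ℕ) [NeZero K] [NeZero L]

/-- The configurations with exactly `N` particles. -/
abbrev Config (N : ℕ) : Type := {η : Site K L → Fin 2 // ∑ x, (η x : ℕ) = N}

open scoped Classical in
/-- The Hamiltonian: minus the sum of `η x * η y` over the unordered bonds `{x, y}`. -/
noncomputable def hamiltonian (N : ℕ) (η : Config K L N) : ℝ :=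
  -∑ e ∈ (torus K L).edgeFinset, (e.map fun x => ((η.1 x : ℕ) : ℝ)).mul

/-- The edge structure of the Kawasaki dynamics: two distinct configurations are adjacent if one
is obtained from the other by exchanging the states at two neighbouring sites. -/
def exchangeGraph (N : ℕ) : SimpleGraph (Config K L N) where
  Adj η ξ := η ≠ ξ ∧ ∃ x y, (torus K L).Adj x y ∧ ξ.1 = η.1 ∘ Equiv.swap x y
  symm := ⟨by
    rintro η ξ ⟨hne, x, y, hxy, h⟩
    refine ⟨hne.symm, x, y, hxy, ?_⟩
    rw [h]
    funext z
    simp⟩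
  loopless := ⟨fun η h => h.1 rfl⟩

theorem sum_strip (N₀ : ℕ) (hN : N₀ ≤ K) (k : ZMod K) :
    ∑ x : Site K L, (((if (x.1 - k).val < N₀ then 1 else 0 : Fin 2) : Fin 2) : ℕ) = L * N₀ := by
  have h1 : ∀ x : Site K L, (((if (x.1 - k).val < N₀ then 1 else 0 : Fin 2) : Fin 2) : ℕ)
      = if (x.1 - k).val < N₀ then 1 else 0 := by
    intro x; split_ifs <;> rfl
  simp_rw [h1]
  rw [Fintype.sum_prod_type, Finset.sum_comm]
  change (∑ _y : ZMod L, ∑ a : ZMod K, if (a - k).val < N₀ then 1 else 0) = L * N₀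
  rw [Finset.sum_const, Finset.card_univ, ZMod.card, smul_eq_mul]
  congr 1
  rw [Fintype.sum_equiv (Equiv.subRight k) (fun a : ZMod K => if (a - k).val < N₀ then 1 else 0)
    (fun a : ZMod K => if a.val < N₀ then 1 else 0) (fun a => rfl)]
  rw [Finset.sum_boole, Nat.cast_id]
  have h2 : (Finset.range N₀).card = ({a : ZMod K | a.val < N₀} : Finset (ZMod K)).card := by
    refine Finset.card_bij (fun i _ => (i : ZMod K)) ?_ ?_ ?_
    · intro i hi
      have hi' := Finset.mem_range.1 hi
      simp [ZMod.val_cast_of_lt (lt_of_lt_of_le hi' hN), hi']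
    · intro i hi j hj hij
      have hi' := Finset.mem_range.1 hi
      have hj' := Finset.mem_range.1 hj
      have := congrArg ZMod.val hij
      rwa [ZMod.val_cast_of_lt (lt_of_lt_of_le hi' hN),
        ZMod.val_cast_of_lt (lt_of_lt_of_le hj' hN)] at this
    · intro a ha
      exact ⟨a.val, by simpa using ha, ZMod.natCast_zmod_val a⟩
  rw [← h2, Finset.card_range]

/-- The strip with state one exactly on the columns `k, k + 1, …, k + N₀ - 1`. -/
def strip (N₀ : ℕ) (hN : N₀ ≤ K) (k : ZMod K) : Config K L (L * N₀) :=
  ⟨fun x => if (x.1 - k).val < N₀ then 1 else 0, sum_strip K L N₀ hN k⟩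

end Kawasaki

/-! Let e be the energy of the strips. An abstract statement on landscapes with prescribed energy
levels (`StripLandscape.hierarchy`) is separated from the verification of these levels for the
lattice gas (`stripLandscape`).

Abstract part. All rates are nonnegative, so a limiting rate is positive exactly when a suitable
sequence of allowed jumps exists (`hitProb_pos_iff`, `traceRate_pos_iff`), and the closed
irreducible components depend on reachability alone. The reachable energies are e, e+2, e+3 and e+4.
At level one the smallest depth is 1: plateaux at e+2 that can be left at e+3 and plateaux at e+3
are left, strips are not. The components are the single strips and, for each component of {H ≤ e+3}
with minimum e+2, all plateaux in it (`levelComponents_one`). From then on the cycles are exactly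
the components of {H ≤ e+3} in the reachable set (`levelCycles_two`, `levelCycles_three`), and all
of them are left at height e+4. At level two the smallest depth is 2, so every component without a
strip is left, the strips are absorbing, and only they survive (`levelComponents_two`). At level
three the smallest depth is 4, every component may be left, and the contracted chain can follow any
path of height e+4 (`DisjointCycles.follow`). A path from one strip to another that avoids the
components of all other strips therefore gives a positive rate (`starRate_pos`).

Lattice part. The energy is the number of exits of the occupied set in the two positive directions,
minus a constant (`hamiltonian_eq`). Counting rows and columns that are neither full nor empty gives
the isoperimetric inequality: the strips are the minimizers, and the level e+1 is met only by sets
with an empty row (`isoperimetry`), which cannot be reached below e+5 (`cut_of_emptying`). The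
component of a strip in {H ≤ e+3} is confined to configurations that are `Near` the strip: at most
one particle is outside, or two of which one faces a hole (`Near.move`). This rests on the fact that
the second kind has energy exactly e+3 and a rigid shape (`shape_of_pair`).

The path between two strips moves the left column to the right side particle by particle
(`window_step`). Completing an intermediate strip would enter its component; instead, when two
particles remain on the left, they are carried to the right and the two remaining holes are then
carried to the left (`bypass`). During this detour two particles outside the intermediate strip
never face a hole, so the configuration is never near that strip. -/

namespace Metastable

/-! ### Connection by paths of bounded height, and communication heights. -/

section Joined

variable {Ω : Type*} (G : SimpleGraph Ω) (H : Ω → ℝ)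

/-- `η` and `ξ` are joined by a path of height at most `t`. -/
def Joined (t : ℝ) (η ξ : Ω) : Prop :=
  H η ≤ t ∧ Relation.ReflTransGen (fun a b => G.Adj a b ∧ H b ≤ t) η ξ

variable {G H} {t s : ℝ} {η ξ ζ : Ω}

theorem Joined.left_le (h : Joined G H t η ξ) : H η ≤ t := h.1

theorem Joined.refl (h : H η ≤ t) : Joined G H t η η := ⟨h, .refl⟩

theorem Joined.right_le (h : Joined G H t η ξ) : H ξ ≤ t := by
  obtain ⟨h1, h2⟩ := h
  rcases Relation.ReflTransGen.cases_tail h2 with h | ⟨c, _, hc⟩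
  · rwa [h]
  · exact hc.2

theorem Joined.trans (h : Joined G H t η ξ) (h' : Joined G H t ξ ζ) : Joined G H t η ζ :=
  ⟨h.1, h.2.trans h'.2⟩

theorem Joined.tail (h : Joined G H t η ξ) (ha : G.Adj ξ ζ) (hz : H ζ ≤ t) :
    Joined G H t η ζ := ⟨h.1, h.2.tail ⟨ha, hz⟩⟩

theorem Joined.symm (h : Joined G H t η ξ) : Joined G H t ξ η := by
  obtain ⟨h1, h2⟩ := h
  induction h2 with
  | refl => exact .refl h1
  | tail hab hbc ih =>
    have hb : Joined G H t η _ := ⟨h1, hab⟩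
    exact Joined.trans ⟨hbc.2, .single ⟨hbc.1.symm, hb.right_le⟩⟩ ih

theorem Joined.mono (h : Joined G H t η ξ) (hts : t ≤ s) : Joined G H s η ξ :=
  ⟨h.1.trans hts, Relation.ReflTransGen.mono (fun _ _ hab => ⟨hab.1, hab.2.trans hts⟩) _ _ h.2⟩

theorem Joined.of_adj (ha : G.Adj η ξ) (h1 : H η ≤ t) (h2 : H ξ ≤ t) : Joined G H t η ξ :=
  (Joined.refl h1).tail ha h2

theorem pathHeight_le_iff (w : G.Walk η ξ) :
    pathHeight G H w ≤ t ↔ ∀ x ∈ w.support, H x ≤ t := by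
  unfold pathHeight
  have hfin : (H '' {x | x ∈ w.support}).Finite := (List.finite_toSet w.support).image _
  have hne : (H '' {x | x ∈ w.support}).Nonempty := ⟨H η, η, w.start_mem_support, rfl⟩
  rw [csSup_le_iff hfin.bddAbove hne]
  simp

theorem exists_walk_iff_joined :
    (∃ w : G.Walk η ξ, ∀ x ∈ w.support, H x ≤ t) ↔ Joined G H t η ξ := by
  constructor
  · rintro ⟨w, hw⟩
    induction w with
    | nil => exact .refl (hw _ (by simp))
    | cons ha w ih =>
      refine Joined.trans (Joined.of_adj ha (hw _ (by simp)) (hw _ ?_)) (ih fun x hx => hw _ ?_)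
      · simp
      · simp [hx]
  · rintro ⟨h1, h2⟩
    induction h2 with
    | refl => exact ⟨.nil, by simpa⟩
    | tail _ hbc ih =>
      obtain ⟨w, hw⟩ := ih
      refine ⟨w.append (.cons hbc.1 .nil), fun x hx => ?_⟩
      rw [SimpleGraph.Walk.mem_support_append_iff] at hx
      rcases hx with hx | hx
      · exact hw x hx
      · simp only [SimpleGraph.Walk.support_cons, SimpleGraph.Walk.support_nil,
          List.mem_cons, List.not_mem_nil, or_false] at hx
        rcases hx with rfl | rfl
        · exact hw _ w.end_mem_support
        · exact hbc.2

/-- The first state of the path outside the set is a boundary state. This turns statements about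
communication heights into statements about boundary energies. -/
theorem Joined.exists_boundary {A : Set Ω} (h : Joined G H t η ξ) (hη : η ∈ A) (hξ : ξ ∉ A) :
    ∃ ζ ∈ outerBoundary G A, Joined G H t η ζ := by
  obtain ⟨h1, h2⟩ := h
  induction h2 with
  | refl => exact absurd hη hξ
  | @tail b c hab hbc ih =>
    by_cases hb : b ∈ A
    · exact ⟨c, ⟨hξ, b, hb, hbc.1.symm⟩, h1, hab.tail hbc⟩
    · exact ih hb

variable (G H) in
theorem exists_pathHeight_eq (w : G.Walk η ξ) : ∃ x, pathHeight G H w = H x := by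
  have hfin : (H '' {x | x ∈ w.support}).Finite := (List.finite_toSet w.support).image _
  have hne : (H '' {x | x ∈ w.support}).Nonempty := ⟨H η, η, w.start_mem_support, rfl⟩
  obtain ⟨x, _, hx⟩ := hne.csSup_mem hfin
  exact ⟨x, hx.symm⟩

theorem joined_pathHeight (w : G.Walk η ξ) : Joined G H (pathHeight G H w) η ξ :=
  exists_walk_iff_joined.1 ⟨w, (pathHeight_le_iff w).1 le_rfl⟩

theorem minEnergy_eq {A : Set Ω} {η : Ω} (hη : η ∈ A) (h : ∀ ξ ∈ A, H η ≤ H ξ) : minEnergy H A = H η := by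
  refine le_antisymm (csInf_le ?_ ⟨η, hη, rfl⟩) (le_csInf ⟨_, η, hη, rfl⟩ ?_)
  · exact ⟨H η, by rintro _ ⟨ξ, hξ, rfl⟩; exact h ξ hξ⟩
  · rintro _ ⟨ξ, hξ, rfl⟩; exact h ξ hξ

variable [Finite Ω] {A B : Set Ω}

variable (G H A B) in
-- Path heights are values of the energy on a finite space. Hence the infimum defining a
-- communication height is attained whenever there is a path at all.
theorem finite_pathHeights :
    {t | ∃ η ∈ A, ∃ ξ ∈ B, ∃ w : G.Walk η ξ, t = pathHeight G H w}.Finite := by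
  refine (Set.finite_range H).subset ?_
  rintro t ⟨η, _, ξ, _, w, rfl⟩
  obtain ⟨x, hx⟩ := exists_pathHeight_eq G H w
  exact ⟨x, hx.symm⟩

theorem commHeight_le (hη : η ∈ A) (hξ : ξ ∈ B) (h : Joined G H t η ξ) :
    commHeight G H A B ≤ t := by
  obtain ⟨w, hw⟩ := exists_walk_iff_joined.2 h
  exact (csInf_le (finite_pathHeights G H A B).bddBelow ⟨η, hη, ξ, hξ, w, rfl⟩).trans
    ((pathHeight_le_iff w).2 hw)

theorem exists_joined_commHeight (hη : η ∈ A) (hξ : ξ ∈ B) (h : Joined G H t η ξ) :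
    ∃ a ∈ A, ∃ b ∈ B, Joined G H (commHeight G H A B) a b := by
  obtain ⟨w, _⟩ := exists_walk_iff_joined.2 h
  have hne : {t | ∃ η ∈ A, ∃ ξ ∈ B, ∃ w : G.Walk η ξ, t = pathHeight G H w}.Nonempty :=
    ⟨_, η, hη, ξ, hξ, w, rfl⟩
  obtain ⟨a, ha, b, hb, w, hw⟩ := hne.csInf_mem (finite_pathHeights G H A B)
  refine ⟨a, ha, b, hb, ?_⟩
  unfold commHeight
  rw [hw]
  exact joined_pathHeight w

/-- A negative communication height is the height of a path. -/
theorem exists_joined_of_commHeight_neg (h : commHeight G H A B < 0) :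
    ∃ a ∈ A, ∃ b ∈ B, Joined G H (commHeight G H A B) a b := by
  have hne : {t | ∃ η ∈ A, ∃ ξ ∈ B, ∃ w : G.Walk η ξ, t = pathHeight G H w}.Nonempty := by
    by_contra hne
    rw [Set.not_nonempty_iff_eq_empty] at hne
    unfold commHeight at h
    rw [hne, Real.sInf_empty] at h
    exact lt_irrefl _ h
  obtain ⟨_, η, hη, ξ, hξ, w, _⟩ := hne
  exact exists_joined_commHeight hη hξ (joined_pathHeight w)

theorem le_commHeight (hη : η ∈ A) (hξ : ξ ∈ B) (h : Joined G H s η ξ)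
    (hle : ∀ a ∈ A, ∀ b ∈ B, ∀ r, Joined G H r a b → t ≤ r) : t ≤ commHeight G H A B := by
  obtain ⟨a, ha, b, hb, hj⟩ := exists_joined_commHeight hη hξ h
  exact hle a ha b hb _ hj

theorem mem_bottom_iff : η ∈ bottom H A ↔ η ∈ A ∧ H η = minEnergy H A := by
  constructor
  · rintro ⟨h1, h2⟩
    exact ⟨h1, (minEnergy_eq h1 h2).symm⟩
  · rintro ⟨h1, h2⟩
    refine ⟨h1, fun ζ hζ => ?_⟩
    rw [h2]
    exact csInf_le (Set.toFinite (H '' A)).bddBelow ⟨ζ, hζ, rfl⟩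

end Joined

/-! ### Stable plateaux as components of level sets. -/

section Plateau

variable {Ω : Type*} {G : SimpleGraph Ω} {H : Ω → ℝ}

variable (G H) in
/-- The connected component of `η` in the level set of its energy. -/
def plateau (η : Ω) : Set Ω :=
  {ξ | Relation.ReflTransGen (fun a b => G.Adj a b ∧ H b = H η) η ξ}

theorem mem_plateau_self (η : Ω) : η ∈ plateau G H η := Relation.ReflTransGen.refl

theorem energy_of_mem_plateau {η ξ : Ω} (h : ξ ∈ plateau G H η) : H ξ = H η := by
  rcases Relation.ReflTransGen.cases_tail h with h | ⟨c, _, hc⟩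
  · rw [h]
  · exact hc.2

theorem joined_of_mem_plateau {η ξ : Ω} (h : ξ ∈ plateau G H η) : Joined G H (H η) η ξ :=
  ⟨le_rfl, Relation.ReflTransGen.mono (fun _ _ hab => ⟨hab.1, hab.2.le⟩) _ _ h⟩

theorem plateau_connected (η : Ω) : (G.induce (plateau G H η)).Connected := by
  have key : ∀ ξ (h : ξ ∈ plateau G H η),
      (G.induce (plateau G H η)).Reachable ⟨η, mem_plateau_self η⟩ ⟨ξ, h⟩ := by
    intro ξ h
    have h' := h
    change Relation.ReflTransGen _ _ _ at h'
    induction h' with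
    | refl => exact .refl _
    | @tail b c hab hbc ih =>
      exact (ih hab).trans (SimpleGraph.Adj.reachable (by simpa using hbc.1))
  have : Nonempty (plateau G H η) := ⟨⟨η, mem_plateau_self η⟩⟩
  refine ⟨fun a b => (key _ a.2).symm.trans (key _ b.2)⟩

theorem IsStablePlateau.nonempty {P : Set Ω} (h : IsStablePlateau G H P) : P.Nonempty :=
  Set.nonempty_coe_sort.1 h.1.nonempty

theorem IsStablePlateau.joined {P : Set Ω} (h : IsStablePlateau G H P) {η ξ : Ω} (hη : η ∈ P)
    (hξ : ξ ∈ P) : Joined G H (H η) η ξ := by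
  obtain ⟨w⟩ := h.1.preconnected ⟨η, hη⟩ ⟨ξ, hξ⟩
  have : ∀ (a b : P) (w : (G.induce P).Walk a b), Joined G H (H η) a b := by
    intro a b w
    induction w with
    | nil => exact .refl (h.2.1 _ (Subtype.coe_prop _) _ hη).le
    | cons hadj _ ih =>
      exact (Joined.of_adj (by simpa using hadj) (h.2.1 _ (Subtype.coe_prop _) _ hη).le
        (h.2.1 _ (Subtype.coe_prop _) _ hη).le).trans ih
  exact this _ _ w

/-- A path leaving the plateau crosses its boundary, where the energy is strictly larger than the
allowed height. -/
theorem IsStablePlateau.mem_of_joined {P : Set Ω} (h : IsStablePlateau G H P) {η ξ : Ω}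
    (hη : η ∈ P) (hj : Joined G H (H η) η ξ) : ξ ∈ P := by
  by_contra hξ
  obtain ⟨ζ, hζ, hj'⟩ := hj.exists_boundary hη hξ
  exact absurd (h.2.2 ζ hζ η hη) hj'.right_le.not_gt

/-- A stable plateau is determined by any one of its states, so two of them are equal or disjoint.
-/
theorem IsStablePlateau.eq_plateau {P : Set Ω} (h : IsStablePlateau G H P) {η : Ω}
    (hη : η ∈ P) : P = plateau G H η := by
  ext ξ
  constructor
  · intro hξ
    obtain ⟨w⟩ := h.1.preconnected ⟨η, hη⟩ ⟨ξ, hξ⟩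
    have : ∀ (a b : P) (w : (G.induce P).Walk a b),
        Relation.ReflTransGen (fun a b => G.Adj a b ∧ H b = H η) (a : Ω) b := by
      intro a b w
      induction w with
      | nil => exact .refl
      | cons hadj _ ih =>
        exact .head ⟨by simpa using hadj, h.2.1 _ (Subtype.coe_prop _) _ hη⟩ ih
    exact this _ _ w
  · intro hξ
    exact h.mem_of_joined hη (joined_of_mem_plateau hξ)

theorem isStablePlateau_plateau {η : Ω}
    (h : ∀ ξ ∈ plateau G H η, ∀ ζ, G.Adj ξ ζ → H η ≤ H ζ) :
    IsStablePlateau G H (plateau G H η) := by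
  refine ⟨plateau_connected η, fun a ha b hb => ?_, ?_⟩
  · rw [energy_of_mem_plateau ha, energy_of_mem_plateau hb]
  · rintro ζ ⟨hζ, ξ, hξ, hadj⟩ a ha
    rw [energy_of_mem_plateau ha]
    refine lt_of_le_of_ne (h ξ hξ ζ hadj.symm) fun heq => hζ ?_
    exact Relation.ReflTransGen.tail hξ ⟨hadj.symm, heq.symm⟩

end Plateau

end Metastable

namespace Metastable

/-! ### Positivity of hitting probabilities. -/

section HittingProbability

variable {X : Type*} [Fintype X] {R : X → X → ℝ}

theorem jumpProb_nonneg (hR : ∀ x y, 0 ≤ R x y) (x y : X) : 0 ≤ jumpProb R x y :=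
  div_nonneg (hR x y) (Finset.sum_nonneg fun z _ => hR x z)

theorem sum_jumpProb_le_one (x : X) : ∑ y, jumpProb R x y ≤ 1 := by
  unfold jumpProb
  rw [← Finset.sum_div]
  -- At an absorbing state the quotient is 0 / 0 = 0, so only an inequality holds in general.
  exact div_self_le_one _

theorem jumpProb_pos_iff (hR : ∀ x y, 0 ≤ R x y) (x y : X) : 0 < jumpProb R x y ↔ 0 < R x y := by
  constructor
  · intro h
    refine lt_of_le_of_ne (hR x y) fun h0 => ?_
    unfold jumpProb at h
    rw [← h0, zero_div] at h
    exact lt_irrefl _ h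
  · intro h
    exact div_pos h (lt_of_lt_of_le h
      (Finset.single_le_sum (f := fun z => R x z) (fun z _ => hR x z) (Finset.mem_univ y)))

theorem hitWithin_nonneg (hR : ∀ x y, 0 ≤ R x y) (A : Set X) (y : X) (n : ℕ) (x : X) :
    0 ≤ hitWithin R A y n x := by
  induction n generalizing x with
  | zero => unfold hitWithin; split_ifs <;> norm_num
  | succ n ih =>
    unfold hitWithin
    split_ifs
    · norm_num
    · norm_num
    · exact Finset.sum_nonneg fun z _ => mul_nonneg (jumpProb_nonneg hR x z) (ih z)

theorem hitWithin_le_one (hR : ∀ x y, 0 ≤ R x y) (A : Set X) (y : X) (n : ℕ) (x : X) :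
    hitWithin R A y n x ≤ 1 := by
  induction n generalizing x with
  | zero => unfold hitWithin; split_ifs <;> norm_num
  | succ n ih =>
    unfold hitWithin
    split_ifs
    · norm_num
    · norm_num
    · refine le_trans (Finset.sum_le_sum fun z _ => ?_) (sum_jumpProb_le_one (R := R) x)
      exact mul_le_of_le_one_right (jumpProb_nonneg hR x z) (ih z)

theorem hitProb_nonneg (hR : ∀ x y, 0 ≤ R x y) (A : Set X) (y x : X) : 0 ≤ hitProb R A y x :=
  Real.iSup_nonneg fun n => hitWithin_nonneg hR A y n x

/-- The hitting probability is positive iff there is a path of jumps which ends at its first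
visit to the target set. -/
theorem hitProb_pos_iff (hR : ∀ x y, 0 ≤ R x y) {A : Set X} {y : X} (hy : y ∈ A) (x : X) :
    0 < hitProb R A y x ↔ Relation.ReflTransGen (fun a b => a ∉ A ∧ 0 < R a b) x y := by
  constructor
  · intro h
    obtain ⟨n, hn⟩ := exists_lt_of_lt_ciSup h
    induction n generalizing x with
    | zero =>
      unfold hitWithin at hn
      split_ifs at hn with hc
      · rw [hc.2]
      · exact absurd hn (lt_irrefl _)
    | succ n ih =>
      unfold hitWithin at hn
      split_ifs at hn with hA hxy
      · rw [hxy]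
      · exact absurd hn (lt_irrefl _)
      · obtain ⟨z, _, hz⟩ := Finset.exists_lt_of_sum_lt (f := fun _ => (0 : ℝ)) (by simpa using hn)
        have h1 : 0 < jumpProb R x z := by
          refine lt_of_le_of_ne (jumpProb_nonneg hR x z) fun h0 => ?_
          rw [← h0, zero_mul] at hz
          exact lt_irrefl _ hz
        exact .head ⟨hA, (jumpProb_pos_iff hR x z).1 h1⟩
          (ih z (((pos_iff_pos_of_mul_pos hz).1 h1).trans_le (le_ciSup (f := fun n => hitWithin R A y n z)
            ⟨1, by rintro _ ⟨m, rfl⟩; exact hitWithin_le_one hR A y m z⟩ n)) ((pos_iff_pos_of_mul_pos hz).1 h1))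
  · intro h
    have key : ∃ n, 0 < hitWithin R A y n x := by
      induction h using Relation.ReflTransGen.head_induction_on with
      | refl => exact ⟨0, by unfold hitWithin; simp [hy]⟩
      | @head a b hab _ ih =>
        obtain ⟨n, hn⟩ := ih
        refine ⟨n + 1, ?_⟩
        unfold hitWithin
        rw [if_neg hab.1]
        refine lt_of_lt_of_le (mul_pos ((jumpProb_pos_iff hR a b).2 hab.2) hn)
          (Finset.single_le_sum (f := fun z => jumpProb R a z * hitWithin R A y n z)
            (fun z _ => mul_nonneg (jumpProb_nonneg hR a z) (hitWithin_nonneg hR A y n z))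
            (Finset.mem_univ b))
    obtain ⟨n, hn⟩ := key
    exact hn.trans_le (le_ciSup (f := fun n => hitWithin R A y n x)
      ⟨1, by rintro _ ⟨m, rfl⟩; exact hitWithin_le_one hR A y m x⟩ n)

end HittingProbability

section Components

variable {X : Type*}

end Components

/-! ### Trace rates and irreducible components as reachability in the contracted graph. -/

section TraceChain

variable {Ω : Type*} {G : SimpleGraph Ω} {H : Ω → ℝ} {𝒞 : Set (Set Ω)} {Γ : ℝ}

theorem contractedRate_nonneg (x y : Ω ⊕ Set Ω) : 0 ≤ contractedRate G H 𝒞 Γ x y := by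
  rcases x with η | P <;> rcases y with ξ | P' <;> unfold contractedRate
  · dsimp only; split_ifs <;> norm_num
  · dsimp only; split_ifs <;> positivity
  · dsimp only; split_ifs <;> positivity
  · exact le_rfl

/-- The relation of being connected by a jump of positive rate of the contracted chain. -/
def Jump (G : SimpleGraph Ω) (H : Ω → ℝ) (𝒞 : Set (Set Ω)) (Γ : ℝ) (x y : Ω ⊕ Set Ω) : Prop :=
  0 < contractedRate G H 𝒞 Γ x y

theorem jump_inl_inl {η ξ : Ω} : Jump G H 𝒞 Γ (.inl η) (.inl ξ) ↔
    η ∈ outside G H 𝒞 ∧ ξ ∈ outside G H 𝒞 ∧ G.Adj η ξ ∧ H ξ ≤ H η := by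
  unfold Jump contractedRate
  dsimp only
  split_ifs with h
  · simp [h]
  · simp [h]

theorem jump_inl_inr [Finite Ω] {η : Ω} {P : Set Ω} : Jump G H 𝒞 Γ (.inl η) (.inr P) ↔
    η ∈ outside G H 𝒞 ∧ P ∈ bottom H '' 𝒞 ∧ η ∈ outerBoundary G (cycleOf H 𝒞 P) := by
  unfold Jump contractedRate
  dsimp only
  split_ifs with h
  · simp only [h, and_self, iff_true]
    rw [Nat.cast_pos, Set.ncard_pos (Set.toFinite _)]
    exact h.2.2.2
  · simp only [lt_self_iff_false, false_iff]
    exact h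

theorem jump_inr_inl [Finite Ω] {η : Ω} {P : Set Ω} (hP : P.Nonempty) :
    Jump G H 𝒞 Γ (.inr P) (.inl η) ↔
    η ∈ outside G H 𝒞 ∧ P ∈ bottom H '' 𝒞 ∧ depth G H (cycleOf H 𝒞 P) ≤ Γ ∧
      η ∈ bottom H (outerBoundary G (cycleOf H 𝒞 P)) := by
  unfold Jump contractedRate
  dsimp only
  split_ifs with h
  · simp only [h, and_self, iff_true]
    have h1 : 0 < P.ncard := (Set.ncard_pos (Set.toFinite _)).2 hP
    have h2 : 0 < {ζ | ζ ∈ cycleOf H 𝒞 P ∧ G.Adj η ζ}.ncard :=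
      (Set.ncard_pos (Set.toFinite _)).2 h.2.2.2.1.2
    positivity
  · simp only [lt_self_iff_false, false_iff]
    exact h

theorem not_jump_inr_inr {P P' : Set Ω} : ¬ Jump G H 𝒞 Γ (.inr P) (.inr P') := by
  unfold Jump contractedRate
  exact lt_irrefl _

/-- Pairwise disjoint cycles are determined by their bottoms. -/
theorem cycleOf_bottom (hne : ∀ C ∈ 𝒞, (bottom H C).Nonempty)
    (hdisj : ∀ C ∈ 𝒞, ∀ C' ∈ 𝒞, ∀ η ∈ C, η ∈ C' → C = C') {C : Set Ω} (hC : C ∈ 𝒞) :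
    cycleOf H 𝒞 (bottom H C) = C := by
  unfold cycleOf
  have : {C' | C' ∈ 𝒞 ∧ bottom H C' = bottom H C} = {C} := by
    ext C'
    constructor
    · rintro ⟨h1, h2⟩
      obtain ⟨η, hη⟩ := hne C hC
      exact hdisj C' h1 C hC η (h2 ▸ hη).1 hη.1
    · rintro rfl
      exact ⟨hC, rfl⟩
  rw [this, Set.sUnion_singleton]

variable [Fintype Ω]

variable (G H 𝒞 Γ) in
/-- The bottoms of the deep cycles, as vertices of the contracted graph. -/
def deepVertices : Set (Ω ⊕ Set Ω) := Sum.inr '' (bottom H '' deepCycles G H 𝒞 Γ)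

theorem inr_mem_deepVertices {P : Set Ω} :
    Sum.inr P ∈ deepVertices G H 𝒞 Γ ↔ P ∈ bottom H '' deepCycles G H 𝒞 Γ := by
  simp [deepVertices]

/-- Every term of the sum is nonnegative, so the rate is positive iff some single exit state has
both a positive exit rate and a positive hitting probability. After this equivalence no probability
is left in the argument. -/
theorem traceRate_pos_iff {P P' : Set Ω} : 0 < traceRate G H 𝒞 Γ P P' ↔
    P ∈ bottom H '' deepCycles G H 𝒞 Γ ∧ P' ∈ bottom H '' deepCycles G H 𝒞 Γ ∧
    ∃ η ∈ outside G H 𝒞, Jump G H 𝒞 Γ (.inr P) (.inl η) ∧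
      Relation.ReflTransGen (fun a b => a ∉ deepVertices G H 𝒞 Γ ∧ Jump G H 𝒞 Γ a b)
        (.inl η) (.inr P') := by
  unfold traceRate
  split_ifs with h
  · simp only [h.1, h.2, true_and]
    have hpos := fun η : Ω => hitProb_pos_iff (R := contractedRate G H 𝒞 Γ)
      contractedRate_nonneg (inr_mem_deepVertices.2 h.2) (.inl η)
    constructor
    · intro hs
      by_contra hcon
      push Not at hcon
      refine absurd hs (not_lt.2 (Finset.sum_nonpos fun η _ => ?_))
      split_ifs with hη
      · by_cases hj : Jump G H 𝒞 Γ (.inr P) (.inl η)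
        · have := mt (hpos η).1 (hcon η hη hj)
          exact mul_nonpos_of_nonneg_of_nonpos (contractedRate_nonneg _ _) (not_lt.1 this)
        · exact mul_nonpos_of_nonpos_of_nonneg (not_lt.1 hj)
            (hitProb_nonneg contractedRate_nonneg _ _ _)
      · exact le_rfl
    · rintro ⟨η, hη, hj, hr⟩
      refine Finset.sum_pos' (fun ξ _ => ?_) ⟨η, Finset.mem_univ _, ?_⟩
      · split_ifs
        · exact mul_nonneg (contractedRate_nonneg _ _)
            (hitProb_nonneg contractedRate_nonneg _ _ _)
        · exact le_rfl
      · rw [if_pos hη]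
        exact mul_pos hj ((hpos η).2 hr)
  · simp only [lt_self_iff_false, false_iff]
    rintro ⟨h1, h2, _⟩
    exact h ⟨h1, h2⟩

variable (G H 𝒞 Γ) in
/-- The jump relation of the trace chain. -/
def TraceJump (P P' : Set Ω) : Prop :=
  P ∈ bottom H '' deepCycles G H 𝒞 Γ ∧ P' ∈ bottom H '' deepCycles G H 𝒞 Γ ∧
    0 < traceRate G H 𝒞 Γ P P'

theorem reach_of_traceReach {P P' : Set Ω}
    (h : Relation.ReflTransGen (TraceJump G H 𝒞 Γ) P P') :
    Relation.ReflTransGen (Jump G H 𝒞 Γ) (.inr P) (.inr P') := by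
  induction h with
  | refl => exact .refl
  | tail _ hbc ih =>
    obtain ⟨_, _, η, _, h1, h2⟩ := traceRate_pos_iff.1 hbc.2.2
    exact ih.trans (.head h1 (Relation.ReflTransGen.mono (fun _ _ h => h.2) _ _ h2))

/-- A path of the contracted chain is cut at its successive visits to bottoms of deep cycles. Each
piece is one jump of the trace chain. -/
theorem traceReach_of_reach {P P' : Set Ω} (hP : P ∈ bottom H '' deepCycles G H 𝒞 Γ)
    (hP' : P' ∈ bottom H '' deepCycles G H 𝒞 Γ)
    (h : Relation.ReflTransGen (Jump G H 𝒞 Γ) (.inr P) (.inr P')) :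
    Relation.ReflTransGen (TraceJump G H 𝒞 Γ) P P' := by
  -- For induction from the end of the path the start is an arbitrary vertex: Q is the first deep
  -- bottom that the path meets.
  have key : ∀ v, Relation.ReflTransGen (Jump G H 𝒞 Γ) v (.inr P') →
      ∃ Q ∈ bottom H '' deepCycles G H 𝒞 Γ,
        Relation.ReflTransGen (fun a b => a ∉ deepVertices G H 𝒞 Γ ∧ Jump G H 𝒞 Γ a b)
          v (.inr Q) ∧ Relation.ReflTransGen (TraceJump G H 𝒞 Γ) Q P' := by
    intro v hv
    induction hv using Relation.ReflTransGen.head_induction_on with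
    | refl => exact ⟨P', hP', .refl, .refl⟩
    | @head a b hab _ ih =>
      obtain ⟨Q, hQ, h1, h2⟩ := ih
      by_cases ha : a ∈ deepVertices G H 𝒞 Γ
      · obtain ⟨Q', hQ', rfl⟩ := ha
        refine ⟨Q', hQ', .refl, .head ⟨hQ', hQ, ?_⟩ h2⟩
        rcases b with η | Q''
        · refine traceRate_pos_iff.2 ⟨hQ', hQ, η, ?_, hab, h1⟩
          by_contra hη
          unfold Jump contractedRate at hab
          dsimp only at hab
          rw [if_neg fun hc => hη hc.1] at hab
          exact lt_irrefl _ hab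
        · exact absurd hab not_jump_inr_inr
      · exact ⟨Q, hQ, .head ⟨ha, hab⟩ h1, h2⟩
  obtain ⟨Q, hQ, h1, h2⟩ := key _ h
  rcases Relation.ReflTransGen.cases_head h1 with h | ⟨c, hc, _⟩
  · rwa [Sum.inr.inj h]
  · exact absurd (inr_mem_deepVertices.2 hP) hc.1

variable (G H 𝒞 Γ) in
/-- The bottoms of the deep cycles which can be reached from `P` by the contracted chain. -/
def accessible (P : Set Ω) : Set (Set Ω) :=
  {P' | P' ∈ bottom H '' deepCycles G H 𝒞 Γ ∧
    Relation.ReflTransGen (Jump G H 𝒞 Γ) (.inr P) (.inr P')}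

/-- The closed irreducible components of the trace chain in terms of the contracted chain. -/
theorem isIrreducibleComponent_iff {𝒜 : Set (Set Ω)} :
    IsIrreducibleComponent (traceRate G H 𝒞 Γ) (bottom H '' deepCycles G H 𝒞 Γ) 𝒜 ↔
      𝒜.Nonempty ∧ 𝒜 ⊆ bottom H '' deepCycles G H 𝒞 Γ ∧
        ∀ P ∈ 𝒜, 𝒜 = accessible G H 𝒞 Γ P := by
  have key : ∀ P ∈ bottom H '' deepCycles G H 𝒞 Γ,
      {P' | Relation.ReflTransGen (TraceJump G H 𝒞 Γ) P P'} = accessible G H 𝒞 Γ P := by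
    intro P hP
    ext P'
    constructor
    · intro h
      refine ⟨?_, reach_of_traceReach h⟩
      rcases Relation.ReflTransGen.cases_tail h with h | ⟨c, _, hc⟩
      · rwa [h]
      · exact hc.2.1
    · rintro ⟨h1, h2⟩
      exact traceReach_of_reach hP h1 h2
  unfold IsIrreducibleComponent
  refine and_congr_right fun _ => and_congr_right fun hsub => ?_
  refine forall₂_congr fun P hP => ?_
  rw [← key P (hsub hP)]
  rfl

end TraceChain

end Metastable

namespace Metastable

/-! ### Following a path of the landscape by the contracted chain. -/

section Follow

variable {Ω : Type*} {G : SimpleGraph Ω} {H : Ω → ℝ} {𝒞 : Set (Set Ω)} {Γ t : ℝ}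

variable (H 𝒞) in
/-- A collection of pairwise disjoint sets with nonempty bottoms. -/
structure DisjointCycles : Prop where
  nonempty : ∀ C ∈ 𝒞, (bottom H C).Nonempty
  eq_of_mem : ∀ C ∈ 𝒞, ∀ C' ∈ 𝒞, ∀ η ∈ C, η ∈ C' → C = C'

theorem DisjointCycles.cycleOf_bottom (h : DisjointCycles H 𝒞) {C : Set Ω} (hC : C ∈ 𝒞) :
    cycleOf H 𝒞 (bottom H C) = C :=
  Metastable.cycleOf_bottom h.nonempty h.eq_of_mem hC

variable (G H 𝒞) in
/-- The vertex of the contracted graph which represents the state `v`. -/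
def IsVertexOf (v : Ω) (X : Ω ⊕ Set Ω) : Prop :=
  (v ∈ outside G H 𝒞 ∧ X = .inl v) ∨ ∃ C ∈ 𝒞, v ∈ C ∧ X = .inr (bottom H C)

variable (G H 𝒞) in
/-- A state at energy `t` outside the cycles, or in a cycle which can be left exactly at `t`. -/
def AtLevel (t : ℝ) (v : Ω) : Prop :=
  (v ∈ outside G H 𝒞 ∧ H v = t) ∨
    ∃ C ∈ 𝒞, v ∈ C ∧ (∀ u ∈ C, H u < t) ∧ ∀ u ∈ outerBoundary G C, t ≤ H u

theorem not_mem_of_outside {v : Ω} {C : Set Ω} (hv : v ∈ outside G H 𝒞) (hC : C ∈ 𝒞) : v ∉ C :=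
  fun h => hv.2 ⟨C, hC, h⟩

theorem DisjointCycles.jump_enter [Finite Ω] (h : DisjointCycles H 𝒞) {v v' : Ω} {C : Set Ω}
    (hv : v ∈ outside G H 𝒞) (hC : C ∈ 𝒞) (hv' : v' ∈ C) (hadj : G.Adj v v') :
    Jump G H 𝒞 Γ (.inl v) (.inr (bottom H C)) := by
  refine jump_inl_inr.2 ⟨hv, ⟨C, hC, rfl⟩, ?_⟩
  rw [h.cycleOf_bottom hC]
  exact ⟨not_mem_of_outside hv hC, v', hv', hadj⟩

theorem DisjointCycles.jump_exit [Finite Ω] (h : DisjointCycles H 𝒞) {v v' : Ω} {C : Set Ω}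
    (hv' : v' ∈ outside G H 𝒞) (hC : C ∈ 𝒞) (hv : v ∈ C) (hadj : G.Adj v v')
    (hd : depth G H C ≤ Γ) (hmin : ∀ u ∈ outerBoundary G C, H v' ≤ H u) :
    Jump G H 𝒞 Γ (.inr (bottom H C)) (.inl v') := by
  refine (jump_inr_inl (h.nonempty C hC)).2 ⟨hv', ⟨C, hC, rfl⟩, ?_⟩
  rw [h.cycleOf_bottom hC]
  exact ⟨hd, ⟨not_mem_of_outside hv' hC, v, hv, hadj.symm⟩, hmin⟩

/-- The contracted chain can follow a path whose states are all at the level `t`. -/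
theorem DisjointCycles.follow [Finite Ω] (h : DisjointCycles H 𝒞) {x y : Ω} (Q : Ω → Prop)
    (hxy : Relation.ReflTransGen (fun a b => G.Adj a b ∧ AtLevel G H 𝒞 t a ∧ AtLevel G H 𝒞 t b ∧
      (∀ C ∈ 𝒞, a ∈ C → depth G H C ≤ Γ) ∧ Q a) x y) {X : Ω ⊕ Set Ω}
    (hX : IsVertexOf G H 𝒞 x X) :
    ∃ Y, IsVertexOf G H 𝒞 y Y ∧ Relation.ReflTransGen (fun A B =>
      (∃ a, Q a ∧ IsVertexOf G H 𝒞 a A) ∧ Jump G H 𝒞 Γ A B) X Y := by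
  induction hxy with
  | refl => exact ⟨X, hX, .refl⟩
  | @tail v v' hxv hvv' ih =>
    obtain ⟨Y, hY, hreach⟩ := ih
    obtain ⟨hadj, hv, hv', hd, hQ⟩ := hvv'
    have step : ∀ Y', IsVertexOf G H 𝒞 v' Y' → Jump G H 𝒞 Γ Y Y' →
        ∃ Y, IsVertexOf G H 𝒞 v' Y ∧ Relation.ReflTransGen (fun A B =>
      (∃ a, Q a ∧ IsVertexOf G H 𝒞 a A) ∧ Jump G H 𝒞 Γ A B) X Y :=
      fun Y' h1 h2 => ⟨Y', h1, hreach.tail ⟨⟨v, hQ, hY⟩, h2⟩⟩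
    rcases hv with ⟨hvo, hvt⟩ | ⟨C, hC, hvC, hlt, hbd⟩
    · have hY' : Y = .inl v := by
        rcases hY with ⟨_, h1⟩ | ⟨C, hC, h1, _⟩
        · exact h1
        · exact absurd h1 (not_mem_of_outside hvo hC)
      subst hY'
      rcases hv' with ⟨hvo', hvt'⟩ | ⟨C', hC', hvC', _⟩
      · exact step (.inl v') (.inl ⟨hvo', rfl⟩)
          (jump_inl_inl.2 ⟨hvo, hvo', hadj, by rw [hvt, hvt']⟩)
      · exact step _ (.inr ⟨C', hC', hvC', rfl⟩) (h.jump_enter hvo hC' hvC' hadj)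
    · have hY' : Y = .inr (bottom H C) := by
        rcases hY with ⟨h1, _⟩ | ⟨C', hC', h1, h2⟩
        · exact absurd hvC (not_mem_of_outside h1 hC)
        · rw [h2, h.eq_of_mem C hC C' hC' v hvC h1]
      subst hY'
      rcases hv' with ⟨hvo', hvt'⟩ | ⟨C', hC', hvC', hlt', _⟩
      · refine step (.inl v') (.inl ⟨hvo', rfl⟩)
          (h.jump_exit hvo' hC hvC hadj (hd C hC hvC) fun u hu => ?_)
        rw [hvt']
        exact hbd u hu
      -- One step cannot lead from a cycle into a different one: the new state would lie on the
      -- boundary of C, hence have energy at least t, while states inside cycles are below t.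
      · by_cases hCC : v' ∈ C
        · exact ⟨_, .inr ⟨C, hC, hCC, rfl⟩, hreach⟩
        · exact absurd (hlt' v' hvC') (not_lt.2 (hbd v' ⟨hCC, v, hvC, hadj.symm⟩))

/-- A path can be stopped at its first visit to a set. -/
theorem exists_first_visit {α : Type*} {r : α → α → Prop} {a b : α} (Z : Set α)
    (h : Relation.ReflTransGen r a b) (hb : b ∈ Z) :
    ∃ c ∈ Z, Relation.ReflTransGen (fun x y => r x y ∧ x ∉ Z) a c := by
  induction h using Relation.ReflTransGen.head_induction_on with
  | refl => exact ⟨b, hb, .refl⟩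
  | @head x y hxy _ ih =>
    by_cases hx : x ∈ Z
    · exact ⟨x, hx, .refl⟩
    · obtain ⟨c, hc, hr⟩ := ih
      exact ⟨c, hc, .head ⟨hxy, hx⟩ hr⟩

end Follow

/-! ### Valleys and their exit heights. -/

section Valley

variable {Ω : Type*} [Finite Ω] {G : SimpleGraph Ω} {H : Ω → ℝ} {𝓠 : Set (Set Ω)} {P : Set Ω}

variable (G H 𝓠 P) in
/-- The communication height between `P` and the other elements of `𝓠`. -/
noncomputable def exitHeight : ℝ := commHeight G H P (⋃₀ (𝓠 \ {P}))

/-- A communication height without any path is the infimum of the empty set, which is 0 by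
convention. The bound on the exit height excludes this default, so that a strict inequality really
provides a path. -/
theorem mem_valley_iff (hT : exitHeight G H 𝓠 P ≤ 0) {η : Ω} :
    η ∈ valley G H 𝓠 P ↔ ∃ p ∈ P, ∃ s < exitHeight G H 𝓠 P, Joined G H s p η := by
  have h1 : η ∈ valley G H 𝓠 P ↔ commHeight G H P {η} < exitHeight G H 𝓠 P := by
    unfold valley relDepth
    exact sub_lt_sub_iff_right (minEnergy H P)
  rw [h1]
  constructor
  · intro h
    obtain ⟨p, hp, q, hq, hj⟩ := exists_joined_of_commHeight_neg (h.trans_le hT)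
    rw [Set.mem_singleton_iff] at hq
    exact ⟨p, hp, _, h, hq ▸ hj⟩
  · rintro ⟨p, hp, s, hs, hj⟩
    exact (commHeight_le hp (Set.mem_singleton η) hj).trans_lt hs

theorem exitHeight_le {P' : Set Ω} (hP' : P' ∈ 𝓠) (hne : P' ≠ P) {p p' : Ω} (hp : p ∈ P)
    (hp' : p' ∈ P') {t : ℝ} (hj : Joined G H t p p') : exitHeight G H 𝓠 P ≤ t :=
  commHeight_le hp ⟨P', ⟨hP', hne⟩, hp'⟩ hj

theorem exists_joined_exitHeight (hT : exitHeight G H 𝓠 P < 0) :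
    ∃ p ∈ P, ∃ P' ∈ 𝓠, P' ≠ P ∧ ∃ p' ∈ P', Joined G H (exitHeight G H 𝓠 P) p p' := by
  obtain ⟨p, hp, p', ⟨P', ⟨hP', hne⟩, hp'⟩, hj⟩ := exists_joined_of_commHeight_neg hT
  exact ⟨p, hp, P', hP', hne, p', hp', hj⟩

theorem exitHeight_le_of_mem_boundary (hT : exitHeight G H 𝓠 P ≤ 0) {ζ : Ω}
    (hζ : ζ ∈ outerBoundary G (valley G H 𝓠 P)) : exitHeight G H 𝓠 P ≤ H ζ := by
  by_contra hlt
  rw [not_le] at hlt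
  obtain ⟨hζ, ξ, hξ, hadj⟩ := hζ
  obtain ⟨p, hp, s, hs, hj⟩ := (mem_valley_iff hT).1 hξ
  exact hζ ((mem_valley_iff hT).2 ⟨p, hp, max s (H ζ), max_lt hs hlt,
    (hj.mono (le_max_left _ _)).tail hadj.symm (le_max_right _ _)⟩)

theorem not_mem_valley_of_mem (hT : exitHeight G H 𝓠 P ≤ 0) {P' : Set Ω} (hP' : P' ∈ 𝓠)
    (hne : P' ≠ P) {p' : Ω} (hp' : p' ∈ P') : p' ∉ valley G H 𝓠 P := by
  intro h
  obtain ⟨p, hp, s, hs, hj⟩ := (mem_valley_iff hT).1 h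
  exact absurd (exitHeight_le hP' hne hp hp' hj) (not_le.2 hs)

/-- An optimal path to another element has to leave the valley, and does so at a boundary state no
higher than the exit height. No boundary state is lower, as it would belong to the valley. -/
theorem minEnergy_boundary_valley (hT : exitHeight G H 𝓠 P < 0)
    (hP : ∀ p ∈ P, H p < exitHeight G H 𝓠 P) :
    minEnergy H (outerBoundary G (valley G H 𝓠 P)) = exitHeight G H 𝓠 P := by
  obtain ⟨p, hp, P', hP', hne, p', hp', hj⟩ := exists_joined_exitHeight hT
  obtain ⟨ζ, hζ, hj'⟩ := hj.exists_boundary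
    ((mem_valley_iff hT.le).2 ⟨p, hp, H p, hP p hp, .refl le_rfl⟩)
    (not_mem_valley_of_mem hT.le hP' hne hp')
  have h1 : H ζ = exitHeight G H 𝓠 P :=
    le_antisymm hj'.right_le (exitHeight_le_of_mem_boundary hT.le hζ)
  rw [minEnergy_eq hζ fun ξ hξ => ?_, h1]
  rw [h1]
  exact exitHeight_le_of_mem_boundary hT.le hξ

/-- Through a common state the two elements would be joined below the larger of the two exit
heights, contradicting the definition of that height. -/
theorem eq_of_mem_valley_of_mem_valley {P' : Set Ω} (hP : P ∈ 𝓠) (hP' : P' ∈ 𝓠)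
    (hT : exitHeight G H 𝓠 P ≤ 0) (hT' : exitHeight G H 𝓠 P' ≤ 0) {η : Ω}
    (h : η ∈ valley G H 𝓠 P) (h' : η ∈ valley G H 𝓠 P') : P = P' := by
  by_contra hne
  obtain ⟨p, hp, s, hs, hj⟩ := (mem_valley_iff hT).1 h
  obtain ⟨p', hp', s', hs', hj'⟩ := (mem_valley_iff hT').1 h'
  have hj2 : Joined G H (max s s') p p' :=
    (hj.mono (le_max_left _ _)).trans (hj'.mono (le_max_right _ _)).symm
  have h1 := exitHeight_le hP' (Ne.symm hne) hp hp' hj2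
  have h2 := exitHeight_le hP hne hp' hp hj2.symm
  rcases max_cases s s' with ⟨h3, _⟩ | ⟨h3, _⟩ <;> rw [h3] at h1 h2 <;> linarith

end Valley

/-! ### Landscapes with the energy levels of the strips. -/

/-- A landscape whose ground states are the states `σ k`, with energy `e`. -/
structure StripLandscape {Ω ι : Type*} (G : SimpleGraph Ω) (H : Ω → ℝ) (σ : ι → Ω) (e : ℝ) :
    Prop where
  int : ∀ η, ∃ n : ℕ, H η = e + n
  inj : Function.Injective σ
  ground : ∀ η, H η = e ↔ ∃ k, η = σ k
  nbr : ∀ k η, G.Adj (σ k) η → e + 3 ≤ H η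
  -- Without a reachable level e+1 every reachable state at e+2 lies in a stable plateau: a lower
  -- neighbour would be a ground state, and `nbr` forbids this.
  gap : ∀ k η, Joined G H (e + 4) (σ k) η → H η ≠ e + 1
  -- All relevant heights are negative, hence differ from the value 0 that a communication height
  -- takes when there is no path. Connectedness of the whole graph is then not needed.
  neg : e + 4 < 0
  -- This state makes the smallest depth at level one equal to 1.
  near : ∃ k η, H η = e + 2 ∧ Joined G H (e + 3) (σ k) η
  -- This state makes the smallest depth at level two equal to 2, so that a third level is needed.
  far : ∃ k η, H η = e + 2 ∧ Joined G H (e + 4) (σ k) η ∧ ∀ k', ¬ Joined G H (e + 3) (σ k') η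
  sep : ∀ k k', k ≠ k' → ¬ Joined G H (e + 3) (σ k) (σ k')
  path : ∀ k k', k ≠ k' → Relation.ReflTransGen (fun a b => G.Adj a b ∧ H b ≤ e + 4 ∧
    ∀ l, l ≠ k → l ≠ k' → ¬ Joined G H (e + 3) (σ l) b) (σ k) (σ k')

namespace StripLandscape

set_option linter.unusedSectionVars false

variable {Ω ι : Type*} [Fintype Ω] [Nontrivial ι] {G : SimpleGraph Ω} {H : Ω → ℝ}
  {σ : ι → Ω} {e : ℝ} (hS : StripLandscape G H σ e)

include hS

theorem energy_strip (k : ι) : H (σ k) = e := (hS.ground _).2 ⟨k, rfl⟩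

theorem le_energy (η : Ω) : e ≤ H η := by
  obtain ⟨n, hn⟩ := hS.int η
  have := n.cast_nonneg (α := ℝ)
  linarith

theorem le_of_lt_add_one {η : Ω} {m : ℕ} (h : H η < e + (m + 1)) : H η ≤ e + m := by
  obtain ⟨n, hn⟩ := hS.int η
  rw [hn] at h ⊢
  have : (n : ℝ) < ((m + 1 : ℕ) : ℝ) := by push_cast; linarith
  have : n ≤ m := by have := Nat.cast_lt.1 this; omega
  have := Nat.cast_le (α := ℝ).2 this
  linarith

theorem le_three {η : Ω} (h : H η < e + 4) : H η ≤ e + 3 := by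
  have := hS.le_of_lt_add_one (η := η) (m := 3) (by push_cast; linarith)
  exact_mod_cast this

theorem le_two {η : Ω} (h : H η < e + 3) : H η ≤ e + 2 := by
  have := hS.le_of_lt_add_one (η := η) (m := 2) (by push_cast; linarith)
  exact_mod_cast this

theorem joined_three {t : ℝ} {η ξ : Ω} (ht : t < e + 4) (h : Joined G H t η ξ) :
    Joined G H (e + 3) η ξ :=
  ⟨hS.le_three (h.1.trans_lt ht), Relation.ReflTransGen.mono
    (fun _ _ hab => ⟨hab.1, hS.le_three (hab.2.trans_lt ht)⟩) _ _ h.2⟩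

theorem joined_two {t : ℝ} {η ξ : Ω} (ht : t < e + 3) (h : Joined G H t η ξ) :
    Joined G H (e + 2) η ξ :=
  ⟨hS.le_two (h.1.trans_lt ht), Relation.ReflTransGen.mono
    (fun _ _ hab => ⟨hab.1, hS.le_two (hab.2.trans_lt ht)⟩) _ _ h.2⟩

theorem joined_strips (k k' : ι) : Joined G H (e + 4) (σ k) (σ k') := by
  have h1 : H (σ k) ≤ e + 4 := by rw [hS.energy_strip]; linarith
  by_cases h : k = k'
  · subst h; exact .refl h1
  · exact ⟨h1, Relation.ReflTransGen.mono (fun _ _ hab => ⟨hab.1, hab.2.1⟩) _ _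
      (hS.path k k' h)⟩

theorem groundStates_eq : groundStates H = Set.range σ := by
  ext η
  constructor
  · rintro ⟨_, h⟩
    obtain ⟨k⟩ : Nonempty ι := inferInstance
    have h1 := h (σ k) trivial
    rw [hS.energy_strip] at h1
    obtain ⟨k', hk'⟩ := (hS.ground η).1 (le_antisymm h1 (hS.le_energy η))
    exact ⟨k', hk'.symm⟩
  · rintro ⟨k, rfl⟩
    refine ⟨trivial, fun ζ _ => ?_⟩
    rw [hS.energy_strip]
    exact hS.le_energy ζ

/-- The field `path` bounds every barrier by e+4. By integrality a lower one would be at most e+3,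
which `sep` excludes. -/
theorem maxBarrier_eq : maxBarrier G H = e + 4 := by
  unfold maxBarrier
  have hub : ∀ t ∈ {t | ∃ s ∈ groundStates H, ∃ s' ∈ groundStates H,
      t = commHeight G H {s} {s'}}, t ≤ e + 4 := by
    rintro t ⟨s, hs, s', hs', rfl⟩
    rw [hS.groundStates_eq] at hs hs'
    obtain ⟨k, rfl⟩ := hs
    obtain ⟨k', rfl⟩ := hs'
    exact commHeight_le rfl rfl (hS.joined_strips k k')
  obtain ⟨k, k', hne⟩ := exists_pair_ne ι
  have hmem : commHeight G H {σ k} {σ k'} ∈ {t | ∃ s ∈ groundStates H,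
      ∃ s' ∈ groundStates H, t = commHeight G H {s} {s'}} := by
    rw [hS.groundStates_eq]
    exact ⟨_, ⟨k, rfl⟩, _, ⟨k', rfl⟩, rfl⟩
  refine le_antisymm (csSup_le ⟨_, hmem⟩ hub) (le_trans ?_ (le_csSup ⟨_, hub⟩ hmem))
  refine le_commHeight rfl rfl (hS.joined_strips k k') ?_
  rintro a rfl b rfl r hr
  by_contra h
  exact hS.sep k k' hne (hS.joined_three (not_le.1 h) hr)

theorem mem_reachable_iff {η : Ω} :
    η ∈ reachable G H ↔ ∃ k, Joined G H (e + 4) (σ k) η := by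
  unfold reachable
  rw [Set.mem_ofPred_eq, hS.maxBarrier_eq, hS.groundStates_eq]
  constructor
  · intro h
    obtain ⟨a, ⟨k, rfl⟩, b, hb, hj⟩ := exists_joined_of_commHeight_neg (h.trans_lt hS.neg)
    rw [Set.mem_singleton_iff] at hb
    exact ⟨k, hb ▸ hj.mono h⟩
  · rintro ⟨k, hk⟩
    exact commHeight_le ⟨k, rfl⟩ rfl hk

theorem strip_mem_reachable (k : ι) : σ k ∈ reachable G H :=
  hS.mem_reachable_iff.2 ⟨k, hS.joined_strips k k⟩

theorem joined_of_mem_reachable {η : Ω} (h : η ∈ reachable G H) (k : ι) :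
    Joined G H (e + 4) η (σ k) := by
  obtain ⟨k', hk'⟩ := hS.mem_reachable_iff.1 h
  exact hk'.symm.trans (hS.joined_strips k' k)

theorem mem_reachable_of_joined {η ξ : Ω} {t : ℝ} (h : η ∈ reachable G H) (ht : t ≤ e + 4)
    (hj : Joined G H t η ξ) : ξ ∈ reachable G H := by
  obtain ⟨k, hk⟩ := hS.mem_reachable_iff.1 h
  exact hS.mem_reachable_iff.2 ⟨k, hk.trans (hj.mono ht)⟩

theorem energy_cases {η : Ω} (h : η ∈ reachable G H) :
    H η = e ∨ H η = e + 2 ∨ H η = e + 3 ∨ H η = e + 4 := by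
  obtain ⟨k, hk⟩ := hS.mem_reachable_iff.1 h
  have h1 := hS.gap k η hk
  have h2 := hk.right_le
  obtain ⟨n, hn⟩ := hS.int η
  rw [hn] at h1 h2 ⊢
  have h3 : n ≤ 4 := by
    have : (n : ℝ) ≤ (4 : ℕ) := by push_cast; linarith
    exact_mod_cast this
  interval_cases n
  · left; simp
  · exact absurd (by norm_num) h1
  · right; left; norm_num
  · right; right; left; norm_num
  · right; right; right; norm_num

end StripLandscape

end Metastable

/-! ### The first level. -/

namespace Metastable

namespace StripLandscape

set_option linter.unusedSectionVars false

variable {Ω ι : Type*} [Fintype Ω] [Nontrivial ι] {G : SimpleGraph Ω} {H : Ω → ℝ}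
  {σ : ι → Ω} {e : ℝ} (hS : StripLandscape G H σ e)

/-- The stable plateaux in the reachable set. -/
def stablePlateaux (G : SimpleGraph Ω) (H : Ω → ℝ) : Set (Set Ω) :=
  {P | IsStablePlateau G H P ∧ P ⊆ reachable G H}

include hS

/-- The states of energy at most `e + 2` lie in stable plateaux. -/
theorem plateau_mem {η : Ω} (hη : η ∈ reachable G H) (h : H η ≤ e + 2) :
    plateau G H η ∈ stablePlateaux G H := by
  have hsub : plateau G H η ⊆ reachable G H := fun ξ hξ =>
    hS.mem_reachable_of_joined hη (by linarith) (joined_of_mem_plateau hξ)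
  refine ⟨isStablePlateau_plateau fun ξ hξ ζ hadj => ?_, hsub⟩
  by_contra hlt
  rw [not_le] at hlt
  have hζ : ζ ∈ reachable G H := hS.mem_reachable_of_joined (hsub hξ) (t := e + 4) le_rfl
    (Joined.of_adj hadj (by rw [energy_of_mem_plateau hξ]; linarith) (by linarith))
  rcases hS.energy_cases hζ with h0 | h0 | h0 | h0
  · obtain ⟨k, rfl⟩ := (hS.ground ζ).1 h0
    have := hS.nbr k ξ hadj.symm
    rw [energy_of_mem_plateau hξ] at this
    linarith
  all_goals linarith

theorem strip_mem (k : ι) : {σ k} ∈ stablePlateaux G H := by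
  have h1 := hS.plateau_mem (hS.strip_mem_reachable k) (by rw [hS.energy_strip]; linarith)
  have h2 : plateau G H (σ k) = {σ k} := by
    ext ξ
    constructor
    · intro hξ
      rcases Relation.ReflTransGen.cases_head hξ with h | ⟨c, hc, _⟩
      · exact h.symm
      · have := hS.nbr k c hc.1
        rw [hc.2, hS.energy_strip] at this
        linarith
    · rintro rfl
      exact mem_plateau_self _
  rwa [h2] at h1

theorem eq_strip_of_mem {P : Set Ω} (hP : P ∈ stablePlateaux G H) {k : ι} (h : σ k ∈ P) :
    P = {σ k} := by
  rw [hP.1.eq_plateau h, (hS.strip_mem k).1.eq_plateau rfl]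

theorem eq_of_mem_mem {P P' : Set Ω} (hP : P ∈ stablePlateaux G H)
    (hP' : P' ∈ stablePlateaux G H) {p : Ω} (h : p ∈ P) (h' : p ∈ P') : P = P' := by
  rw [hP.1.eq_plateau h, hP'.1.eq_plateau h']

theorem exitHeight_le_four {P : Set Ω} (hP : P ∈ stablePlateaux G H) :
    exitHeight G H (stablePlateaux G H) P ≤ e + 4 := by
  obtain ⟨p, hp⟩ := hP.1.nonempty
  obtain ⟨k, hk⟩ : ∃ k, P ≠ {σ k} := by
    obtain ⟨k, k', hne⟩ := exists_pair_ne ι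
    by_cases h : P = {σ k}
    · refine ⟨k', ?_⟩
      rw [h]
      intro h'
      exact hne (hS.inj (Set.singleton_injective h'))
    · exact ⟨k, h⟩
  exact exitHeight_le (hS.strip_mem k) hk.symm hp rfl (hS.joined_of_mem_reachable (hP.2 hp) k)

theorem exitHeight_neg {P : Set Ω} (hP : P ∈ stablePlateaux G H) :
    exitHeight G H (stablePlateaux G H) P < 0 := (hS.exitHeight_le_four hP).trans_lt hS.neg

/-- A path of the least height to another stable plateau crosses the boundary. -/
theorem exists_boundary_le_exitHeight {P : Set Ω} (hP : P ∈ stablePlateaux G H) :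
    ∃ ζ ∈ outerBoundary G P, ζ ∈ reachable G H ∧
      H ζ ≤ exitHeight G H (stablePlateaux G H) P := by
  obtain ⟨p, hp, P', hP', hne, p', hp', hj⟩ := exists_joined_exitHeight (hS.exitHeight_neg hP)
  obtain ⟨ζ, hζ, hj'⟩ := hj.exists_boundary hp
    fun h => hne (hS.eq_of_mem_mem hP' hP hp' h)
  exact ⟨ζ, hζ, hS.mem_reachable_of_joined (hP.2 hp) (hS.exitHeight_le_four hP) hj',
    hj'.right_le⟩

/-- No stable plateau has energy e+4: its boundary would lie strictly higher, whereas an exit at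
height at most e+4 exists because the reachable set is joined at that height. -/
theorem energy_cases_of_mem {P : Set Ω} (hP : P ∈ stablePlateaux G H) {p : Ω} (hp : p ∈ P) :
    ((∃ k, P = {σ k}) ∧ H p = e) ∨ H p = e + 2 ∨ H p = e + 3 := by
  rcases hS.energy_cases (hP.2 hp) with h | h | h | h
  · obtain ⟨k, rfl⟩ := (hS.ground p).1 h
    exact .inl ⟨⟨k, hS.eq_strip_of_mem hP hp⟩, h⟩
  · exact .inr (.inl h)
  · exact .inr (.inr h)
  · obtain ⟨ζ, hζ, _, hle⟩ := hS.exists_boundary_le_exitHeight hP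
    have := hP.1.2.2 ζ hζ p hp
    have := hS.exitHeight_le_four hP
    linarith

theorem exitHeight_cases {P : Set Ω} (hP : P ∈ stablePlateaux G H) {p : Ω} (hp : p ∈ P) :
    (exitHeight G H (stablePlateaux G H) P = e + 3 ∧ H p ≤ e + 2) ∨
      exitHeight G H (stablePlateaux G H) P = e + 4 := by
  obtain ⟨ζ, hζ, hr, hle⟩ := hS.exists_boundary_le_exitHeight hP
  have h4 := hS.exitHeight_le_four hP
  have hlt := hP.1.2.2 ζ hζ p hp
  by_cases h : exitHeight G H (stablePlateaux G H) P < e + 4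
  · left
    have h3 : exitHeight G H (stablePlateaux G H) P ≤ e + 3 := by
      obtain ⟨p, hp, P', hP', hne, p', hp', hj⟩ :=
        exists_joined_exitHeight (hS.exitHeight_neg hP)
      exact exitHeight_le hP' hne hp hp' (hS.joined_three h hj)
    have h5 : e + 3 ≤ H ζ := by
      rcases hS.energy_cases_of_mem hP hp with ⟨⟨k, rfl⟩, _⟩ | h' | h'
      · obtain ⟨_, ξ, rfl, hadj⟩ := hζ
        exact hS.nbr k ζ hadj.symm
      · rcases hS.energy_cases hr with h | h | h | h <;> linarith
      · linarith
    refine ⟨le_antisymm h3 (h5.trans hle), hS.le_two (by linarith)⟩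
  · right
    linarith

theorem energy_lt_exitHeight {P : Set Ω} (hP : P ∈ stablePlateaux G H) {p : Ω} (hp : p ∈ P) :
    H p < exitHeight G H (stablePlateaux G H) P := by
  rcases hS.exitHeight_cases hP hp with h | h
  · linarith
  · rcases hS.energy_cases_of_mem hP hp with ⟨_, h'⟩ | h' | h' <;> linarith

theorem subset_valley {P : Set Ω} (hP : P ∈ stablePlateaux G H) :
    P ⊆ valley G H (stablePlateaux G H) P := fun p hp =>
  (mem_valley_iff (hS.exitHeight_neg hP).le).2
    ⟨p, hp, H p, hS.energy_lt_exitHeight hP hp, .refl le_rfl⟩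

theorem joined_of_mem_valley {P : Set Ω} (hP : P ∈ stablePlateaux G H) {η p : Ω} (hp : p ∈ P)
    (h : η ∈ valley G H (stablePlateaux G H) P) : Joined G H (e + 3) p η := by
  obtain ⟨p', hp', s, hs, hj⟩ := (mem_valley_iff (hS.exitHeight_neg hP).le).1 h
  have h1 := hS.exitHeight_le_four hP
  have h2 := hS.joined_three (by linarith) hj
  refine ((hP.1.joined hp hp').mono ?_).trans h2
  rw [hP.1.2.1 p hp p' hp']
  exact h2.left_le

/-- A plateau at energy e+3 is an entire component of {H ≤ e+3}. This dichotomy between plateaux at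
e+3 and lower ones is used throughout the level. -/
theorem eq_valley {P : Set Ω} (hP : P ∈ stablePlateaux G H) {p : Ω} (hp : p ∈ P)
    (h : H p = e + 3) {η : Ω} (hj : Joined G H (e + 3) p η) : η ∈ P :=
  hP.1.mem_of_joined hp (h ▸ hj)

/-- A state of the valley at energy at most e+2 lies in some stable plateau, and a valley meets no
plateau but its own. A state of the valley at e+3 can only tie with a plateau at e+3, which fills
its component. -/
theorem bottom_valley {P : Set Ω} (hP : P ∈ stablePlateaux G H) :
    bottom H (valley G H (stablePlateaux G H) P) = P ∧
      ∀ p ∈ P, minEnergy H (valley G H (stablePlateaux G H) P) = H p := by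
  have key : ∀ p ∈ P, ∀ η ∈ valley G H (stablePlateaux G H) P, H p ≤ H η ∧ (H η ≤ H p → η ∈ P) := by
    intro p hp η hη
    have hj := hS.joined_of_mem_valley hP hp hη
    have hηr := hS.mem_reachable_of_joined (hP.2 hp) (by linarith) hj
    by_cases h3 : H η ≤ e + 2
    · have hmem := hS.plateau_mem hηr h3
      by_cases heq : plateau G H η = P
      · have : η ∈ P := heq ▸ mem_plateau_self η
        exact ⟨(hP.1.2.1 p hp η this).le, fun _ => this⟩
      · exact absurd hη (not_mem_valley_of_mem (hS.exitHeight_neg hP).le hmem heq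
          (mem_plateau_self η))
    · have hη3 : H η = e + 3 := by
        have := hj.right_le
        rcases hS.energy_cases hηr with h | h | h | h <;> linarith
      constructor
      · rw [hη3]; exact hj.left_le
      · intro hle
        exact hS.eq_valley hP hp (le_antisymm hj.left_le (hη3 ▸ hle)) hj
  obtain ⟨p, hp⟩ := hP.1.nonempty
  have hmin : ∀ p ∈ P, minEnergy H (valley G H (stablePlateaux G H) P) = H p := fun p hp =>
    minEnergy_eq (hS.subset_valley hP hp) fun η hη => (key p hp η hη).1
  refine ⟨?_, hmin⟩
  ext η
  rw [mem_bottom_iff, hmin p hp]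
  constructor
  · rintro ⟨h1, h2⟩
    exact (key p hp η h1).2 h2.le
  · intro h
    exact ⟨hS.subset_valley hP h, hP.1.2.1 η h p hp⟩

theorem depth_valley {P : Set Ω} (hP : P ∈ stablePlateaux G H) {p : Ω} (hp : p ∈ P) :
    depth G H (valley G H (stablePlateaux G H) P) =
      exitHeight G H (stablePlateaux G H) P - H p := by
  unfold depth
  rw [minEnergy_boundary_valley (hS.exitHeight_neg hP) fun q hq => hS.energy_lt_exitHeight hP hq,
    (hS.bottom_valley hP).2 p hp]

theorem minEnergy_plateau {P : Set Ω} (hP : P ∈ stablePlateaux G H) {p : Ω} (hp : p ∈ P) :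
    minEnergy H P = H p := minEnergy_eq hp fun q hq => (hP.1.2.1 p hp q hq).le

theorem one_le_depth {P : Set Ω} (hP : P ∈ stablePlateaux G H) {p : Ω} (hp : p ∈ P) :
    1 ≤ exitHeight G H (stablePlateaux G H) P - H p := by
  rcases hS.exitHeight_cases hP hp with h | h
  · linarith
  · rcases hS.energy_cases_of_mem hP hp with ⟨_, h'⟩ | h' | h' <;> linarith

theorem minDepth_one : minDepth G H (stablePlateaux G H) = 1 := by
  unfold minDepth
  have hlow : ∀ x ∈ relDepth G H (stablePlateaux G H) '' stablePlateaux G H, 1 ≤ x := by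
    rintro _ ⟨P, hP, rfl⟩
    obtain ⟨p, hp⟩ := hP.1.nonempty
    have := hS.one_le_depth hP hp
    unfold relDepth
    rwa [hS.minEnergy_plateau hP hp]
  obtain ⟨k, η, hη, hj⟩ := hS.near
  have hr := hS.mem_reachable_of_joined (hS.strip_mem_reachable k) (by linarith) hj
  have hP := hS.plateau_mem hr hη.le
  have hne : {σ k} ≠ plateau G H η := by
    intro h
    have : η = σ k := by
      have := mem_plateau_self (G := G) (H := H) η
      rwa [← h] at this
    rw [this, hS.energy_strip] at hη
    linarith
  have h1 := exitHeight_le (hS.strip_mem k) hne (mem_plateau_self η) rfl hj.symm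
  have h2 : relDepth G H (stablePlateaux G H) (plateau G H η) ≤ 1 := by
    unfold relDepth
    rw [hS.minEnergy_plateau hP (mem_plateau_self η), hη]
    change exitHeight G H (stablePlateaux G H) (plateau G H η) - (e + 2) ≤ 1
    linarith
  refine le_antisymm ((csInf_le ⟨1, hlow⟩ ⟨_, hP, rfl⟩).trans h2) (le_csInf ⟨_, _, hP, rfl⟩ hlow)

omit hS in
theorem levelCycles_one : levelCycles G H (stablePlateaux G H) ∅ =
    valley G H (stablePlateaux G H) '' stablePlateaux G H := by
  unfold levelCycles
  simp

theorem disjointCycles_one : DisjointCycles H (levelCycles G H (stablePlateaux G H) ∅) := by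
  rw [levelCycles_one]
  constructor
  · rintro _ ⟨P, hP, rfl⟩
    rw [(hS.bottom_valley hP).1]
    exact hP.1.nonempty
  · rintro _ ⟨P, hP, rfl⟩ _ ⟨P', hP', rfl⟩ η h h'
    rw [eq_of_mem_valley_of_mem_valley hP hP' (hS.exitHeight_neg hP).le
      (hS.exitHeight_neg hP').le h h']

theorem deepCycles_one : deepCycles G H (levelCycles G H (stablePlateaux G H) ∅) 1 =
    levelCycles G H (stablePlateaux G H) ∅ := by
  unfold deepCycles
  rw [levelCycles_one]
  ext C
  constructor
  · exact fun h => h.1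
  · rintro ⟨P, hP, rfl⟩
    refine ⟨⟨P, hP, rfl⟩, ?_⟩
    obtain ⟨p, hp⟩ := hP.1.nonempty
    rw [hS.depth_valley hP hp]
    exact hS.one_le_depth hP hp

theorem bottom_image_one : bottom H '' levelCycles G H (stablePlateaux G H) ∅ =
    stablePlateaux G H := by
  rw [levelCycles_one, Set.image_image]
  ext P
  constructor
  · rintro ⟨P', hP', rfl⟩
    change bottom H _ ∈ _
    rwa [(hS.bottom_valley hP').1]
  · intro hP
    exact ⟨P, hP, (hS.bottom_valley hP).1⟩

theorem bottom_deepCycles_one :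
    bottom H '' deepCycles G H (levelCycles G H (stablePlateaux G H) ∅) 1 =
      stablePlateaux G H := by
  rw [hS.deepCycles_one, hS.bottom_image_one]

theorem cycleOf_one {P : Set Ω} (hP : P ∈ stablePlateaux G H) :
    cycleOf H (levelCycles G H (stablePlateaux G H) ∅) P =
      valley G H (stablePlateaux G H) P := by
  have h := hS.disjointCycles_one.cycleOf_bottom (C := valley G H (stablePlateaux G H) P)
    (by rw [levelCycles_one]; exact ⟨P, hP, rfl⟩)
  rwa [(hS.bottom_valley hP).1] at h

theorem outside_one_energy {η : Ω}
    (h : η ∈ outside G H (levelCycles G H (stablePlateaux G H) ∅)) :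
    H η = e + 3 ∨ H η = e + 4 := by
  by_contra hcon
  rw [not_or] at hcon
  have h2 : H η ≤ e + 2 := by
    rcases hS.energy_cases h.1 with h' | h' | h' | h'
    · linarith
    · exact h'.le
    · exact absurd h' hcon.1
    · exact absurd h' hcon.2
  have hP := hS.plateau_mem h.1 h2
  refine not_mem_of_outside h (C := valley G H (stablePlateaux G H) (plateau G H η)) ?_
    (hS.subset_valley hP (mem_plateau_self η))
  rw [levelCycles_one]
  exact ⟨_, hP, rfl⟩

theorem vertex_one_cases {v : Ω} {X : Ω ⊕ Set Ω}
    (h : IsVertexOf G H (levelCycles G H (stablePlateaux G H) ∅) v X) :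
    (v ∈ outside G H (levelCycles G H (stablePlateaux G H) ∅) ∧ X = .inl v) ∨
      ∃ P ∈ stablePlateaux G H, v ∈ valley G H (stablePlateaux G H) P ∧ X = .inr P := by
  rcases h with h | ⟨C, hC, hv, rfl⟩
  · exact .inl h
  · rw [levelCycles_one] at hC
    obtain ⟨P, hP, rfl⟩ := hC
    exact .inr ⟨P, hP, hv, by rw [(hS.bottom_valley hP).1]⟩

theorem valley_mem_one {P : Set Ω} (hP : P ∈ stablePlateaux G H) :
    valley G H (stablePlateaux G H) P ∈ levelCycles G H (stablePlateaux G H) ∅ := by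
  rw [levelCycles_one]
  exact ⟨P, hP, rfl⟩

theorem exists_vertex {v : Ω} {𝒞 : Set (Set Ω)} (hv : v ∈ reachable G H) :
    ∃ X, IsVertexOf G H 𝒞 v X := by
  by_cases h : v ∈ ⋃₀ 𝒞
  · obtain ⟨C, hC, hvC⟩ := h
    exact ⟨_, .inr ⟨C, hC, hvC, rfl⟩⟩
  · exact ⟨_, .inl ⟨⟨hv, h⟩, rfl⟩⟩

/-- The jump relation at the first level. -/
local notation "Jump₁" => Jump G H (levelCycles G H (stablePlateaux G H) ∅) 1

/-- The first level chain cannot leave a component of `{H ≤ e + 3}` with a state of energy at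
most `e + 2`. -/
theorem reach_one_closed {w y : Ω} (hy : Joined G H (e + 3) w y) (hy2 : H y ≤ e + 2)
    {X Y : Ω ⊕ Set Ω} (h : Relation.ReflTransGen Jump₁ X Y)
    (hX : (∃ η, X = .inl η ∧ Joined G H (e + 3) w η) ∨
      ∃ P ∈ stablePlateaux G H, X = .inr P ∧ ∃ p ∈ P, Joined G H (e + 3) w p) :
    (∃ η, Y = .inl η ∧ Joined G H (e + 3) w η) ∨
      ∃ P ∈ stablePlateaux G H, Y = .inr P ∧ ∃ p ∈ P, Joined G H (e + 3) w p := by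
  induction h with
  | refl => exact hX
  | @tail Y Z _ hYZ ih =>
    rcases ih with ⟨η, rfl, hη⟩ | ⟨P, hP, rfl, p, hp, hj⟩
    · rcases Z with ξ | P
      · obtain ⟨_, _, hadj, hle⟩ := jump_inl_inl.1 hYZ
        exact .inl ⟨ξ, rfl, hη.tail hadj (hle.trans hη.right_le)⟩
      · obtain ⟨_, hP, hbd⟩ := jump_inl_inr.1 hYZ
        rw [hS.bottom_image_one] at hP
        rw [hS.cycleOf_one hP] at hbd
        obtain ⟨_, ζ, hζ, hadj⟩ := hbd
        obtain ⟨p, hp⟩ := hP.1.nonempty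
        have hj := hS.joined_of_mem_valley hP hp hζ
        exact .inr ⟨P, hP, rfl, p, hp, (hη.tail hadj hj.right_le).trans hj.symm⟩
    · rcases Z with ξ | P'
      · obtain ⟨_, _, hd, hbd⟩ := (jump_inr_inl hP.1.nonempty).1 hYZ
        rw [hS.cycleOf_one hP] at hd hbd
        rw [hS.depth_valley hP hp] at hd
        -- A plateau at e+3 would fill the component, which contains y. Hence the plateau is at most
        -- at e+2, and depth at most 1 allows an exit at e+3 only.
        have hp2 : H p ≤ e + 2 := by
          rcases hS.energy_cases_of_mem hP hp with ⟨_, h'⟩ | h' | h'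
          · linarith
          · exact h'.le
          · have := hS.eq_valley hP hp h' (hj.symm.trans hy)
            rwa [hP.1.2.1 p hp y this]
        have hξ : H ξ ≤ e + 3 := by
          rw [(mem_bottom_iff.1 hbd).2, minEnergy_boundary_valley (hS.exitHeight_neg hP)
            fun q hq => hS.energy_lt_exitHeight hP hq]
          linarith
        obtain ⟨_, ζ, hζ, hadj⟩ := hbd.1
        exact .inl ⟨ξ, rfl, (hj.trans (hS.joined_of_mem_valley hP hp hζ)).tail hadj.symm hξ⟩
      · exact absurd hYZ not_jump_inr_inr

/-- From a component of `{H ≤ e + 3}` with a state of energy at most `e + 2` the first level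
chain reaches a stable plateau of energy at most `e + 2`. -/
theorem reach_one_low {v y : Ω} (hv : v ∈ reachable G H) (hj : Joined G H (e + 3) v y)
    (hy : H y ≤ e + 2) {X : Ω ⊕ Set Ω}
    (hX : IsVertexOf G H (levelCycles G H (stablePlateaux G H) ∅) v X) :
    ∃ P ∈ stablePlateaux G H, (∀ p ∈ P, H p ≤ e + 2) ∧
      Relation.ReflTransGen Jump₁ X (.inr P) := by
  have key : ∃ P ∈ stablePlateaux G H, (∃ p ∈ P, Joined G H (e + 3) v p) ∧
      Relation.ReflTransGen Jump₁ X (.inr P) := by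
    obtain ⟨hv3, hpath⟩ := hj
    induction hpath using Relation.ReflTransGen.head_induction_on generalizing X with
    | refl =>
      rcases hS.vertex_one_cases hX with ⟨h1, h2⟩ | ⟨P, hP, hvP, rfl⟩
      · rcases hS.outside_one_energy h1 with h | h <;> linarith
      · obtain ⟨p, hp⟩ := hP.1.nonempty
        exact ⟨P, hP, ⟨p, hp, (hS.joined_of_mem_valley hP hp hvP).symm⟩, .refl⟩
    | @head a b hab hb ih =>
      rcases hS.vertex_one_cases hX with ⟨h1, rfl⟩ | ⟨P, hP, hvP, rfl⟩
      · have hjab : Joined G H (e + 3) a b := Joined.of_adj hab.1 hv3 hab.2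
        have hbr : b ∈ reachable G H := hS.mem_reachable_of_joined hv (by linarith) hjab
        obtain ⟨Y, hY⟩ := hS.exists_vertex
          (𝒞 := levelCycles G H (stablePlateaux G H) ∅) hbr
        obtain ⟨P, hP, ⟨p, hp, hjp⟩, hr⟩ := ih hbr hY hab.2
        refine ⟨P, hP, ⟨p, hp, hjab.trans hjp⟩, .head ?_ hr⟩
        rcases hY with ⟨h2, rfl⟩ | ⟨C, hC, hbC, rfl⟩
        · refine jump_inl_inl.2 ⟨h1, h2, hab.1, ?_⟩
          rcases hS.outside_one_energy h1 with h | h <;> linarith [hab.2]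
        · exact hS.disjointCycles_one.jump_enter h1 hC hbC hab.1
      · obtain ⟨p, hp⟩ := hP.1.nonempty
        exact ⟨P, hP, ⟨p, hp, (hS.joined_of_mem_valley hP hp hvP).symm⟩, .refl⟩
  obtain ⟨P, hP, ⟨p, hp, hjp⟩, hr⟩ := key
  refine ⟨P, hP, fun q hq => ?_, hr⟩
  rw [hP.1.2.1 q hq p hp]
  rcases hS.energy_cases_of_mem hP hp with ⟨_, h⟩ | h | h
  · linarith
  · exact h.le
  · rw [hP.1.2.1 p hp y (hS.eq_valley hP hp h (hjp.symm.trans hj))]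
    exact hy

/-- A component of `{H ≤ e + 3}` without states of energy at most `e + 2` is a stable plateau. -/
theorem plateau_of_high {v : Ω} (hv : v ∈ reachable G H) (h3 : H v ≤ e + 3)
    (hhigh : ∀ y, Joined G H (e + 3) v y → ¬ H y ≤ e + 2) :
    H v = e + 3 ∧ {ξ | Joined G H (e + 3) v ξ} ∈ stablePlateaux G H := by
  have hE : ∀ y, Joined G H (e + 3) v y → H y = e + 3 := by
    intro y hy
    have h1 := hhigh y hy
    have h2 := hy.right_le
    rcases hS.energy_cases (hS.mem_reachable_of_joined hv (by linarith) hy) with h | h | h | h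
    · exact absurd (by linarith) h1
    · exact absurd h.le h1
    · exact h
    · linarith
  have hv3 := hE v (.refl h3)
  have heq : {ξ | Joined G H (e + 3) v ξ} = plateau G H v := by
    ext ξ
    constructor
    · intro hξ
      have : ∀ ξ, Relation.ReflTransGen (fun a b => G.Adj a b ∧ H b ≤ e + 3) v ξ →
          ξ ∈ plateau G H v := by
        intro ξ h
        induction h with
        | refl => exact mem_plateau_self v
        | @tail b c hb hbc ih =>
          refine Relation.ReflTransGen.tail ih ⟨hbc.1, ?_⟩
          rw [hv3]
          exact hE c ⟨h3, hb.tail hbc⟩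
      exact this ξ hξ.2
    · intro hξ
      exact hv3 ▸ joined_of_mem_plateau hξ
  refine ⟨hv3, ?_⟩
  rw [heq]
  refine ⟨isStablePlateau_plateau fun ξ hξ ζ hadj => ?_, ?_⟩
  · by_contra hlt
    rw [not_le] at hlt
    have hj : Joined G H (e + 3) v ξ := by rw [← heq] at hξ; exact hξ
    have := hE ζ (hj.tail hadj (by linarith))
    linarith
  · rw [← heq]
    exact fun ξ hξ => hS.mem_reachable_of_joined hv (by linarith) hξ

/-- From every vertex the first level chain reaches a stable plateau of energy at most `e + 2`. -/
theorem reach_one {v : Ω} (hv : v ∈ reachable G H) {X : Ω ⊕ Set Ω}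
    (hX : IsVertexOf G H (levelCycles G H (stablePlateaux G H) ∅) v X) :
    ∃ P ∈ stablePlateaux G H, (∀ p ∈ P, H p ≤ e + 2) ∧
      Relation.ReflTransGen Jump₁ X (.inr P) := by
  obtain ⟨k⟩ : Nonempty ι := inferInstance
  obtain ⟨hv4, hpath⟩ := hS.joined_of_mem_reachable hv k
  induction hpath using Relation.ReflTransGen.head_induction_on generalizing X with
  | refl =>
    have h := hS.energy_strip k
    exact hS.reach_one_low hv (.refl (by linarith)) (by linarith) hX
  | @head a b hab hb ih =>
    have hbr : b ∈ reachable G H :=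
      hS.mem_reachable_of_joined hv le_rfl (Joined.of_adj hab.1 hv4 hab.2)
    obtain ⟨Y, hY⟩ := hS.exists_vertex (𝒞 := levelCycles G H (stablePlateaux G H) ∅) hbr
    by_cases hlow : ∃ y, Joined G H (e + 3) a y ∧ H y ≤ e + 2
    · obtain ⟨y, hy, hy2⟩ := hlow
      exact hS.reach_one_low hv hy hy2 hX
    · obtain ⟨P, hP, hP2, hr⟩ := ih hbr hY hab.2
      by_cases ha3 : H a ≤ e + 3
      -- The component of a in {H ≤ e+3} is itself a stable plateau W, of depth at most 1, so it may
      -- be left at e+4. The induction hypothesis is applied to the next state of the path, inside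
      -- or outside W.
      · push Not at hlow
        obtain ⟨haE, hW⟩ := hS.plateau_of_high hv ha3 fun y hy => not_le.2 (hlow y hy)
        set W := {ξ | Joined G H (e + 3) a ξ} with hWdef
        have haW : a ∈ W := Joined.refl ha3
        have hXW : X = .inr W := by
          rcases hS.vertex_one_cases hX with ⟨h1, _⟩ | ⟨P', hP', haP', rfl⟩
          · exact absurd (hS.subset_valley hW haW)
              (not_mem_of_outside h1 (hS.valley_mem_one hW))
          · rw [eq_of_mem_valley_of_mem_valley hP' hW (hS.exitHeight_neg hP').le
              (hS.exitHeight_neg hW).le haP' (hS.subset_valley hW haW)]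
        subst hXW
        rcases hS.vertex_one_cases hY with ⟨h1, rfl⟩ | ⟨P', hP', hbP', rfl⟩
        · refine ⟨P, hP, hP2, .head ?_ hr⟩
          have hb4 : H b = e + 4 := by
            have hbW : b ∉ W := fun h =>
              not_mem_of_outside h1 (hS.valley_mem_one hW) (hS.subset_valley hW h)
            rcases hS.outside_one_energy h1 with h | h
            · exact absurd (Joined.of_adj hab.1 ha3 h.le) hbW
            · exact h
          have := hS.disjointCycles_one.jump_exit (Γ := 1) h1 (hS.valley_mem_one hW)
            (hS.subset_valley hW haW) hab.1 (by
              rw [hS.depth_valley hW haW]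
              linarith [hS.exitHeight_le_four hW]) (by
              intro u hu
              have h5 := exitHeight_le_of_mem_boundary (hS.exitHeight_neg hW).le hu
              rcases hS.exitHeight_cases hW haW with h | h <;> linarith)
          rwa [(hS.bottom_valley hW).1] at this
        · have hb3 : H b ≤ e + 3 := by
            obtain ⟨p, hp⟩ := hP'.1.nonempty
            exact (hS.joined_of_mem_valley hP' hp hbP').right_le
          have hbW : b ∈ W := Joined.of_adj hab.1 ha3 hb3
          have : P' = W := eq_of_mem_valley_of_mem_valley hP' hW (hS.exitHeight_neg hP').le
              (hS.exitHeight_neg hW).le hbP' (hS.subset_valley hW hbW)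
          subst this
          exact ⟨P, hP, hP2, hr⟩
      · refine ⟨P, hP, hP2, .head ?_ hr⟩
        rcases hX with ⟨h1, rfl⟩ | ⟨C, hC, haC, rfl⟩
        · rcases hY with ⟨h2, rfl⟩ | ⟨C, hC, hbC, rfl⟩
          · refine jump_inl_inl.2 ⟨h1, h2, hab.1, ?_⟩
            rcases hS.outside_one_energy h1 with h | h <;> linarith [hab.2]
          · exact hS.disjointCycles_one.jump_enter h1 hC hbC hab.1
        · rw [levelCycles_one] at hC
          obtain ⟨P', hP', rfl⟩ := hC
          obtain ⟨p, hp⟩ := hP'.1.nonempty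
          exact absurd (hS.joined_of_mem_valley hP' hp haC).right_le ha3

/-- Two stable plateaux in a component of `{H ≤ e + 3}`: the first level chain started at one of
them reaches the other one or a ground state of the component. -/
theorem reach_one_of_joined {P P' : Set Ω} (hP : P ∈ stablePlateaux G H)
    (hP' : P' ∈ stablePlateaux G H) (hne : P ≠ P') {p p' : Ω} (hp : p ∈ P) (hp' : p' ∈ P')
    (hj : Joined G H (e + 3) p p') :
    Relation.ReflTransGen Jump₁ (.inr P) (.inr P') ∨
      ∃ k, Joined G H (e + 3) p (σ k) ∧ Relation.ReflTransGen Jump₁ (.inr P) (.inr {σ k}) := by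
  have hT : ∀ Q ∈ stablePlateaux G H, ∀ q ∈ Q, Joined G H (e + 3) p q →
      exitHeight G H (stablePlateaux G H) Q = e + 3 := by
    intro Q hQ q hq hjq
    have hle : exitHeight G H (stablePlateaux G H) Q ≤ e + 3 := by
      by_cases h : P = Q
      · exact exitHeight_le hP' (h ▸ hne.symm) hq hp' (hjq.symm.trans hj)
      · exact exitHeight_le hP h hq hp hjq.symm
    rcases hS.exitHeight_cases hQ hq with h | h <;> linarith
  have hQ2 : ∀ Q ∈ stablePlateaux G H, ∀ q ∈ Q, Joined G H (e + 3) p q → H q ≤ e + 2 := by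
    intro Q hQ q hq hjq
    rcases hS.exitHeight_cases hQ hq with h | h
    · exact h.2
    · rw [hT Q hQ q hq hjq] at h; linarith
  have hAt : ∀ v, Joined G H (e + 3) p v →
      AtLevel G H (levelCycles G H (stablePlateaux G H) ∅) (e + 3) v := by
    intro v hv
    have hvr := hS.mem_reachable_of_joined (hP.2 hp) (by linarith) hv
    by_cases hvo : v ∈ outside G H (levelCycles G H (stablePlateaux G H) ∅)
    · refine .inl ⟨hvo, ?_⟩
      rcases hS.outside_one_energy hvo with h | h
      · exact h
      · linarith [hv.right_le]
    · have : v ∈ ⋃₀ levelCycles G H (stablePlateaux G H) ∅ := by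
        by_contra h
        exact hvo ⟨hvr, h⟩
      rw [levelCycles_one] at this
      obtain ⟨_, ⟨Q, hQ, rfl⟩, hvQ⟩ := this
      obtain ⟨q, hq⟩ := hQ.1.nonempty
      have hTQ := hT Q hQ q hq (hv.trans (hS.joined_of_mem_valley hQ hq hvQ).symm)
      refine .inr ⟨_, hS.valley_mem_one hQ, hvQ, fun u hu => ?_, fun u hu => ?_⟩
      · obtain ⟨_, _, s, hs, hju⟩ := (mem_valley_iff (hS.exitHeight_neg hQ).le).1 hu
        exact hju.right_le.trans_lt (hTQ ▸ hs)
      · rw [← hTQ]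
        exact exitHeight_le_of_mem_boundary (hS.exitHeight_neg hQ).le hu
  -- Strips are too deep to be left at this level, so the path is stopped at the first strip or at
  -- its goal.
  obtain ⟨c, hc, hr⟩ := exists_first_visit (P' ∪ Set.range σ) hj.2 (.inl hp')
  have hpj : ∀ v, Relation.ReflTransGen (fun x y => (G.Adj x y ∧ H y ≤ e + 3) ∧
      x ∉ P' ∪ Set.range σ) p v → Joined G H (e + 3) p v := fun v hv =>
    ⟨hj.left_le, Relation.ReflTransGen.mono (fun _ _ h => h.1) _ _ hv⟩
  have hr' : Relation.ReflTransGen (fun a b => G.Adj a b ∧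
      AtLevel G H (levelCycles G H (stablePlateaux G H) ∅) (e + 3) a ∧
      AtLevel G H (levelCycles G H (stablePlateaux G H) ∅) (e + 3) b ∧
      (∀ C ∈ levelCycles G H (stablePlateaux G H) ∅, a ∈ C → depth G H C ≤ 1) ∧ True) p c := by
    clear hc
    induction hr with
    | refl => exact .refl
    | @tail a b ha hab ih =>
      refine ih.tail ⟨hab.1.1, hAt a (hpj a ha), hAt b (hpj b (ha.tail hab)), ?_, trivial⟩
      intro C hC haC
      rw [levelCycles_one] at hC
      obtain ⟨Q, hQ, rfl⟩ := hC
      obtain ⟨q, hq⟩ := hQ.1.nonempty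
      have hjq := (hpj a ha).trans (hS.joined_of_mem_valley hQ hq haC).symm
      have hTQ := hT Q hQ q hq hjq
      rw [hS.depth_valley hQ hq, hTQ]
      rcases hS.energy_cases_of_mem hQ hq with ⟨⟨k, rfl⟩, h⟩ | h | h
      -- With exit height e+3 the valley of a strip is the strip alone, since its neighbours are at
      -- e+3 or higher. Then a would itself be a strip, where the path has already been stopped.
      · exfalso
        obtain ⟨q', hq', s, hs, hja⟩ := (mem_valley_iff (hS.exitHeight_neg hQ).le).1 haC
        rw [Set.mem_singleton_iff] at hq'
        subst hq'
        rw [hTQ] at hs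
        have hj2 := hS.joined_two hs hja
        rcases Relation.ReflTransGen.cases_head hj2.2 with h' | ⟨c, hc, _⟩
        · exact hab.2 (.inr ⟨k, h'⟩)
        · have := hS.nbr k c hc.1
          linarith [hc.2]
      · linarith
      · linarith
  have hPv : IsVertexOf G H (levelCycles G H (stablePlateaux G H) ∅) p (.inr P) :=
    .inr ⟨_, hS.valley_mem_one hP, hS.subset_valley hP hp, by rw [(hS.bottom_valley hP).1]⟩
  obtain ⟨Y, hY, hreach⟩ := hS.disjointCycles_one.follow (fun _ => True) hr' hPv
  have hreach' : Relation.ReflTransGen Jump₁ (.inr P) Y :=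
    Relation.ReflTransGen.mono (fun _ _ h => h.2) _ _ hreach
  have hYeq : ∀ Q ∈ stablePlateaux G H, c ∈ Q → Y = .inr Q := by
    intro Q hQ hcQ
    rcases hS.vertex_one_cases hY with ⟨h1, _⟩ | ⟨Q', hQ', hcQ', rfl⟩
    · exact absurd (hS.subset_valley hQ hcQ) (not_mem_of_outside h1 (hS.valley_mem_one hQ))
    · rw [eq_of_mem_valley_of_mem_valley hQ' hQ (hS.exitHeight_neg hQ').le
        (hS.exitHeight_neg hQ).le hcQ' (hS.subset_valley hQ hcQ)]
  rcases hc with hc | ⟨k, rfl⟩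
  · left
    rwa [hYeq P' hP' hc] at hreach'
  · right
    refine ⟨k, hpj _ hr, ?_⟩
    rwa [hYeq {σ k} (hS.strip_mem k) rfl] at hreach'

/-- The valley of a strip has depth 3 or 4, more than the threshold 1, so all its outgoing rates
vanish. -/
theorem accessible_one_strip (k : ι) :
    accessible G H (levelCycles G H (stablePlateaux G H) ∅) 1 {σ k} = {{σ k}} := by
  unfold accessible
  rw [hS.bottom_deepCycles_one]
  ext P
  constructor
  · rintro ⟨_, h⟩
    rcases Relation.ReflTransGen.cases_head h with h | ⟨c, hc, _⟩
    · exact (Sum.inr.inj h).symm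
    · rcases c with η | P'
      · obtain ⟨_, _, hd, _⟩ := (jump_inr_inl (Set.singleton_nonempty _)).1 hc
        rw [hS.cycleOf_one (hS.strip_mem k), hS.depth_valley (hS.strip_mem k) rfl,
          hS.energy_strip] at hd
        rcases hS.exitHeight_cases (hS.strip_mem k) rfl with h' | h' <;> linarith
      · exact absurd hc not_jump_inr_inr
  · rintro rfl
    exact ⟨hS.strip_mem k, .refl⟩

/-- If there is only one plateau in the component nothing is to be done. Otherwise all exit heights
in it are e+3 and the chain moves freely inside, without being able to leave since it never climbs
to e+4. -/
theorem accessible_one {w : Ω} (hw : H w = e + 2) (hns : ∀ k, ¬ Joined G H (e + 3) w (σ k))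
    {P : Set Ω} (hP : P ∈ stablePlateaux G H) {p : Ω} (hp : p ∈ P)
    (hj : Joined G H (e + 3) w p) :
    accessible G H (levelCycles G H (stablePlateaux G H) ∅) 1 P =
      {P' ∈ stablePlateaux G H | ∃ p' ∈ P', Joined G H (e + 3) w p'} := by
  unfold accessible
  rw [hS.bottom_deepCycles_one]
  ext P'
  constructor
  · rintro ⟨hP', h⟩
    refine ⟨hP', ?_⟩
    have hw0 : Joined G H (e + 3) w w := .refl (by linarith)
    rcases hS.reach_one_closed hw0 hw.le h (.inr ⟨P, hP, rfl, p, hp, hj⟩) with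
      ⟨η, h, _⟩ | ⟨Q, _, h, hQ⟩
    · exact absurd h (by simp)
    · rwa [Sum.inr.inj h]
  · rintro ⟨hP', p', hp', hj'⟩
    refine ⟨hP', ?_⟩
    by_cases hne : P = P'
    · rw [hne]
    · rcases hS.reach_one_of_joined hP hP' hne hp hp' (hj.symm.trans hj') with h | ⟨k, hk, _⟩
      · exact h
      · exact absurd (hj.trans hk) (hns k)

/-- From any plateau the chain descends to one at energy at most e+2. If a strip is within reach at
height e+3, it goes on to an absorbing strip; if not, the plateaux of the component form a closed
class. -/
theorem levelComponents_one {𝒜 : Set (Set Ω)} :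
    𝒜 ∈ levelComponents G H (stablePlateaux G H) ∅ ↔ (∃ k, 𝒜 = {{σ k}}) ∨
      ∃ w ∈ reachable G H, H w = e + 2 ∧ (∀ k, ¬ Joined G H (e + 3) w (σ k)) ∧
        𝒜 = {P' ∈ stablePlateaux G H | ∃ p' ∈ P', Joined G H (e + 3) w p'} := by
  unfold levelComponents
  rw [Set.mem_ofPred_eq, hS.minDepth_one, isIrreducibleComponent_iff, hS.bottom_deepCycles_one]
  constructor
  · rintro ⟨⟨P, hPA⟩, hsub, hall⟩
    have hP := hsub hPA
    obtain ⟨p, hp⟩ := hP.1.nonempty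
    obtain ⟨P', hP', hlow, hreach⟩ := hS.reach_one (hP.2 hp)
      (.inr ⟨_, hS.valley_mem_one hP, hS.subset_valley hP hp, by rw [(hS.bottom_valley hP).1]⟩)
    have hP'A : P' ∈ 𝒜 := by
      rw [hall P hPA]
      exact ⟨by rwa [hS.bottom_deepCycles_one], hreach⟩
    obtain ⟨w, hw⟩ := hP'.1.nonempty
    have hstrip : ∀ k, {σ k} ∈ 𝒜 → 𝒜 = {{σ k}} := fun k hk => by
      rw [hall _ hk, hS.accessible_one_strip]
    rcases hS.energy_cases_of_mem hP' hw with ⟨⟨k, rfl⟩, _⟩ | h | h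
    · exact .inl ⟨k, hstrip k hP'A⟩
    · by_cases hs : ∃ k, Joined G H (e + 3) w (σ k)
      · obtain ⟨k, hk⟩ := hs
        have hne : P' ≠ {σ k} := by
          rintro rfl
          rw [Set.mem_singleton_iff] at hw
          rw [hw, hS.energy_strip] at h
          linarith
        have : ∃ l, Relation.ReflTransGen Jump₁ (.inr P') (.inr {σ l}) := by
          rcases hS.reach_one_of_joined hP' (hS.strip_mem k) hne hw rfl hk with h' | ⟨l, _, h'⟩
          · exact ⟨k, h'⟩
          · exact ⟨l, h'⟩
        obtain ⟨l, hl⟩ := this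
        refine .inl ⟨l, hstrip l ?_⟩
        rw [hall P' hP'A]
        exact ⟨by rw [hS.bottom_deepCycles_one]; exact hS.strip_mem l, hl⟩
      · push Not at hs
        refine .inr ⟨w, hP'.2 hw, h, hs, ?_⟩
        rw [hall P' hP'A]
        exact hS.accessible_one h hs hP' hw (.refl (by linarith))
    · linarith [hlow w hw]
  · rintro (⟨k, rfl⟩ | ⟨w, hwr, hw, hns, rfl⟩)
    · refine ⟨Set.singleton_nonempty _, ?_, ?_⟩
      · rintro _ rfl
        exact hS.strip_mem k
      · rintro _ rfl
        rw [hS.accessible_one_strip]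
    · refine ⟨⟨plateau G H w, hS.plateau_mem hwr hw.le, w, mem_plateau_self w,
        .refl (by linarith)⟩, fun _ h => h.1, ?_⟩
      rintro P ⟨hP, p, hp, hj⟩
      rw [hS.accessible_one hw hns hP hp hj]

end StripLandscape

end Metastable

/-! ### The second and third levels: components of {H ≤ e + 3}. -/

namespace Metastable

namespace StripLandscape

set_option linter.unusedSectionVars false

variable {Ω ι : Type*} [Fintype Ω] [Nontrivial ι] {G : SimpleGraph Ω} {H : Ω → ℝ}
  {σ : ι → Ω} {e : ℝ} (hS : StripLandscape G H σ e)

/-- The connected components of `{H ≤ t}` in the reachable set. -/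
def basins (G : SimpleGraph Ω) (H : Ω → ℝ) (t : ℝ) : Set (Set Ω) :=
  {C | ∃ w ∈ reachable G H, H w ≤ t ∧ C = {ξ | Joined G H t w ξ}}

include hS

omit hS in
theorem mem_basins {t : ℝ} {w : Ω} (hw : w ∈ reachable G H) (h : H w ≤ t) :
    {ξ | Joined G H t w ξ} ∈ basins G H t := ⟨w, hw, h, rfl⟩

omit hS in
theorem basin_eq {t : ℝ} {C : Set Ω} (hC : C ∈ basins G H t) {η : Ω} (hη : η ∈ C) :
    C = {ξ | Joined G H t η ξ} := by
  obtain ⟨w, _, _, rfl⟩ := hC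
  ext ξ
  exact ⟨fun h => (Joined.symm hη).trans h, fun h => Joined.trans hη h⟩

omit hS in
theorem basin_nonempty {t : ℝ} {C : Set Ω} (hC : C ∈ basins G H t) : C.Nonempty := by
  obtain ⟨w, _, h, rfl⟩ := hC
  exact ⟨w, .refl h⟩

omit hS in
theorem basin_eq_of_mem {t : ℝ} {C C' : Set Ω} (hC : C ∈ basins G H t) (hC' : C' ∈ basins G H t)
    {η : Ω} (h : η ∈ C) (h' : η ∈ C') : C = C' := by
  rw [basin_eq hC h, basin_eq hC' h']

theorem basin_subset {C : Set Ω} (hC : C ∈ basins G H (e + 3)) : C ⊆ reachable G H := by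
  obtain ⟨w, hw, _, rfl⟩ := hC
  exact fun ξ hξ => hS.mem_reachable_of_joined hw (by linarith) hξ

omit hS in
theorem basin_energy_le {t : ℝ} {C : Set Ω} (hC : C ∈ basins G H t) {η : Ω} (h : η ∈ C) :
    H η ≤ t := by
  rw [basin_eq hC h] at h
  exact Joined.right_le h

omit hS in
theorem bottom_nonempty {C : Set Ω} (hC : C.Nonempty) : (bottom H C).Nonempty := by
  obtain ⟨η, h1, h2⟩ := Set.exists_min_image C H (Set.toFinite C) hC
  exact ⟨η, h1, h2⟩

omit hS in
theorem disjointCycles_basins {t : ℝ} : DisjointCycles H (basins G H t) :=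
  ⟨fun _ hC => bottom_nonempty (basin_nonempty hC),
    fun _ hC _ hC' _ h h' => basin_eq_of_mem hC hC' h h'⟩

theorem strip_basin_mem (k : ι) : {ξ | Joined G H (e + 3) (σ k) ξ} ∈ basins G H (e + 3) :=
  mem_basins (hS.strip_mem_reachable k) (by rw [hS.energy_strip]; linarith)

theorem strip_mem_basin (k : ι) : σ k ∈ {ξ | Joined G H (e + 3) (σ k) ξ} :=
  Joined.refl (by rw [hS.energy_strip]; linarith)

theorem bottom_strip_basin (k : ι) : bottom H {ξ | Joined G H (e + 3) (σ k) ξ} = {σ k} := by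
  ext η
  constructor
  · rintro ⟨h1, h2⟩
    have h3 := h2 (σ k) (hS.strip_mem_basin k)
    rw [hS.energy_strip] at h3
    obtain ⟨k', rfl⟩ := (hS.ground η).1 (le_antisymm h3 (hS.le_energy η))
    by_contra hne
    exact hS.sep k k' (fun h => hne (h ▸ rfl)) h1
  · rintro rfl
    refine ⟨hS.strip_mem_basin k, fun ζ _ => ?_⟩
    rw [hS.energy_strip]
    exact hS.le_energy ζ

theorem minEnergy_strip_basin (k : ι) : minEnergy H {ξ | Joined G H (e + 3) (σ k) ξ} = e := by
  rw [minEnergy_eq (hS.strip_mem_basin k), hS.energy_strip]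
  intro ξ _
  rw [hS.energy_strip]
  exact hS.le_energy ξ

theorem exists_strip_basin_ne (C : Set Ω) : ∃ k, {ξ | Joined G H (e + 3) (σ k) ξ} ≠ C := by
  obtain ⟨k, k', hne⟩ := exists_pair_ne ι
  by_cases h : {ξ | Joined G H (e + 3) (σ k) ξ} = C
  · refine ⟨k', fun h' => hS.sep k k' hne ?_⟩
    have := hS.strip_mem_basin k'
    rw [h', ← h] at this
    exact this
  · exact ⟨k, h⟩

theorem outside_basins {η : Ω} :
    η ∈ outside G H (basins G H (e + 3)) ↔ η ∈ reachable G H ∧ H η = e + 4 := by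
  constructor
  · intro h
    refine ⟨h.1, ?_⟩
    by_contra hne
    have h3 : H η ≤ e + 3 := by
      rcases hS.energy_cases h.1 with h' | h' | h' | h'
      · linarith
      · linarith
      · exact h'.le
      · exact absurd h' hne
    exact not_mem_of_outside h (mem_basins h.1 h3) (Joined.refl h3)
  · rintro ⟨h1, h2⟩
    refine ⟨h1, ?_⟩
    rintro ⟨C, hC, hη⟩
    linarith [basin_energy_le hC hη]

/-- Energies are spaced by integers, so a boundary state below e+4 would be at most at e+3 and hence
inside the component. -/
theorem boundary_basin {C : Set Ω} (hC : C ∈ basins G H (e + 3)) {ζ : Ω}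
    (hζ : ζ ∈ outerBoundary G C) : e + 4 ≤ H ζ := by
  by_contra hlt
  obtain ⟨hζ, ξ, hξ, hadj⟩ := hζ
  rw [basin_eq hC hξ] at hζ
  exact hζ (Joined.of_adj hadj.symm (basin_energy_le hC hξ) (hS.le_three (not_le.1 hlt)))

theorem depth_basin {C : Set Ω} (hC : C ∈ basins G H (e + 3)) :
    depth G H C = e + 4 - minEnergy H C := by
  obtain ⟨η, hη⟩ := basin_nonempty hC
  obtain ⟨k, hk⟩ := hS.exists_strip_basin_ne C
  have hσ : σ k ∉ C := fun h =>
    hk (basin_eq_of_mem (hS.strip_basin_mem k) hC (hS.strip_mem_basin k) h)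
  obtain ⟨ζ, hζ, hj⟩ := (hS.joined_of_mem_reachable (hS.basin_subset hC hη) k).exists_boundary
    hη hσ
  have h1 : H ζ = e + 4 := le_antisymm hj.right_le (hS.boundary_basin hC hζ)
  unfold depth
  rw [minEnergy_eq hζ fun ξ hξ => ?_, h1]
  rw [h1]
  exact hS.boundary_basin hC hξ

theorem atLevel_basins {v : Ω} (hv : v ∈ reachable G H) :
    AtLevel G H (basins G H (e + 3)) (e + 4) v := by
  by_cases h : H v ≤ e + 3
  · refine .inr ⟨_, mem_basins hv h, Joined.refl h, fun u hu => ?_, fun u hu => ?_⟩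
    · linarith [Joined.right_le hu]
    · exact hS.boundary_basin (mem_basins hv h) hu
  · refine .inl ?_
    have h4 : H v = e + 4 := by
      rcases hS.energy_cases hv with h' | h' | h' | h'
      · exact absurd (by linarith) h
      · exact absurd (by linarith) h
      · exact absurd h'.le h
      · exact h'
    exact ⟨hS.outside_basins.2 ⟨hv, h4⟩, h4⟩

theorem minEnergy_cases {C : Set Ω} (hC : C ∈ basins G H (e + 3)) :
    (∃ k, C = {ξ | Joined G H (e + 3) (σ k) ξ} ∧ minEnergy H C = e) ∨
      minEnergy H C = e + 2 ∨ minEnergy H C = e + 3 := by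
  obtain ⟨η, hη⟩ := bottom_nonempty (H := H) (basin_nonempty hC)
  rw [mem_bottom_iff] at hη
  rw [← hη.2]
  rcases hS.energy_cases (hS.basin_subset hC hη.1) with h | h | h | h
  · obtain ⟨k, rfl⟩ := (hS.ground η).1 h
    exact .inl ⟨k, basin_eq hC hη.1, h⟩
  · exact .inr (.inl h)
  · exact .inr (.inr h)
  · linarith [basin_energy_le hC hη.1]

omit hS in
theorem minEnergy_bottom {C : Set Ω} (hC : C.Nonempty) :
    minEnergy H (bottom H C) = minEnergy H C := by
  obtain ⟨η, hη⟩ := bottom_nonempty (H := H) hC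
  rw [minEnergy_eq hη fun ξ hξ => hη.2 ξ hξ.1, (mem_bottom_iff.1 hη).2]

section Level

variable {𝒦 𝒟 : Set (Set Ω)} (h𝒦 : 𝒦 ⊆ basins G H (e + 3))
  (hσ : ∀ k, {ξ | Joined G H (e + 3) (σ k) ξ} ∈ 𝒦)

include h𝒦 hσ

/-- The reachable set is joined at e+4, while two different components of {H ≤ e+3} are not joined
below that. The exit height thus does not depend on which subcollection 𝒦 has been retained, as long
as it contains the strips. -/
theorem exitHeight_bottom {C : Set Ω} (hC : C ∈ 𝒦) :
    exitHeight G H (bottom H '' 𝒦) (bottom H C) = e + 4 := by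
  obtain ⟨k, hk⟩ := hS.exists_strip_basin_ne C
  obtain ⟨η, hη⟩ := bottom_nonempty (H := H) (basin_nonempty (h𝒦 hC))
  have hne : bottom H {ξ | Joined G H (e + 3) (σ k) ξ} ≠ bottom H C := by
    intro h
    have h1 : η ∈ bottom H {ξ | Joined G H (e + 3) (σ k) ξ} := h ▸ hη
    exact hk (basin_eq_of_mem (h𝒦 (hσ k)) (h𝒦 hC) h1.1 hη.1)
  have hmem : σ k ∈ bottom H {ξ | Joined G H (e + 3) (σ k) ξ} := by
    rw [hS.bottom_strip_basin]; rfl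
  have hj := hS.joined_of_mem_reachable (hS.basin_subset (h𝒦 hC) hη.1) k
  refine le_antisymm (exitHeight_le (Set.mem_image_of_mem _ (hσ k)) hne hη hmem hj) ?_
  have hmem' : σ k ∈ ⋃₀ (bottom H '' 𝒦 \ {bottom H C}) := ⟨_, ⟨⟨_, hσ k, rfl⟩, hne⟩, hmem⟩
  unfold exitHeight
  refine le_commHeight hη hmem' hj ?_
  rintro a ha b ⟨_, ⟨⟨C', hC', rfl⟩, hne'⟩, hb⟩ r hr
  by_contra hlt
  have h3 := hS.joined_three (not_le.1 hlt) hr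
  apply hne'
  rw [Set.mem_singleton_iff]
  congr 1
  rw [basin_eq (h𝒦 hC) ha.1, basin_eq (h𝒦 hC') hb.1]
  ext ξ
  exact ⟨fun h => h3.trans h, fun h => h3.symm.trans h⟩

theorem valley_bottom {C : Set Ω} (hC : C ∈ 𝒦) :
    valley G H (bottom H '' 𝒦) (bottom H C) = C := by
  have hT := hS.exitHeight_bottom h𝒦 hσ hC
  ext η
  rw [mem_valley_iff (by rw [hT]; exact hS.neg.le), hT]
  constructor
  · rintro ⟨p, hp, s, hs, hj⟩
    rw [basin_eq (h𝒦 hC) hp.1]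
    exact hS.joined_three hs hj
  · intro hη
    obtain ⟨p, hp⟩ := bottom_nonempty (H := H) (basin_nonempty (h𝒦 hC))
    refine ⟨p, hp, e + 3, by linarith, ?_⟩
    rw [basin_eq (h𝒦 hC) hp.1] at hη
    exact hη

theorem relDepth_bottom {C : Set Ω} (hC : C ∈ 𝒦) :
    relDepth G H (bottom H '' 𝒦) (bottom H C) = e + 4 - minEnergy H C := by
  have hT := hS.exitHeight_bottom h𝒦 hσ hC
  unfold relDepth
  unfold exitHeight at hT
  rw [hT, minEnergy_bottom (basin_nonempty (h𝒦 hC))]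

/-- Common to levels two and three: whatever components are retained as metastable sets, their
valleys are the components themselves, and the leftover cycles supply the remaining components. -/
theorem levelCycles_bottom (h1 : ∀ C ∈ basins G H (e + 3), C ∉ 𝒦 → C ∈ 𝒟)
    (h2 : ∀ C ∈ 𝒟, (∀ C' ∈ 𝒦, Disjoint C C') → C ∈ basins G H (e + 3)) :
    levelCycles G H (bottom H '' 𝒦) 𝒟 = basins G H (e + 3) := by
  ext C
  unfold levelCycles
  constructor
  · rintro (⟨_, ⟨C', hC', rfl⟩, rfl⟩ | ⟨hC, hd⟩)
    · rw [hS.valley_bottom h𝒦 hσ hC']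
      exact h𝒦 hC'
    · refine h2 C hC fun C' hC' => ?_
      have := hd _ ⟨C', hC', rfl⟩
      rwa [hS.valley_bottom h𝒦 hσ hC'] at this
  · intro hC
    by_cases h : C ∈ 𝒦
    · exact .inl ⟨_, ⟨C, h, rfl⟩, hS.valley_bottom h𝒦 hσ h⟩
    · refine .inr ⟨h1 C hC h, ?_⟩
      rintro _ ⟨C', hC', rfl⟩
      rw [hS.valley_bottom h𝒦 hσ hC', Set.disjoint_left]
      intro η hη hη'
      exact h (by rwa [basin_eq_of_mem hC (h𝒦 hC') hη hη'])

end Level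

/-- The components of `{H ≤ e + 3}` with a state of energy at most `e + 2`. -/
def lowBasins (G : SimpleGraph Ω) (H : Ω → ℝ) (e : ℝ) : Set (Set Ω) :=
  {C ∈ basins G H (e + 3) | minEnergy H C ≤ e + 2}

theorem strip_basin_low (k : ι) : {ξ | Joined G H (e + 3) (σ k) ξ} ∈ lowBasins G H e :=
  ⟨hS.strip_basin_mem k, by rw [hS.minEnergy_strip_basin]; linarith⟩

/-- In a component with minimum e+2 the plateaux together form the bottom: a plateau at e+3 cannot
occur in it, since it would be the whole component. -/
theorem stage_one_fst : (stage G H 1).1 = bottom H '' lowBasins G H e := by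
  change (fun 𝒜 : Set (Set Ω) => ⋃₀ 𝒜) '' levelComponents G H (stablePlateaux G H) ∅ = _
  have hunion : ∀ w ∈ reachable G H, H w = e + 2 → (∀ k, ¬ Joined G H (e + 3) w (σ k)) →
      ⋃₀ {P' ∈ stablePlateaux G H | ∃ p' ∈ P', Joined G H (e + 3) w p'} =
        bottom H {ξ | Joined G H (e + 3) w ξ} ∧
      minEnergy H {ξ | Joined G H (e + 3) w ξ} = e + 2 := by
    intro w hwr hw hns
    have hmin : minEnergy H {ξ | Joined G H (e + 3) w ξ} = e + 2 := by
      rw [minEnergy_eq (η := w) (Joined.refl (by linarith)), hw]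
      intro ξ hξ
      rw [hw]
      rcases hS.energy_cases (hS.mem_reachable_of_joined hwr (by linarith) hξ) with
        h | h | h | h
      · obtain ⟨k, rfl⟩ := (hS.ground ξ).1 h
        exact absurd hξ (hns k)
      all_goals linarith
    refine ⟨?_, hmin⟩
    ext η
    rw [mem_bottom_iff, hmin]
    constructor
    · rintro ⟨P, ⟨hP, p, hp, hj⟩, hη⟩
      have hpη := hP.1.2.1 p hp η hη
      rcases hS.energy_cases_of_mem hP hp with ⟨⟨k, rfl⟩, _⟩ | h | h
      · rw [Set.mem_singleton_iff] at hp
        exact absurd (hp ▸ hj) (hns k)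
      · refine ⟨hj.trans ((hP.1.joined hp hη).mono (by linarith)), hpη ▸ h⟩
      · have := hS.eq_valley hP hp h hj.symm
        have := hP.1.2.1 p hp w this
        linarith
    · rintro ⟨h1, h2⟩
      have hr : η ∈ reachable G H := hS.mem_reachable_of_joined hwr (by linarith) h1
      exact ⟨_, ⟨hS.plateau_mem hr h2.le, η, mem_plateau_self η, h1⟩, mem_plateau_self η⟩
  ext P
  constructor
  · rintro ⟨𝒜, h𝒜, rfl⟩
    rcases hS.levelComponents_one.1 h𝒜 with ⟨k, rfl⟩ | ⟨w, hwr, hw, hns, rfl⟩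
    · refine ⟨_, hS.strip_basin_low k, ?_⟩
      rw [hS.bottom_strip_basin]
      simp
    · obtain ⟨h1, h2⟩ := hunion w hwr hw hns
      exact ⟨_, ⟨mem_basins hwr (by linarith), h2.le⟩, h1.symm⟩
  · rintro ⟨C, ⟨hC, hlow⟩, rfl⟩
    rcases hS.minEnergy_cases hC with ⟨k, rfl, _⟩ | h | h
    · refine ⟨_, hS.levelComponents_one.2 (.inl ⟨k, rfl⟩), ?_⟩
      rw [hS.bottom_strip_basin]
      simp
    · obtain ⟨w, hw⟩ := bottom_nonempty (H := H) (basin_nonempty hC)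
      have hwr := hS.basin_subset hC hw.1
      have hCw := basin_eq hC hw.1
      have hwe : H w = e + 2 := by rw [(mem_bottom_iff.1 hw).2, h]
      have hns : ∀ k, ¬ Joined G H (e + 3) w (σ k) := by
        intro k hk
        have : σ k ∈ C := by rw [hCw]; exact hk
        have := hw.2 _ this
        rw [hS.energy_strip] at this
        linarith
      refine ⟨_, hS.levelComponents_one.2 (.inr ⟨w, hwr, hwe, hns, rfl⟩), ?_⟩
      change Set.sUnion _ = _
      rw [(hunion w hwr hwe hns).1, ← hCw]
    · linarith

/-- A component with all states at e+3 is a single stable plateau equal to its valley. Its bottom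
belongs to no irreducible component of level one, so it is kept as a transient cycle. -/
theorem stage_one_snd_of_basin {C : Set Ω} (hC : C ∈ basins G H (e + 3))
    (h : C ∉ lowBasins G H e) : C ∈ (stage G H 1).2 := by
  left
  change C ∈ {C | C ∈ deepCycles G H (levelCycles G H (stablePlateaux G H) ∅)
    (minDepth G H (stablePlateaux G H)) ∧
      bottom H C ∉ ⋃₀ levelComponents G H (stablePlateaux G H) ∅}
  rw [hS.minDepth_one, hS.deepCycles_one]
  obtain ⟨v, hv⟩ := basin_nonempty hC
  have hCv := basin_eq hC hv
  have hvr := hS.basin_subset hC hv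
  have hhigh : ∀ y ∈ C, ¬ H y ≤ e + 2 := by
    intro y hy hle
    refine h ⟨hC, le_trans ?_ hle⟩
    exact csInf_le (Set.toFinite (H '' C)).bddBelow ⟨y, hy, rfl⟩
  obtain ⟨hv3, hP⟩ := hS.plateau_of_high hvr (basin_energy_le hC hv)
    fun y hy => hhigh y (by rw [hCv]; exact hy)
  rw [← hCv] at hP
  have hval : valley G H (stablePlateaux G H) C = C := by
    refine Set.Subset.antisymm (fun η hη => ?_) (hS.subset_valley hP)
    rw [hCv]
    exact hS.joined_of_mem_valley hP hv hη
  have hbot := (hS.bottom_valley hP).1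
  rw [hval] at hbot
  refine ⟨by have := hS.valley_mem_one hP; rwa [hval] at this, ?_⟩
  rw [hbot]
  rintro ⟨𝒜, h𝒜, hCA⟩
  rcases hS.levelComponents_one.1 h𝒜 with ⟨k, rfl⟩ | ⟨w, _, hw, _, rfl⟩
  · rw [Set.mem_singleton_iff] at hCA
    rw [hCA, Set.mem_singleton_iff] at hv
    rw [hv, hS.energy_strip] at hv3
    linarith
  · obtain ⟨_, p, hp, hj⟩ := hCA
    refine hhigh w ?_ hw.le
    rw [basin_eq hC hp]
    exact hj.symm

/-- Disjointness from the retained components excludes valleys in components with a state at e+2 or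
lower. What remains are the valleys of plateaux at e+3, and these are whole components. -/
theorem basin_of_stage_one_snd {C : Set Ω} (hC : C ∈ (stage G H 1).2)
    (hd : ∀ C' ∈ lowBasins G H e, Disjoint C C') : C ∈ basins G H (e + 3) := by
  have hC' : C ∈ levelCycles G H (stablePlateaux G H) ∅ := by
    rcases hC with h | h
    · exact h.1.1
    · exact h.1
  rw [levelCycles_one] at hC'
  obtain ⟨P, hP, rfl⟩ := hC'
  obtain ⟨p, hp⟩ := hP.1.nonempty
  have hpr := hP.2 hp
  have hpV := hS.subset_valley hP hp
  have hp3 := (hS.joined_of_mem_valley hP hp hpV).left_le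
  have hnot : {ξ | Joined G H (e + 3) p ξ} ∉ lowBasins G H e := fun h =>
    Set.disjoint_left.1 (hd _ h) hpV (Joined.refl hp3)
  obtain ⟨_, hW⟩ := hS.plateau_of_high hpr hp3 fun y hy hle => hnot
    ⟨mem_basins hpr hp3, (csInf_le (Set.toFinite (H '' _)).bddBelow ⟨y, hy, rfl⟩).trans hle⟩
  have hPW : P = {ξ | Joined G H (e + 3) p ξ} := hS.eq_of_mem_mem hP hW hp (Joined.refl hp3)
  have : valley G H (stablePlateaux G H) P = {ξ | Joined G H (e + 3) p ξ} :=
    Set.Subset.antisymm (fun η hη => hS.joined_of_mem_valley hP hp hη)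
      (fun η hη => hS.subset_valley hP (by rw [hPW]; exact hη))
  rw [this]
  exact mem_basins hpr hp3

theorem levelCycles_two :
    levelCycles G H (stage G H 1).1 (stage G H 1).2 = basins G H (e + 3) := by
  rw [hS.stage_one_fst]
  exact hS.levelCycles_bottom (fun _ h => h.1) hS.strip_basin_low
    (fun C hC h => hS.stage_one_snd_of_basin hC h)
    fun C hC h => hS.basin_of_stage_one_snd hC h

theorem exists_basin_two : ∃ C ∈ lowBasins G H e, minEnergy H C = e + 2 := by
  obtain ⟨k, η, hη, hj, hns⟩ := hS.far
  have hr := hS.mem_reachable_iff.2 ⟨k, hj⟩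
  have hmem := mem_basins hr (show H η ≤ e + 3 by linarith)
  have hη' : η ∈ {ξ | Joined G H (e + 3) η ξ} := Joined.refl (by linarith)
  have hle : minEnergy H {ξ | Joined G H (e + 3) η ξ} ≤ e + 2 :=
    (csInf_le (Set.toFinite (H '' _)).bddBelow ⟨η, hη', rfl⟩).trans hη.le
  refine ⟨_, ⟨hmem, hle⟩, ?_⟩
  rcases hS.minEnergy_cases hmem with ⟨l, h, _⟩ | h | h
  · rw [h] at hη'
    exact absurd hη' (hns l)
  · exact h
  · linarith

theorem minDepth_two : minDepth G H (stage G H 1).1 = 2 := by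
  rw [hS.stage_one_fst]
  unfold minDepth
  have hlow : ∀ x ∈ relDepth G H (bottom H '' lowBasins G H e) '' (bottom H '' lowBasins G H e),
      2 ≤ x := by
    rintro _ ⟨_, ⟨C, hC, rfl⟩, rfl⟩
    rw [hS.relDepth_bottom (fun _ h => h.1) hS.strip_basin_low hC]
    linarith [hC.2]
  obtain ⟨C, hC, hmin⟩ := hS.exists_basin_two
  have h2 := hS.relDepth_bottom (fun _ h => h.1) hS.strip_basin_low hC
  refine le_antisymm ((csInf_le ⟨2, hlow⟩ ⟨_, ⟨C, hC, rfl⟩, rfl⟩).trans ?_)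
    (le_csInf ⟨_, _, ⟨C, hC, rfl⟩, rfl⟩ hlow)
  rw [h2, hmin]
  linarith

theorem deepCycles_two : deepCycles G H (basins G H (e + 3)) 2 = lowBasins G H e := by
  ext C
  constructor
  · rintro ⟨hC, h⟩
    rw [hS.depth_basin hC] at h
    exact ⟨hC, by linarith⟩
  · rintro ⟨hC, h⟩
    refine ⟨hC, ?_⟩
    rw [hS.depth_basin hC]
    linarith

/-- A path at height e+4 to some strip is stopped at the first component that contains a strip. All
components met before have minimum at least e+2, so their depth does not exceed the threshold 2. -/
theorem reach_two {C : Set Ω} (hC : C ∈ basins G H (e + 3)) :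
    ∃ k, Relation.ReflTransGen (Jump G H (basins G H (e + 3)) 2)
      (.inr (bottom H C)) (.inr {σ k}) := by
  obtain ⟨η, hη⟩ := basin_nonempty hC
  have hηr := hS.basin_subset hC hη
  obtain ⟨k⟩ : Nonempty ι := inferInstance
  have hj := hS.joined_of_mem_reachable hηr k
  obtain ⟨c, ⟨l, hl⟩, hr⟩ := exists_first_visit {v | ∃ k, Joined G H (e + 3) (σ k) v} hj.2
    ⟨k, hS.strip_mem_basin k⟩
  have hr' : Relation.ReflTransGen (fun a b => G.Adj a b ∧
      AtLevel G H (basins G H (e + 3)) (e + 4) a ∧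
      AtLevel G H (basins G H (e + 3)) (e + 4) b ∧
      (∀ C ∈ basins G H (e + 3), a ∈ C → depth G H C ≤ 2) ∧ True) η c := by
    clear hl
    have hjj : ∀ v, Relation.ReflTransGen (fun x y => (G.Adj x y ∧ H y ≤ e + 4) ∧
        x ∉ {v | ∃ k, Joined G H (e + 3) (σ k) v}) η v → v ∈ reachable G H := fun v hv =>
      hS.mem_reachable_of_joined hηr (t := e + 4) le_rfl
        ⟨hj.left_le, Relation.ReflTransGen.mono (fun _ _ h => h.1) _ _ hv⟩
    induction hr with
    | refl => exact .refl
    | @tail a b ha hab ih =>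
      refine ih.tail ⟨hab.1.1, hS.atLevel_basins (hjj a ha),
        hS.atLevel_basins (hjj b (ha.tail hab)), fun C hC haC => ?_, trivial⟩
      rw [hS.depth_basin hC]
      rcases hS.minEnergy_cases hC with ⟨k, rfl, _⟩ | h | h
      · exact absurd ⟨k, haC⟩ hab.2
      all_goals linarith
  obtain ⟨Y, hY, hreach⟩ := disjointCycles_basins.follow (fun _ => True) hr' (.inr ⟨C, hC, hη, rfl⟩)
  refine ⟨l, ?_⟩
  have hYl : Y = .inr {σ l} := by
    rcases hY with ⟨h1, _⟩ | ⟨C', hC', hcC', rfl⟩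
    · exact absurd hl (not_mem_of_outside (C := {ξ | Joined G H (e + 3) (σ l) ξ}) h1
        (hS.strip_basin_mem l))
    · rw [basin_eq_of_mem hC' (hS.strip_basin_mem l) hcC' hl, hS.bottom_strip_basin]
  rw [hYl] at hreach
  exact Relation.ReflTransGen.mono (fun _ _ h => h.2) _ _ hreach

theorem strip_mem_bottom_two (k : ι) : {σ k} ∈ bottom H '' lowBasins G H e :=
  ⟨_, hS.strip_basin_low k, hS.bottom_strip_basin k⟩

theorem accessible_two_strip (k : ι) :
    accessible G H (basins G H (e + 3)) 2 {σ k} = {{σ k}} := by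
  unfold accessible
  rw [hS.deepCycles_two]
  ext P
  constructor
  · rintro ⟨_, h⟩
    rcases Relation.ReflTransGen.cases_head h with h | ⟨c, hc, _⟩
    · exact (Sum.inr.inj h).symm
    · rcases c with η | P'
      · obtain ⟨_, _, hd, _⟩ := (jump_inr_inl (Set.singleton_nonempty _)).1 hc
        rw [← hS.bottom_strip_basin, disjointCycles_basins.cycleOf_bottom (hS.strip_basin_mem k),
          hS.depth_basin (hS.strip_basin_mem k), hS.minEnergy_strip_basin] at hd
        linarith
      · exact absurd hc not_jump_inr_inr
  · rintro rfl
    exact ⟨hS.strip_mem_bottom_two k, .refl⟩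

/-- Every deep bottom leads to a strip, and a strip of depth 4 cannot be left at threshold 2. Hence
all bottoms except the strips are transient. -/
theorem levelComponents_two {𝒜 : Set (Set Ω)} :
    𝒜 ∈ levelComponents G H (stage G H 1).1 (stage G H 1).2 ↔ ∃ k, 𝒜 = {{σ k}} := by
  unfold levelComponents
  rw [Set.mem_ofPred_eq, hS.minDepth_two, hS.levelCycles_two, isIrreducibleComponent_iff,
    hS.deepCycles_two]
  constructor
  · rintro ⟨⟨P, hPA⟩, hsub, hall⟩
    obtain ⟨C, hC, rfl⟩ := hsub hPA
    obtain ⟨k, hk⟩ := hS.reach_two hC.1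
    have hkA : {σ k} ∈ 𝒜 := by
      rw [hall _ hPA]
      exact ⟨by rw [hS.deepCycles_two]; exact hS.strip_mem_bottom_two k, hk⟩
    exact ⟨k, by rw [hall _ hkA, hS.accessible_two_strip]⟩
  · rintro ⟨k, rfl⟩
    refine ⟨Set.singleton_nonempty _, ?_, ?_⟩
    · rintro _ rfl
      exact hS.strip_mem_bottom_two k
    · rintro _ rfl
      rw [hS.accessible_two_strip]

omit hS in
/-- The components of `{H ≤ e + 3}` which contain a ground state. -/
def stripBasins (G : SimpleGraph Ω) (H : Ω → ℝ) (σ : ι → Ω) (e : ℝ) : Set (Set Ω) :=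
  Set.range fun k => {ξ | Joined G H (e + 3) (σ k) ξ}

theorem bottom_stripBasins :
    bottom H '' stripBasins G H σ e = Set.range fun k => ({σ k} : Set Ω) := by
  unfold stripBasins
  rw [← Set.range_comp]
  congr 1
  funext k
  exact hS.bottom_strip_basin k

theorem stage_two_fst : (stage G H 2).1 = bottom H '' stripBasins G H σ e := by
  change (fun 𝒜 : Set (Set Ω) => ⋃₀ 𝒜) '' levelComponents G H (stage G H 1).1 (stage G H 1).2 = _
  rw [hS.bottom_stripBasins]
  ext P
  constructor
  · rintro ⟨𝒜, h𝒜, rfl⟩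
    obtain ⟨k, rfl⟩ := hS.levelComponents_two.1 h𝒜
    exact ⟨k, by simp⟩
  · rintro ⟨k, rfl⟩
    exact ⟨_, hS.levelComponents_two.2 ⟨k, rfl⟩, by simp⟩

theorem stripBasins_subset : stripBasins G H σ e ⊆ basins G H (e + 3) := by
  rintro _ ⟨k, rfl⟩
  exact hS.strip_basin_mem k

/-- The components dropped at level two reappear as leftovers: those of depth 2 as transient cycles,
those of depth 1 as shallow ones. -/
theorem levelCycles_three :
    levelCycles G H (stage G H 2).1 (stage G H 2).2 = basins G H (e + 3) := by
  have hsnd : (stage G H 2).2 = {C | C ∈ lowBasins G H e ∧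
      bottom H C ∉ ⋃₀ levelComponents G H (stage G H 1).1 (stage G H 1).2} ∪
      shallowCycles G H (basins G H (e + 3)) 2 := by
    change {C | C ∈ deepCycles G H (levelCycles G H (stage G H 1).1 (stage G H 1).2)
      (minDepth G H (stage G H 1).1) ∧ _} ∪ shallowCycles G H
        (levelCycles G H (stage G H 1).1 (stage G H 1).2) (minDepth G H (stage G H 1).1) = _
    rw [hS.minDepth_two, hS.levelCycles_two, hS.deepCycles_two]
  rw [hS.stage_two_fst, hsnd]
  refine hS.levelCycles_bottom hS.stripBasins_subset (fun k => ⟨k, rfl⟩) (fun C hC h => ?_)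
    fun C hC _ => ?_
  · by_cases hlow : C ∈ lowBasins G H e
    · refine .inl ⟨hlow, ?_⟩
      rintro ⟨𝒜, h𝒜, hCA⟩
      obtain ⟨k, rfl⟩ := hS.levelComponents_two.1 h𝒜
      rw [Set.mem_singleton_iff] at hCA
      have hk : σ k ∈ bottom H C := by rw [hCA]; rfl
      exact h ⟨k, (basin_eq hC hk.1).symm⟩
    · refine .inr ⟨hC, ?_⟩
      rw [← hS.deepCycles_two] at hlow
      by_contra hd
      exact hlow ⟨hC, not_lt.1 hd⟩
  · rcases hC with h | h
    · exact h.1.1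
    · exact h.1

theorem minDepth_three : minDepth G H (stage G H 2).1 = 4 := by
  rw [hS.stage_two_fst]
  unfold minDepth
  have h4 : ∀ x ∈ relDepth G H (bottom H '' stripBasins G H σ e) ''
      (bottom H '' stripBasins G H σ e), x = 4 := by
    rintro _ ⟨_, ⟨C, hC, rfl⟩, rfl⟩
    rw [hS.relDepth_bottom hS.stripBasins_subset (fun k => ⟨k, rfl⟩) hC]
    obtain ⟨k, rfl⟩ := hC
    rw [hS.minEnergy_strip_basin]
    ring
  obtain ⟨k⟩ : Nonempty ι := inferInstance
  have hmem : relDepth G H (bottom H '' stripBasins G H σ e)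
      (bottom H {ξ | Joined G H (e + 3) (σ k) ξ}) ∈
      relDepth G H (bottom H '' stripBasins G H σ e) '' (bottom H '' stripBasins G H σ e) :=
    ⟨_, ⟨_, ⟨k, rfl⟩, rfl⟩, rfl⟩
  have : relDepth G H (bottom H '' stripBasins G H σ e) '' (bottom H '' stripBasins G H σ e) =
      {4} := Set.eq_singleton_iff_nonempty_unique_mem.2 ⟨⟨_, hmem⟩, h4⟩
  rw [this, csInf_singleton]

theorem deepCycles_three : deepCycles G H (basins G H (e + 3)) 4 = stripBasins G H σ e := by
  ext C
  constructor
  · rintro ⟨hC, h⟩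
    rw [hS.depth_basin hC] at h
    rcases hS.minEnergy_cases hC with ⟨k, rfl, _⟩ | h' | h'
    · exact ⟨k, rfl⟩
    all_goals linarith
  · rintro ⟨k, rfl⟩
    refine ⟨hS.strip_basin_mem k, ?_⟩
    dsimp only
    rw [hS.depth_basin (hS.strip_basin_mem k), hS.minEnergy_strip_basin]
    linarith

/-- At threshold 4 every component may be left, so the chain can follow the path given by `path`.
This path meets no third strip component, so between its last departure from the first strip and the
next arrival at the second one there is no other deep bottom. -/
theorem starRate_pos {k k' : ι} (hne : k ≠ k') : 0 < starRate G H 3 {σ k} {σ k'} := by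
  change 0 < traceRate G H (levelCycles G H (stage G H 2).1 (stage G H 2).2)
    (minDepth G H (stage G H 2).1) {σ k} {σ k'}
  rw [hS.minDepth_three, hS.levelCycles_three]
  have hdeep : bottom H '' deepCycles G H (basins G H (e + 3)) 4 =
      Set.range fun k => ({σ k} : Set Ω) := by
    rw [hS.deepCycles_three, hS.bottom_stripBasins]
  have hr : ∀ a, Relation.ReflTransGen (fun a b => G.Adj a b ∧ H b ≤ e + 4 ∧
      ∀ l, l ≠ k → l ≠ k' → ¬ Joined G H (e + 3) (σ l) b) (σ k) a →
      a ∈ reachable G H := fun a ha =>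
    hS.mem_reachable_iff.2 ⟨k, by rw [hS.energy_strip]; linarith,
      Relation.ReflTransGen.mono (fun _ _ h => ⟨h.1, h.2.1⟩) _ _ ha⟩
  have hQ : ∀ a, Relation.ReflTransGen (fun a b => G.Adj a b ∧ H b ≤ e + 4 ∧
      ∀ l, l ≠ k → l ≠ k' → ¬ Joined G H (e + 3) (σ l) b) (σ k) a →
      ∀ l, l ≠ k → l ≠ k' → ¬ Joined G H (e + 3) (σ l) a := by
    intro a ha
    rcases Relation.ReflTransGen.cases_tail ha with h | ⟨c, _, hc⟩
    · rw [h]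
      exact fun l h _ => hS.sep l k h
    · exact hc.2.2
  have hpath : Relation.ReflTransGen (fun a b => G.Adj a b ∧
      AtLevel G H (basins G H (e + 3)) (e + 4) a ∧
      AtLevel G H (basins G H (e + 3)) (e + 4) b ∧
      (∀ C ∈ basins G H (e + 3), a ∈ C → depth G H C ≤ 4) ∧
      ∀ l, l ≠ k → l ≠ k' → ¬ Joined G H (e + 3) (σ l) a) (σ k) (σ k') := by
    have h := hS.path k k' hne
    generalize hy : σ k' = y at h ⊢
    clear hy
    induction h with
    | refl => exact .refl
    | @tail a b ha hab ih =>
      refine ih.tail ⟨hab.1, hS.atLevel_basins (hr a ha), hS.atLevel_basins (hr b (ha.tail hab)),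
        fun C hC _ => ?_, hQ a ha⟩
      rw [hS.depth_basin hC]
      rcases hS.minEnergy_cases hC with ⟨_, _, h⟩ | h | h <;> linarith
  have hvert : ∀ l, IsVertexOf G H (basins G H (e + 3)) (σ l) (.inr {σ l}) := fun l =>
    .inr ⟨_, hS.strip_basin_mem l, hS.strip_mem_basin l, by rw [hS.bottom_strip_basin]⟩
  obtain ⟨Y, hY, hreach⟩ := disjointCycles_basins.follow _ hpath (hvert k)
  have hYk : Y = .inr {σ k'} := by
    rcases hY with ⟨h1, _⟩ | ⟨C', hC', hcC', rfl⟩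
    · exact absurd (hS.strip_mem_basin k') (not_mem_of_outside h1 (hS.strip_basin_mem k'))
    · rw [basin_eq_of_mem hC' (hS.strip_basin_mem k') hcC' (hS.strip_mem_basin k'),
        hS.bottom_strip_basin]
  subst hYk
  -- Only strips are deep at this level, so the only deep vertices met along the path are its two
  -- end strips.
  have hsrc : ∀ A, (∃ a, (∀ l, l ≠ k → l ≠ k' → ¬ Joined G H (e + 3) (σ l) a) ∧
      IsVertexOf G H (basins G H (e + 3)) a A) →
      A ∉ deepVertices G H (basins G H (e + 3)) 4 ∨ A = .inr {σ k} ∨ A = .inr {σ k'} := by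
    rintro A ⟨a, ha, hA⟩
    rcases hA with ⟨_, rfl⟩ | ⟨C, hC, haC, rfl⟩
    · left
      rintro ⟨_, _, h⟩
      simp at h
    · by_cases hs : ∃ l, C = {ξ | Joined G H (e + 3) (σ l) ξ}
      · obtain ⟨l, rfl⟩ := hs
        rw [hS.bottom_strip_basin]
        by_cases h1 : l = k
        · exact .inr (.inl (by rw [h1]))
        · by_cases h2 : l = k'
          · exact .inr (.inr (by rw [h2]))
          · exact absurd haC (ha l h1 h2)
      · left
        rw [inr_mem_deepVertices, hdeep]
        rintro ⟨l, hl⟩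
        have h1 : σ l ∈ bottom H C := by rw [← hl]; rfl
        exact hs ⟨l, basin_eq hC h1.1⟩
  -- Read from the end: reaching the second strip restarts the record, and the first departure from
  -- the initial strip that is found completes it.
  have hfinal : ∀ A, Relation.ReflTransGen (fun A B => (∃ a, (∀ l, l ≠ k → l ≠ k' →
      ¬ Joined G H (e + 3) (σ l) a) ∧ IsVertexOf G H (basins G H (e + 3)) a A) ∧
      Jump G H (basins G H (e + 3)) 4 A B) A (.inr {σ k'}) →
      Relation.ReflTransGen (fun a b => a ∉ deepVertices G H (basins G H (e + 3)) 4 ∧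
        Jump G H (basins G H (e + 3)) 4 a b) A (.inr {σ k'}) ∨
      ∃ B, Jump G H (basins G H (e + 3)) 4 (.inr {σ k}) B ∧
        Relation.ReflTransGen (fun a b => a ∉ deepVertices G H (basins G H (e + 3)) 4 ∧
        Jump G H (basins G H (e + 3)) 4 a b) B (.inr {σ k'}) := by
    intro A hA
    induction hA using Relation.ReflTransGen.head_induction_on with
    | refl => exact .inl .refl
    | @head A B hAB _ ih =>
      rcases ih with h | h
      · rcases hsrc A hAB.1 with h' | rfl | rfl
        · exact .inl (.head ⟨h', hAB.2⟩ h)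
        · exact .inr ⟨B, hAB.2, h⟩
        · exact .inl .refl
      · exact .inr h
  have hkd : Sum.inr {σ k} ∈ deepVertices G H (basins G H (e + 3)) 4 := by
    rw [inr_mem_deepVertices, hdeep]
    exact ⟨k, rfl⟩
  have hconc : ∃ B, Jump G H (basins G H (e + 3)) 4 (.inr {σ k}) B ∧
        Relation.ReflTransGen (fun a b => a ∉ deepVertices G H (basins G H (e + 3)) 4 ∧
        Jump G H (basins G H (e + 3)) 4 a b) B (.inr {σ k'}) := by
    rcases hfinal _ hreach with h | h
    · rcases Relation.ReflTransGen.cases_head h with h | ⟨c, hc, _⟩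
      · exact absurd (hS.inj (Set.singleton_injective (Sum.inr.inj h))) hne
      · exact absurd hkd hc.1
    · exact h
  obtain ⟨B, hB, hBr⟩ := hconc
  refine traceRate_pos_iff.2 ⟨by rw [hdeep]; exact ⟨k, rfl⟩, by rw [hdeep]; exact ⟨k', rfl⟩, ?_⟩
  rcases B with η | P
  · exact ⟨η, ((jump_inr_inl (Set.singleton_nonempty _)).1 hB).1, hB, hBr⟩
  · exact absurd hB not_jump_inr_inr

/-- The first three levels of the hierarchy of a strip landscape. -/
theorem hierarchy : (∀ h ∈ Set.Icc (1 : ℕ) 3, (starPlateaux G H h).Nontrivial) ∧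
    ∀ k k', k ≠ k' → {σ k} ∈ starPlateaux G H 3 ∧ {σ k'} ∈ starPlateaux G H 3 ∧
      0 < starRate G H 3 {σ k} {σ k'} := by
  have h3 : ∀ k, {σ k} ∈ starPlateaux G H 3 := by
    intro k
    change {σ k} ∈ (stage G H 2).1
    rw [hS.stage_two_fst, hS.bottom_stripBasins]
    exact ⟨k, rfl⟩
  have h2 : ∀ k, {σ k} ∈ starPlateaux G H 2 := by
    intro k
    change {σ k} ∈ (stage G H 1).1
    rw [hS.stage_one_fst]
    exact hS.strip_mem_bottom_two k
  have h1 : ∀ k, {σ k} ∈ starPlateaux G H 1 := hS.strip_mem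
  refine ⟨fun h hh => ?_, fun k k' hne => ⟨h3 k, h3 k', hS.starRate_pos hne⟩⟩
  obtain ⟨k, k', hne⟩ := exists_pair_ne ι
  have hne' : ({σ k} : Set Ω) ≠ {σ k'} := fun h' => hne (hS.inj (Set.singleton_injective h'))
  obtain ⟨ha, hb⟩ := hh
  interval_cases h
  · exact ⟨_, h1 k, _, h1 k', hne'⟩
  · exact ⟨_, h2 k, _, h2 k', hne'⟩
  · exact ⟨_, h3 k, _, h3 k', hne'⟩

end StripLandscape

end Metastable

/-! ### Exits of a set of sites, and the effect of one jump. -/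

namespace Kawasaki

section Cut

variable {A : Type*} [AddCommGroup A] [DecidableEq A]

/-- The number of points of `s` whose translate by `d` is not in `s`. -/
def exits (d : A) (s : Finset A) : ℕ := (s.filter fun x => x + d ∉ s).card

/-- Adding q affects two places only: q becomes an exit unless q + d is occupied, and q - d stops
being one if it is occupied. -/
theorem exits_insert {d : A} (hd : d ≠ 0) {s : Finset A} {q : A} (hq : q ∉ s) :
    exits d (insert q s) + ((if q + d ∈ s then 1 else 0) + if q - d ∈ s then 1 else 0) =
      exits d s + 1 := by
  unfold exits
  have hqd : q + d ≠ q := by simpa using hd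
  have h1 : (insert q s).filter (fun x => x + d ∉ insert q s) =
      if q + d ∈ s then (s.filter fun x => x + d ∉ s).erase (q - d)
      else insert q ((s.filter fun x => x + d ∉ s).erase (q - d)) := by
    have hcase : ∀ x, x + d = q ↔ x = q - d := fun x => eq_sub_iff_add_eq.symm
    split_ifs with h
    · ext x
      simp only [Finset.mem_filter, Finset.mem_insert, Finset.mem_erase, not_or, hcase]
      constructor
      · rintro ⟨rfl | hx, h2, h3⟩
        · exact absurd h h3
        · exact ⟨h2, hx, h3⟩
      · rintro ⟨h2, hx, h3⟩
        exact ⟨.inr hx, h2, h3⟩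
    · ext x
      simp only [Finset.mem_filter, Finset.mem_insert, Finset.mem_erase, not_or, hcase]
      constructor
      · rintro ⟨rfl | hx, h2, h3⟩
        · exact .inl rfl
        · exact .inr ⟨h2, hx, h3⟩
      · rintro (rfl | ⟨h2, hx, h3⟩)
        · exact ⟨.inl rfl, fun h' => hqd ((hcase x).2 h'), h⟩
        · exact ⟨.inr hx, h2, h3⟩
  have h2 : ((s.filter fun x => x + d ∉ s).erase (q - d)).card + (if q - d ∈ s then 1 else 0) =
      (s.filter fun x => x + d ∉ s).card := by
    split_ifs with h
    · exact Finset.card_erase_add_one (by simpa [h] using hq)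
    · rw [Finset.erase_eq_of_notMem (by simp [h]), add_zero]
  rw [h1]
  split_ifs at h2 ⊢ with h3 h4 h5
  · omega
  · omega
  · rw [Finset.card_insert_of_notMem (by simp [hq])]; omega
  · rw [Finset.card_insert_of_notMem (by simp [hq])]; omega

theorem exits_add_card {d : A} (s : Finset A) :
    exits d s + (s.filter fun x => x + d ∈ s).card = s.card := by
  unfold exits
  rw [add_comm]
  exact Finset.card_filter_add_card_filter_not (s := s) (fun x => x + d ∈ s)

end Cut

variable {K L : ℕ} [NeZero K] [NeZero L]

/-- The horizontal unit vector. -/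
def e₁ : Site K L := (1, 0)

/-- The vertical unit vector. -/
def e₂ : Site K L := (0, 1)

omit [NeZero K] [NeZero L]

theorem natCast_ne_zero {M n : ℕ} (h0 : 0 < n) (h : n < M) : (n : ZMod M) ≠ 0 := by
  intro h'
  rw [ZMod.natCast_eq_zero_iff] at h'
  exact absurd (Nat.le_of_dvd h0 h') (not_le.2 h)

theorem one_ne_zero' {M : ℕ} (h : 2 ≤ M) : (1 : ZMod M) ≠ 0 := by
  simpa using natCast_ne_zero (M := M) one_pos (by omega)

theorem two_ne_zero' {M : ℕ} (h : 3 ≤ M) : (2 : ZMod M) ≠ 0 := by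
  simpa using natCast_ne_zero (M := M) two_pos (by omega)

/-- Neighbouring sites of the torus. -/
def Nb (p q : Site K L) : Prop := q = p + e₁ ∨ q = p - e₁ ∨ q = p + e₂ ∨ q = p - e₂

theorem Nb.symm {p q : Site K L} (h : Nb p q) : Nb q p := by
  rcases h with rfl | rfl | rfl | rfl
  · exact .inr (.inl (by simp))
  · exact .inl (by simp)
  · exact .inr (.inr (.inr (by simp)))
  · exact .inr (.inr (.inl (by simp)))

theorem e₁_ne_zero (hK : 2 ≤ K) : (e₁ : Site K L) ≠ 0 := fun h =>
  one_ne_zero' hK (congrArg Prod.fst h)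

theorem e₂_ne_zero (hL : 2 ≤ L) : (e₂ : Site K L) ≠ 0 := fun h =>
  one_ne_zero' hL (congrArg Prod.snd h)

theorem Nb.ne (hK : 2 ≤ K) (hL : 2 ≤ L) {p q : Site K L} (h : Nb p q) : p ≠ q := by
  have h1 := e₁_ne_zero (L := L) hK
  have h2 := e₂_ne_zero (K := K) hL
  rcases h with rfl | rfl | rfl | rfl
  · simpa using h1
  · rw [ne_eq, eq_comm, sub_eq_self]
    exact h1
  · simpa using h2
  · rw [ne_eq, eq_comm, sub_eq_self]
    exact h2

theorem torus_adj (hK : 2 ≤ K) (hL : 2 ≤ L) {p q : Site K L} :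
    (torus K L).Adj p q ↔ Nb p q := by
  have h1 : ∀ x : Site K L, (x.1 + 1, x.2) = x + e₁ := fun x => by ext <;> simp [e₁]
  have h2 : ∀ x : Site K L, (x.1, x.2 + 1) = x + e₂ := fun x => by ext <;> simp [e₂]
  unfold torus
  rw [SimpleGraph.fromRel_adj]
  simp only [h1, h2]
  constructor
  · rintro ⟨_, (h | h) | h | h⟩
    · exact .inl h
    · exact .inr (.inr (.inl h))
    · exact .inr (.inl (by rw [h]; simp))
    · exact .inr (.inr (.inr (by rw [h]; simp)))
  · intro h
    refine ⟨h.ne hK hL, ?_⟩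
    rcases h with rfl | rfl | rfl | rfl <;> simp

/-- The number of occupied neighbours. -/
def deg (s : Finset (Site K L)) (q : Site K L) : ℕ :=
  ((if q + e₁ ∈ s then 1 else 0) + if q - e₁ ∈ s then 1 else 0) +
    ((if q + e₂ ∈ s then 1 else 0) + if q - e₂ ∈ s then 1 else 0)

/-- The number of bonds between an occupied and an empty site, divided by two. -/
def cut (s : Finset (Site K L)) : ℕ := exits e₁ s + exits e₂ s

theorem cut_insert (hK : 2 ≤ K) (hL : 2 ≤ L) {s : Finset (Site K L)} {q : Site K L} (hq : q ∉ s) :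
    cut (insert q s) + deg s q = cut s + 2 := by
  have h1 := exits_insert (e₁_ne_zero (L := L) hK) hq
  have h2 := exits_insert (e₂_ne_zero (K := K) hL) hq
  unfold cut deg
  omega

theorem sites_distinct (hK : 3 ≤ K) (hL : 3 ≤ L) (q : Site K L) :
    q + e₁ ≠ q - e₁ ∧ q + e₁ ≠ q + e₂ ∧ q + e₁ ≠ q - e₂ ∧ q - e₁ ≠ q + e₂ ∧ q - e₁ ≠ q - e₂ ∧
      q + e₂ ≠ q - e₂ := by
  have h1 := one_ne_zero' (M := K) (by omega)
  have h2 := two_ne_zero' (M := K) (by omega)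
  have h4 := two_ne_zero' (M := L) (by omega)
  refine ⟨fun h => h2 ?_, fun h => h1 ?_, fun h => h1 ?_, fun h => h1 ?_, fun h => h1 ?_,
    fun h => h4 ?_⟩
  · have := congrArg Prod.fst h
    simp only [e₁, Prod.fst_add, Prod.fst_sub] at this
    linear_combination this
  · have := congrArg Prod.fst h
    simp only [e₁, e₂, Prod.fst_add] at this
    linear_combination this
  · have := congrArg Prod.fst h
    simp only [e₁, e₂, Prod.fst_add, Prod.fst_sub] at this
    linear_combination this
  · have := congrArg Prod.fst h
    simp only [e₁, e₂, Prod.fst_add, Prod.fst_sub] at this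
    linear_combination -this
  · have := congrArg Prod.fst h
    simp only [e₁, e₂, Prod.fst_sub] at this
    linear_combination -this
  · have := congrArg Prod.snd h
    simp only [e₂, Prod.snd_add, Prod.snd_sub] at this
    linear_combination this

/-- Side lengths at least 3 make the four neighbours of a site distinct, so a removed neighbour is
counted once. -/
theorem deg_erase_of_nb (hK : 3 ≤ K) (hL : 3 ≤ L) {s : Finset (Site K L)} {p q : Site K L}
    (hp : p ∈ s) (h : Nb q p) : deg (s.erase p) q + 1 = deg s q := by
  obtain ⟨h1, h2, h3, h4, h5, h6⟩ := sites_distinct hK hL q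
  unfold deg
  rcases h with rfl | rfl | rfl | rfl
  · simp only [Finset.mem_erase, ne_eq, not_true_eq_false, false_and, if_false, h1.symm, h2.symm,
      h3.symm, not_false_eq_true, true_and, hp, if_true]
    omega
  · simp only [Finset.mem_erase, ne_eq, not_true_eq_false, false_and, if_false, h1, h4.symm,
      h5.symm, not_false_eq_true, true_and, hp, if_true]
    omega
  · simp only [Finset.mem_erase, ne_eq, not_true_eq_false, false_and, if_false, h2, h4, h6.symm,
      not_false_eq_true, true_and, hp, if_true]
    omega
  · simp only [Finset.mem_erase, ne_eq, not_true_eq_false, false_and, if_false, h3, h5, h6,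
      not_false_eq_true, true_and, hp, if_true]
    omega

theorem deg_erase_self (hK : 2 ≤ K) (hL : 2 ≤ L) (s : Finset (Site K L)) (p : Site K L) :
    deg (s.erase p) p = deg s p := by
  have h1 := e₁_ne_zero (L := L) hK
  have h2 := e₂_ne_zero (K := K) hL
  unfold deg
  simp [h1, h2]

/-- The change of the cut when a particle jumps from `p` to the neighbour `q`. -/
theorem cut_jump (hK : 3 ≤ K) (hL : 3 ≤ L) {s : Finset (Site K L)} {p q : Site K L}
    (hp : p ∈ s) (hq : q ∉ s) (h : Nb p q) :
    cut (insert q (s.erase p)) + deg s q = cut s + deg s p + 1 := by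
  have h1 := cut_insert (by omega) (by omega) (s := s.erase p) (q := q)
    fun h => hq (Finset.mem_of_mem_erase h)
  have h2 := cut_insert (by omega) (by omega) (Finset.notMem_erase p s)
  rw [Finset.insert_erase hp, deg_erase_self (by omega) (by omega)] at h2
  -- The degree of q still counts the particle at p that jumps to it; this is the extra 1 in the
  -- balance.
  have h3 := deg_erase_of_nb hK hL hp h.symm
  omega

/-- `t` is obtained from `s` by the jump of a particle to an empty neighbouring site. -/
def Move (s t : Finset (Site K L)) : Prop :=
  ∃ p ∈ s, ∃ q, q ∉ s ∧ Nb p q ∧ t = insert q (s.erase p)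

theorem Move.card_eq {s t : Finset (Site K L)} (h : Move s t) : t.card = s.card := by
  obtain ⟨p, hp, q, hq, _, rfl⟩ := h
  rw [Finset.card_insert_of_notMem (fun h => hq (Finset.mem_of_mem_erase h)),
    Finset.card_erase_add_one hp]

end Kawasaki

/-! ### Configurations as sets of occupied sites; the Hamiltonian as a cut. -/

namespace Kawasaki

variable {K L : ℕ} [NeZero K] [NeZero L] {N : ℕ}

/-- The set of occupied sites. -/
def occ (η : Config K L N) : Finset (Site K L) := Finset.univ.filter fun x => η.1 x = 1

theorem mem_occ {η : Config K L N} {x : Site K L} : x ∈ occ η ↔ η.1 x = 1 := by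
  simp [occ]

theorem val_eq (η : Config K L N) (x : Site K L) :
    (η.1 x : ℕ) = if x ∈ occ η then 1 else 0 := by
  have : ∀ a : Fin 2, (a : ℕ) = if a = 1 then 1 else 0 := by decide
  simp only [mem_occ]
  exact this _

theorem card_occ (η : Config K L N) : (occ η).card = N := by
  have h := η.2
  simp only [val_eq] at h
  rw [Finset.sum_boole] at h
  simpa using h

/-- The configuration with the given set of occupied sites. -/
def ofOcc (s : Finset (Site K L)) (hs : s.card = N) : Config K L N :=
  ⟨fun x => if x ∈ s then 1 else 0, by
    have : ∀ x, (((if x ∈ s then 1 else 0 : Fin 2) : Fin 2) : ℕ) = if x ∈ s then 1 else 0 := by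
      intro x; split_ifs <;> rfl
    simp only [this]
    rw [Finset.sum_boole]
    simpa using hs⟩

theorem occ_ofOcc (s : Finset (Site K L)) (hs : s.card = N) : occ (ofOcc s hs) = s := by
  ext x
  rw [mem_occ]
  simp [ofOcc]

theorem occ_injective : Function.Injective (occ : Config K L N → Finset (Site K L)) := by
  intro η ξ h
  apply Subtype.ext
  funext x
  have h1 := val_eq η x
  rw [h, ← val_eq ξ x] at h1
  exact Fin.ext h1

/-- With side lengths at least 3 every bond is obtained exactly once from its left or lower end. In
a direction of length 2 the bonds from x and from its translate would coincide. -/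
theorem sum_edges (hK : 3 ≤ K) (hL : 3 ≤ L) (f : Sym2 (Site K L) → ℝ)
    [Fintype (torus K L).edgeSet] :
    ∑ e ∈ (torus K L).edgeFinset, f e = ∑ x, f s(x, x + e₁) + ∑ x, f s(x, x + e₂) := by
  have hadj := fun p q : Site K L => torus_adj (p := p) (q := q) (by omega : 2 ≤ K) (by omega : 2 ≤ L)
  have hset : (torus K L).edgeFinset = (Finset.univ.image fun x : Site K L => s(x, x + e₁)) ∪
      Finset.univ.image fun x : Site K L => s(x, x + e₂) := by
    ext z
    induction z using Sym2.ind with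
    | _ a b =>
      rw [SimpleGraph.mem_edgeFinset, SimpleGraph.mem_edgeSet, hadj]
      simp only [Finset.mem_union, Finset.mem_image, Finset.mem_univ, true_and, Sym2.eq_iff]
      constructor
      · rintro (rfl | rfl | rfl | rfl)
        · exact .inl ⟨a, .inl ⟨rfl, rfl⟩⟩
        · exact .inl ⟨a - e₁, .inr ⟨rfl, by simp⟩⟩
        · exact .inr ⟨a, .inl ⟨rfl, rfl⟩⟩
        · exact .inr ⟨a - e₂, .inr ⟨rfl, by simp⟩⟩
      · rintro (⟨x, ⟨rfl, rfl⟩ | ⟨rfl, rfl⟩⟩ | ⟨x, ⟨rfl, rfl⟩ | ⟨rfl, rfl⟩⟩)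
        · exact .inl rfl
        · exact .inr (.inl (by simp))
        · exact .inr (.inr (.inl rfl))
        · exact .inr (.inr (.inr (by simp)))
  have hinj1 : Function.Injective fun x : Site K L => s(x, x + e₁) := by
    intro x y h
    rcases Sym2.eq_iff.1 h with ⟨h, _⟩ | ⟨h1, h2⟩
    · exact h
    · exfalso
      rw [h1] at h2
      have := congrArg Prod.fst h2
      simp only [e₁, Prod.fst_add] at this
      exact two_ne_zero' hK (by linear_combination this)
  have hinj2 : Function.Injective fun x : Site K L => s(x, x + e₂) := by
    intro x y h
    rcases Sym2.eq_iff.1 h with ⟨h, _⟩ | ⟨h1, h2⟩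
    · exact h
    · exfalso
      rw [h1] at h2
      have := congrArg Prod.snd h2
      simp only [e₂, Prod.snd_add] at this
      exact two_ne_zero' hL (by linear_combination this)
  have hdisj : Disjoint (Finset.univ.image fun x : Site K L => s(x, x + e₁))
      (Finset.univ.image fun x : Site K L => s(x, x + e₂)) := by
    rw [Finset.disjoint_left]
    intro z h1 h2
    simp only [Finset.mem_image, Finset.mem_univ, true_and] at h1 h2
    obtain ⟨x, rfl⟩ := h1
    obtain ⟨y, hy⟩ := h2
    rcases Sym2.eq_iff.1 hy with ⟨h1, h2⟩ | ⟨h1, h2⟩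
    · rw [h1] at h2
      have := congrArg Prod.fst h2
      simp only [e₁, e₂, Prod.fst_add] at this
      exact one_ne_zero' (by omega) (show (1 : ZMod K) = 0 by linear_combination -this)
    · rw [h1] at h2
      have := congrArg Prod.fst h2
      simp only [e₁, e₂, Prod.fst_add] at this
      exact one_ne_zero' (by omega) (show (1 : ZMod K) = 0 by linear_combination this)
  rw [hset, Finset.sum_union hdisj, Finset.sum_image fun x _ y _ h => hinj1 h,
    Finset.sum_image fun x _ y _ h => hinj2 h]

/-- Each particle owns one bond to the right and one upwards, and such a bond contributes unless the
other end is empty, that is, unless the particle is an exit. -/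
theorem hamiltonian_eq (hK : 3 ≤ K) (hL : 3 ≤ L) (η : Config K L N) :
    hamiltonian K L N η = (cut (occ η) : ℝ) - 2 * N := by
  unfold hamiltonian
  rw [sum_edges hK hL]
  have key : ∀ d : Site K L, (∑ x, (s(x, x + d).map fun x => ((η.1 x : ℕ) : ℝ)).mul : ℝ) =
      N - exits d (occ η) := by
    intro d
    have h1 := exits_add_card (d := d) (occ η)
    rw [card_occ] at h1
    have h2 : ∀ x, (s(x, x + d).map fun x => ((η.1 x : ℕ) : ℝ)).mul =
        if x ∈ (occ η).filter (fun x => x + d ∈ occ η) then (1 : ℝ) else 0 := by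
      intro x
      rw [Sym2.map_mk]
      change ((η.1 x : ℕ) : ℝ) * ((η.1 (x + d) : ℕ) : ℝ) = _
      rw [val_eq, val_eq]
      by_cases h3 : x ∈ occ η <;> by_cases h4 : x + d ∈ occ η <;> simp [h3, h4]
    simp only [h2]
    rw [Finset.sum_boole]
    have h3 : ((exits d (occ η) : ℕ) : ℝ) + (((occ η).filter fun x => x + d ∈ occ η).card : ℝ)
        = N := by exact_mod_cast h1
    simp only [Finset.filter_mem_eq_inter, Finset.univ_inter]
    linarith
  rw [key, key]
  unfold cut
  push_cast
  ring

theorem exchange_adj (hK : 2 ≤ K) (hL : 2 ≤ L) {η ξ : Config K L N} :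
    (exchangeGraph K L N).Adj η ξ ↔ Move (occ η) (occ ξ) := by
  have hswap : ∀ (η ξ : Config K L N) (x y : Site K L), Nb x y → ξ.1 = η.1 ∘ Equiv.swap x y →
      x ∈ occ η → y ∉ occ η → Move (occ η) (occ ξ) := by
    intro η ξ x y hxy h hx hy
    refine ⟨x, hx, y, hy, hxy, ?_⟩
    ext z
    rw [mem_occ, h, Function.comp_apply, ← mem_occ, Finset.mem_insert, Finset.mem_erase]
    by_cases h1 : z = x
    · subst h1
      rw [Equiv.swap_apply_left]
      simp [hy, hxy.ne hK hL]
    · by_cases h2 : z = y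
      · subst h2
        rw [Equiv.swap_apply_right]
        simp [hx]
      · rw [Equiv.swap_apply_of_ne_of_ne h1 h2]
        simp [h1, h2]
  constructor
  · rintro ⟨hne, x, y, hxy, h⟩
    rw [torus_adj hK hL] at hxy
    by_cases hx : x ∈ occ η <;> by_cases hy : y ∈ occ η
    · exfalso
      apply hne
      apply Subtype.ext
      rw [h]
      funext z
      rw [mem_occ] at hx hy
      by_cases h1 : z = x
      · subst h1; simp [hx, hy]
      · by_cases h2 : z = y
        · subst h2; simp [hx, hy]
        · simp [Equiv.swap_apply_of_ne_of_ne h1 h2]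
    · exact hswap η ξ x y hxy h hx hy
    · rw [Equiv.swap_comm] at h
      exact hswap η ξ y x hxy.symm h hy hx
    · exfalso
      apply hne
      apply Subtype.ext
      rw [h]
      funext z
      rw [mem_occ] at hx hy
      have h01 : ∀ a b : Fin 2, a ≠ 1 → b ≠ 1 → a = b := by decide
      by_cases h1 : z = x
      · subst h1
        simpa using h01 _ _ hx hy
      · by_cases h2 : z = y
        · subst h2
          simpa using h01 _ _ hy hx
        · simp [Equiv.swap_apply_of_ne_of_ne h1 h2]
  · rintro ⟨p, hp, q, hq, hpq, h⟩
    refine ⟨?_, p, q, (torus_adj hK hL).2 hpq, ?_⟩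
    · rintro rfl
      exact hq (h ▸ Finset.mem_insert_self _ _)
    · funext z
      have hz := val_eq ξ z
      rw [h] at hz
      apply Fin.ext
      rw [Function.comp_apply, hz, val_eq]
      by_cases h1 : z = p
      · subst h1
        simp [hq, hpq.ne hK hL]
      · by_cases h2 : z = q
        · subst h2
          simp [hp]
        · rw [Equiv.swap_apply_of_ne_of_ne h1 h2]
          simp [h1, h2]

end Kawasaki

/-! ### The isoperimetric inequality on the torus. -/

namespace Kawasaki

/-- A cyclic sequence which is not constant has a descent. -/
theorem exists_exit {M : ℕ} [NeZero M] {P : ZMod M → Prop} {a b : ZMod M} (ha : P a)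
    (hb : ¬ P b) : ∃ x, P x ∧ ¬ P (x + 1) := by
  by_contra h
  push Not at h
  have key : ∀ n : ℕ, P (a + n) := by
    intro n
    induction n with
    | zero => simpa using ha
    | succ n ih =>
      have := h _ ih
      rwa [add_assoc, ← Nat.cast_succ] at this
  have := key (b - a).val
  rw [ZMod.natCast_zmod_val, add_sub_cancel] at this
  exact hb this

variable {K L : ℕ} [NeZero K] [NeZero L]

/-- The rows with both an occupied and an empty site. -/
def partialRows (s : Finset (Site K L)) : Finset (ZMod L) :=
  Finset.univ.filter fun y => (∃ x, (x, y) ∈ s) ∧ ∃ x, (x, y) ∉ s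

/-- The columns with both an occupied and an empty site. -/
def partialCols (s : Finset (Site K L)) : Finset (ZMod K) :=
  Finset.univ.filter fun x => (∃ y, (x, y) ∈ s) ∧ ∃ y, (x, y) ∉ s

theorem mem_partialRows {s : Finset (Site K L)} {y : ZMod L} :
    y ∈ partialRows s ↔ (∃ x, (x, y) ∈ s) ∧ ∃ x, (x, y) ∉ s := by
  simp [partialRows]

theorem mem_partialCols {s : Finset (Site K L)} {x : ZMod K} :
    x ∈ partialCols s ↔ (∃ y, (x, y) ∈ s) ∧ ∃ y, (x, y) ∉ s := by
  simp [partialCols]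

/-- Going around a row or column with both kinds of sites one must pass from an occupied site to an
empty one at least once. -/
theorem partial_le_cut (s : Finset (Site K L)) :
    (partialRows s).card + (partialCols s).card ≤ cut s := by
  unfold cut exits
  refine Nat.add_le_add ?_ ?_
  · refine (Finset.card_le_card (t := (s.filter fun x => x + e₁ ∉ s).image Prod.snd) ?_).trans
      Finset.card_image_le
    intro y hy
    obtain ⟨⟨a, ha⟩, b, hb⟩ := mem_partialRows.1 hy
    obtain ⟨x, hx, hx'⟩ := exists_exit (P := fun x => (x, y) ∈ s) ha hb
    refine Finset.mem_image.2 ⟨(x, y), Finset.mem_filter.2 ⟨hx, ?_⟩, rfl⟩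
    simpa [e₁] using hx'
  · refine (Finset.card_le_card (t := (s.filter fun x => x + e₂ ∉ s).image Prod.fst) ?_).trans
      Finset.card_image_le
    intro x hx
    obtain ⟨⟨a, ha⟩, b, hb⟩ := mem_partialCols.1 hx
    obtain ⟨y, hy, hy'⟩ := exists_exit (P := fun y => (x, y) ∈ s) ha hb
    refine Finset.mem_image.2 ⟨(x, y), Finset.mem_filter.2 ⟨hy, ?_⟩, rfl⟩
    simpa [e₂] using hy'

/-- The number of particles in a column. -/
def colCount (s : Finset (Site K L)) (x : ZMod K) : ℕ :=
  (Finset.univ.filter fun y => (x, y) ∈ s).card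

/-- The number of particles in a row. -/
def rowCount (s : Finset (Site K L)) (y : ZMod L) : ℕ :=
  (Finset.univ.filter fun x => (x, y) ∈ s).card

theorem sum_colCount (s : Finset (Site K L)) : ∑ x, colCount s x = s.card := by
  have h : s.card = ∑ p : Site K L, if p ∈ s then 1 else 0 := by
    rw [Finset.sum_boole]; simp
  rw [h, Fintype.sum_prod_type]
  refine Finset.sum_congr rfl fun x _ => ?_
  rw [Finset.sum_boole]
  simp [colCount]

theorem sum_rowCount (s : Finset (Site K L)) : ∑ y, rowCount s y = s.card := by
  have h : s.card = ∑ p : Site K L, if p ∈ s then 1 else 0 := by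
    rw [Finset.sum_boole]; simp
  rw [h, Fintype.sum_prod_type, Finset.sum_comm]
  refine Finset.sum_congr rfl fun x _ => ?_
  rw [Finset.sum_boole]
  simp [rowCount]

theorem card_le_mul {s : Finset (Site K L)} (hrow : ∀ y, ∃ x, (x, y) ∉ s)
    (hcol : ∀ x, ∃ y, (x, y) ∉ s) :
    s.card ≤ (partialCols s).card * (partialRows s).card := by
  rw [← Finset.card_product]
  refine Finset.card_le_card fun p hp => Finset.mem_product.2 ⟨?_, ?_⟩
  · exact mem_partialCols.2 ⟨⟨p.2, hp⟩, hcol _⟩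
  · exact mem_partialRows.2 ⟨⟨p.1, hp⟩, hrow _⟩

theorem card_compl_le_mul {s : Finset (Site K L)} (hrow : ∀ y, ∃ x, (x, y) ∈ s)
    (hcol : ∀ x, ∃ y, (x, y) ∈ s) :
    K * L ≤ s.card + (partialCols s).card * (partialRows s).card := by
  have h1 : sᶜ.card ≤ (partialCols s).card * (partialRows s).card := by
    rw [← Finset.card_product]
    refine Finset.card_le_card fun p hp => ?_
    rw [Finset.mem_compl] at hp
    exact Finset.mem_product.2 ⟨mem_partialCols.2 ⟨hcol _, p.2, hp⟩,
      mem_partialRows.2 ⟨hrow _, p.1, hp⟩⟩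
  have h2 := Finset.card_add_card_compl s
  rw [Fintype.card_prod, ZMod.card, ZMod.card] at h2
  omega

/-- The sites of the strip with left column `k`. -/
def stripSet (K L N₀ : ℕ) [NeZero K] [NeZero L] (k : ZMod K) : Finset (Site K L) :=
  Finset.univ.filter fun x => (x.1 - k).val < N₀

theorem mem_stripSet {N₀ : ℕ} {k : ZMod K} {x : Site K L} :
    x ∈ stripSet K L N₀ k ↔ (x.1 - k).val < N₀ := by
  simp [stripSet]

theorem occ_strip {N₀ : ℕ} (hN : N₀ ≤ K) (k : ZMod K) :
    occ (strip K L N₀ hN k) = stripSet K L N₀ k := by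
  ext x
  rw [mem_occ, mem_stripSet]
  unfold strip
  simp

theorem card_stripSet {N₀ : ℕ} (hN : N₀ ≤ K) (k : ZMod K) :
    (stripSet K L N₀ k).card = L * N₀ := by
  rw [← occ_strip hN, card_occ]

/-- A cyclic set with a single exit is an interval. -/
theorem eq_interval {T : Finset (ZMod K)} (hT : (T.filter fun x => x + 1 ∉ T).card = 1)
    (h0 : 0 < T.card) : ∃ k, ∀ x, x ∈ T ↔ (x - k).val < T.card := by
  obtain ⟨r, hr⟩ := Finset.card_eq_one.1 hT
  have hr' : ∀ x, x ∈ T → x + 1 ∉ T → x = r := fun x h1 h2 => by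
    have : x ∈ T.filter fun x => x + 1 ∉ T := Finset.mem_filter.2 ⟨h1, h2⟩
    rwa [hr, Finset.mem_singleton] at this
  -- Going left from the unique exit r, a missing site stays missing: otherwise the next site to the
  -- left would be a second exit. The bound on j prevents a return to r.
  have hstep : ∀ j : ℕ, j + 1 < K → r - (j : ZMod K) ∉ T → r - ((j + 1 : ℕ) : ZMod K) ∉ T := by
    intro j hj h1 h2
    have h3 := hr' _ h2 (by
      have : r - ((j + 1 : ℕ) : ZMod K) + 1 = r - (j : ZMod K) := by push_cast; ring
      rwa [this])
    rw [sub_eq_self] at h3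
    exact natCast_ne_zero (Nat.succ_pos j) hj h3
  have hmono : ∀ i j : ℕ, i ≤ j → j < K → r - (i : ZMod K) ∉ T → r - (j : ZMod K) ∉ T := by
    intro i j hij
    induction j, hij using Nat.le_induction with
    | base => exact fun _ h => h
    | succ j _ ih => exact fun hj h => hstep j hj (ih (by omega) h)
  set J := (Finset.range K).filter fun j : ℕ => r - (j : ZMod K) ∈ T with hJ
  have hcard : J.card = T.card := by
    refine Finset.card_bij (fun j _ => r - (j : ZMod K)) ?_ ?_ ?_
    · intro j hj
      exact (Finset.mem_filter.1 hj).2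
    · intro i hi j hj hij
      have h1 : ((i : ℕ) : ZMod K) = j := by linear_combination -hij
      have h2 := congrArg ZMod.val h1
      rwa [ZMod.val_cast_of_lt (Finset.mem_range.1 (Finset.mem_filter.1 hi).1),
        ZMod.val_cast_of_lt (Finset.mem_range.1 (Finset.mem_filter.1 hj).1)] at h2
    · intro x hx
      refine ⟨(r - x).val, Finset.mem_filter.2 ⟨Finset.mem_range.2 (ZMod.val_lt _), ?_⟩, ?_⟩
      · rw [ZMod.natCast_zmod_val]; simpa using hx
      · rw [ZMod.natCast_zmod_val]; ring
  have hrange : ∀ j < K, (r - (j : ZMod K) ∈ T ↔ j < T.card) := by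
    intro j hj
    constructor
    · intro h
      have : Finset.range (j + 1) ⊆ J := by
        intro i hi
        rw [Finset.mem_range] at hi
        refine Finset.mem_filter.2 ⟨Finset.mem_range.2 (by omega), ?_⟩
        by_contra hi'
        exact hmono i j (by omega) hj hi' h
      have := Finset.card_le_card this
      rw [Finset.card_range, hcard] at this
      omega
    · intro h
      by_contra hj'
      have : J ⊆ Finset.range j := by
        intro i hi
        obtain ⟨h1, h2⟩ := Finset.mem_filter.1 hi
        rw [Finset.mem_range] at h1 ⊢
        by_contra hij
        exact hmono j i (by omega) h1 hj' h2
      have := Finset.card_le_card this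
      rw [Finset.card_range, hcard] at this
      omega
  have hTK : T.card ≤ K := by
    have := Finset.card_le_univ T
    rwa [ZMod.card] at this
  refine ⟨r - ((T.card - 1 : ℕ) : ZMod K), fun x => ?_⟩
  have h1 : x ∈ T ↔ (r - x).val < T.card := by
    rw [← hrange _ (ZMod.val_lt _), ZMod.natCast_zmod_val]
    simp
  have hflip : ∀ a b : ZMod K, a + b = ((T.card - 1 : ℕ) : ZMod K) → a.val < T.card →
      b.val < T.card := by
    intro a b hab ha
    have hb : b = ((T.card - 1 - a.val : ℕ) : ZMod K) := by
      rw [Nat.cast_sub (by omega), ZMod.natCast_zmod_val, ← hab]; ring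
    rw [hb, ZMod.val_cast_of_lt (by omega)]
    omega
  rw [h1]
  exact ⟨hflip _ _ (by ring), hflip _ _ (by ring)⟩

section Isoperimetry

set_option linter.unusedSectionVars false

variable {N₀ : ℕ} (hKL : L < K) (hLN : L < 4 * N₀) (hNK : 2 * N₀ < K) (hL : 4 ≤ L)
  (hN : 4 ≤ N₀ ∨ (N₀ = 3 ∧ L ≤ 9)) {s : Finset (Site K L)} (hs : s.card = L * N₀)

include hKL hLN hNK hL hN hs

/-- No line is full, so the particles lie in a grid of a partial columns and b partial rows, L * N₀
≤ a * b, and 4ab ≤ (a + b)². If a + b ≤ L this contradicts L < 4 * N₀. If a + b = L + 1 and N₀ = 3,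
it reads 12L ≤ (L + 1)², which fails for L ≤ 9; this is the role of that bound. -/
theorem lt_of_empty_row {y : ZMod L} (hy : ∀ x, (x, y) ∉ s)
    (hfull : ∀ y, ∃ x, (x, y) ∉ s) : L < cut s ∧ (N₀ = 3 → L ≤ 9 → L + 1 < cut s) := by
  have h1 := card_le_mul hfull fun x => ⟨y, hy x⟩
  have h2 := partial_le_cut s
  rw [hs] at h1
  generalize (partialCols s).card = a at *
  generalize (partialRows s).card = b at *
  refine ⟨?_, fun h3 h9 => ?_⟩
  · by_contra hlt
    have h3 : a + b ≤ L := by omega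
    nlinarith [sq_nonneg ((a : ℤ) - b), Nat.mul_le_mul h3 h3, four_mul_le_sq_add a b]
  · by_contra hlt
    have h4 : a + b ≤ L + 1 := by omega
    subst h3
    have h5 := four_mul_le_sq_add a b
    have h6 : (a + b) ^ 2 ≤ (L + 1) ^ 2 := Nat.pow_le_pow_left h4 2
    rw [mul_assoc] at h5
    interval_cases L <;> omega

/-- The same count for the empty sites, of which there are (K - N₀) * L. Since K - N₀ > K / 2 and K
> L, four times this number exceeds (L + 1)². -/
theorem lt_of_full_row {y : ZMod L} (hy : ∀ x, (x, y) ∈ s) (hempty : ∀ y, ∃ x, (x, y) ∈ s) :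
    L + 1 < cut s := by
  have h1 := card_compl_le_mul hempty fun x => ⟨y, hy x⟩
  have h2 := partial_le_cut s
  rw [hs] at h1
  generalize (partialCols s).card = a at *
  generalize (partialRows s).card = b at *
  by_contra hlt
  have h4 : a + b ≤ L + 1 := by omega
  have h5 := four_mul_le_sq_add a b
  have h6 : (a + b) ^ 2 ≤ (L + 1) ^ 2 := Nat.pow_le_pow_left h4 2
  nlinarith

/-- All K columns are partial. A cut of at most L + 1 forces K = L + 1 and only full or empty rows,
so L + 1 divides L * N₀ and hence N₀, which is too small. -/
theorem lt_of_full_row_of_empty_row {y y' : ZMod L} (hy : ∀ x, (x, y) ∈ s)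
    (hy' : ∀ x, (x, y') ∉ s) : L + 1 < cut s := by
  have h2 := partial_le_cut s
  have hcols : partialCols s = Finset.univ := by
    ext x
    simp only [mem_partialCols, Finset.mem_univ, iff_true]
    exact ⟨⟨y, hy x⟩, y', hy' x⟩
  rw [hcols, Finset.card_univ, ZMod.card] at h2
  by_contra hlt
  have hK : K = L + 1 := by omega
  have hrows : partialRows s = ∅ := Finset.card_eq_zero.1 (by omega)
  have hdvd : K ∣ s.card := by
    rw [← sum_rowCount]
    refine Finset.dvd_sum fun z _ => ?_
    by_cases h : ∃ x, (x, z) ∈ s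
    · have hall : ∀ x, (x, z) ∈ s := by
        by_contra h'
        push Not at h'
        have : z ∈ partialRows s := mem_partialRows.2 ⟨h, h'⟩
        rw [hrows] at this
        exact absurd this (Finset.notMem_empty z)
      unfold rowCount
      simp [hall]
    · push Not at h
      unfold rowCount
      simp [h]
  rw [hs, hK] at hdvd
  have hcop : Nat.Coprime (L + 1) L := by simp
  have := Nat.le_of_dvd (by omega) (hcop.dvd_of_dvd_mul_left hdvd)
  omega

/-- All L rows are partial. One further partial column is impossible: the other columns hold
multiples of L particles and so does the total. Hence columns are full or empty, each exit in their
cyclic order costs L, and only one exit is affordable. -/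
theorem eq_strip_or_lt (hfull : ∀ y, ∃ x, (x, y) ∉ s) (hempty : ∀ y, ∃ x, (x, y) ∈ s) :
    L ≤ cut s ∧ (cut s ≤ L + 1 → ∃ k, s = stripSet K L N₀ k) := by
  have h2 := partial_le_cut s
  have hrows : partialRows s = Finset.univ := by
    ext y
    simp only [mem_partialRows, Finset.mem_univ, iff_true]
    exact ⟨hempty y, hfull y⟩
  rw [hrows, Finset.card_univ, ZMod.card] at h2
  refine ⟨by omega, fun hcut => ?_⟩
  have hcolcases : ∀ x, x ∉ partialCols s → (∀ y, (x, y) ∈ s) ∨ ∀ y, (x, y) ∉ s := by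
    intro x hx
    rw [mem_partialCols] at hx
    by_cases h : ∃ y, (x, y) ∈ s
    · left
      by_contra h'
      push Not at h'
      exact hx ⟨h, h'⟩
    · right
      push Not at h
      exact h
  have hcoldvd : ∀ x, x ∉ partialCols s → L ∣ colCount s x := by
    intro x hx
    unfold colCount
    rcases hcolcases x hx with h | h
    · simp [h]
    · simp [h]
  have hcols : partialCols s = ∅ := by
    by_contra hne
    have h1 : (partialCols s).card = 1 := by
      have := Finset.card_pos.2 (Finset.nonempty_iff_ne_empty.2 hne)
      omega
    obtain ⟨x₀, hx₀⟩ := Finset.card_eq_one.1 h1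
    have hsum := sum_colCount s
    rw [← Finset.add_sum_erase _ _ (Finset.mem_univ x₀), hs] at hsum
    have hd1 : L ∣ ∑ x ∈ Finset.univ.erase x₀, colCount s x := by
      refine Finset.dvd_sum fun x hx => hcoldvd x ?_
      rw [hx₀, Finset.mem_singleton]
      exact Finset.ne_of_mem_erase hx
    have hd2 : L ∣ colCount s x₀ :=
      (Nat.dvd_add_left hd1).1 (hsum ▸ dvd_mul_right L N₀)
    obtain ⟨⟨a, ha⟩, b, hb⟩ := mem_partialCols.1 (show x₀ ∈ partialCols s by rw [hx₀]; simp)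
    have hpos : 0 < colCount s x₀ := Finset.card_pos.2 ⟨a, by simpa using ha⟩
    have hlt : colCount s x₀ < L := by
      have : (Finset.univ.filter fun y => (x₀, y) ∈ s) ⊂ Finset.univ := by
        rw [Finset.ssubset_univ_iff]
        intro h
        have hb' := Finset.mem_univ b
        rw [← h, Finset.mem_filter] at hb'
        exact hb hb'.2
      have := Finset.card_lt_card this
      rwa [Finset.card_univ, ZMod.card] at this
    exact absurd (Nat.le_of_dvd hpos hd2) (not_le.2 hlt)
  have hconst : ∀ x y, (x, y) ∈ s ↔ (x, (0 : ZMod L)) ∈ s := by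
    intro x y
    rcases hcolcases x (by rw [hcols]; simp) with h | h <;> simp [h]
  set T : Finset (ZMod K) := Finset.univ.filter fun x => (x, (0 : ZMod L)) ∈ s with hT
  have hmemT : ∀ x y, (x, y) ∈ s ↔ x ∈ T := by
    intro x y
    rw [hconst x y, hT]
    simp
  have hprod : s = T ×ˢ Finset.univ := by
    ext p
    simp [← hmemT p.1 p.2]
  have hTcard : T.card = N₀ := by
    have : s.card = T.card * L := by
      conv_lhs => rw [hprod]
      rw [Finset.card_product, Finset.card_univ, ZMod.card]
    rw [hs, mul_comm] at this
    exact (Nat.eq_of_mul_eq_mul_right (by omega) this).symm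
  have hexits : (T.filter fun x => x + 1 ∉ T).card * L ≤ cut s := by
    unfold cut exits
    have : (s.filter fun x => x + e₁ ∉ s) = (T.filter fun x => x + 1 ∉ T) ×ˢ Finset.univ := by
      ext p
      have h1 : p + e₁ = (p.1 + 1, p.2) := by ext <;> simp [e₁]
      have h2 : p = (p.1, p.2) := rfl
      rw [Finset.mem_filter, h1, hmemT, h2, hmemT]
      simp
    rw [this, Finset.card_product, Finset.card_univ, ZMod.card]
    exact Nat.le_add_right _ _
  have hone : (T.filter fun x => x + 1 ∉ T).card = 1 := by
    have hle : (T.filter fun x => x + 1 ∉ T).card < 2 := by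
      by_contra h
      have := Nat.mul_le_mul_right L (not_lt.1 h)
      omega
    have hpos : 0 < (T.filter fun x => x + 1 ∉ T).card := by
      obtain ⟨a, ha⟩ := hempty 0
      obtain ⟨b, hb⟩ := hfull 0
      obtain ⟨x, hx, hx'⟩ := exists_exit (P := fun x => x ∈ T) ((hmemT a 0).1 ha)
        (fun h => hb ((hmemT b 0).2 h))
      exact Finset.card_pos.2 ⟨x, Finset.mem_filter.2 ⟨hx, hx'⟩⟩
    omega
  obtain ⟨k, hk⟩ := eq_interval hone (by omega)
  refine ⟨k, ?_⟩
  ext p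
  rw [mem_stripSet, ← hTcard, ← hk, ← hmemT p.1 p.2]

/-- The isoperimetric inequality on the torus. -/
theorem isoperimetry : L ≤ cut s ∧ (cut s ≤ L + 1 → (∃ k, s = stripSet K L N₀ k) ∨
    (cut s = L + 1 ∧ 4 ≤ N₀ ∧ ∃ y, ∀ x, (x, y) ∉ s)) := by
  by_cases hempty : ∀ y, ∃ x, (x, y) ∈ s
  · by_cases hfull : ∀ y, ∃ x, (x, y) ∉ s
    · obtain ⟨h1, h2⟩ := eq_strip_or_lt hKL hLN hNK hL hN hs hfull hempty
      exact ⟨h1, fun h => .inl (h2 h)⟩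
    · push Not at hfull
      obtain ⟨y, hy⟩ := hfull
      have := lt_of_full_row hKL hLN hNK hL hN hs hy hempty
      exact ⟨by omega, fun h => by omega⟩
  · push Not at hempty
    obtain ⟨y, hy⟩ := hempty
    by_cases hfull : ∀ y, ∃ x, (x, y) ∉ s
    · obtain ⟨h1, h2⟩ := lt_of_empty_row hKL hLN hNK hL hN hs hy hfull
      refine ⟨h1.le, fun h => .inr ⟨by omega, ?_, y, hy⟩⟩
      rcases hN with h4 | ⟨h3, h9⟩
      · exact h4
      · have := h2 h3 h9
        omega
    · push Not at hfull
      obtain ⟨y', hy'⟩ := hfull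
      have := lt_of_full_row_of_empty_row hKL hLN hNK hL hN hs hy' hy
      exact ⟨by omega, fun h => by omega⟩

/-- Emptying a row costs at least five. -/
theorem cut_of_emptying (hN4 : 4 ≤ N₀) (hempty : ∀ y, ∃ x, (x, y) ∈ s)
    {t : Finset (Site K L)} (hm : Move s t) {y : ZMod L} (hy : ∀ x, (x, y) ∉ t) :
    L + 5 ≤ cut s := by
  obtain ⟨p, hp, q, hq, hpq, rfl⟩ := hm
  have honly : ∀ x, (x, y) ∈ s → (x, y) = p := by
    intro x hx
    by_contra hne
    exact hy x (Finset.mem_insert_of_mem (Finset.mem_erase.2 ⟨hne, hx⟩))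
  obtain ⟨x₀, hx₀⟩ := hempty y
  have hpx := honly x₀ hx₀
  -- The last particle of the row leaves it, so it jumps vertically and stays in its column.
  have hqy : q.2 ≠ y := by
    intro h
    exact hy q.1 (by rw [← h]; exact Finset.mem_insert_self _ _)
  have hqx : q.1 = x₀ := by
    subst hpx
    rcases hpq with rfl | rfl | rfl | rfl
    · simp [e₁] at hqy
    · simp [e₁] at hqy
    · simp [e₂]
    · simp [e₂]
  have hnotfull : ∀ x, ∃ z, (x, z) ∉ s := by
    intro x
    by_cases h : x = x₀
    · exact ⟨q.2, by rw [h, ← hqx]; exact hq⟩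
    · exact ⟨y, fun h' => h (by have := honly x h'; rw [← hpx] at this; exact congrArg Prod.fst this)⟩
  have h2 := partial_le_cut s
  by_cases hfull : ∀ y, ∃ x, (x, y) ∉ s
  · have hrows : partialRows s = Finset.univ := by
      ext y
      simp only [mem_partialRows, Finset.mem_univ, iff_true]
      exact ⟨hempty y, hfull y⟩
    rw [hrows, Finset.card_univ, ZMod.card] at h2
    -- The mean row count is N₀ and row y has at most one particle, so some row exceeds N₀. Its
    -- particles lie in at least N₀ + 1 ≥ 5 partial columns, besides the L partial rows.
    obtain ⟨z, hz⟩ : ∃ z, N₀ < rowCount s z := by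
      by_contra hle
      push Not at hle
      have hy1 : rowCount s y ≤ 1 := by
        refine Finset.card_le_one.2 fun a ha b hb => ?_
        simp only [Finset.mem_filter, Finset.mem_univ, true_and] at ha hb
        exact congrArg Prod.fst ((honly a ha).trans (honly b hb).symm)
      have hlt : ∑ y, rowCount s y < ∑ _y : ZMod L, N₀ :=
        Finset.sum_lt_sum (fun z _ => hle z) ⟨y, Finset.mem_univ _, by omega⟩
      rw [sum_rowCount, hs, Finset.sum_const, Finset.card_univ, ZMod.card, smul_eq_mul] at hlt
      exact lt_irrefl _ hlt
    have hcols : rowCount s z ≤ (partialCols s).card := by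
      refine Finset.card_le_card fun x hx => ?_
      simp only [Finset.mem_filter, Finset.mem_univ, true_and] at hx
      exact mem_partialCols.2 ⟨⟨z, hx⟩, hnotfull x⟩
    omega
  · push Not at hfull
    obtain ⟨z, hz⟩ := hfull
    have hcols : partialCols s = Finset.univ := by
      ext x
      simp only [mem_partialCols, Finset.mem_univ, iff_true]
      exact ⟨⟨z, hz x⟩, hnotfull x⟩
    rw [hcols, Finset.card_univ, ZMod.card] at h2
    have hcount : (L - (partialRows s).card) * K ≤ L * N₀ := by
      rw [← hs, ← sum_rowCount]
      have h3 : ∑ y ∈ (partialRows s)ᶜ, rowCount s y = ((partialRows s)ᶜ).card * K := by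
        rw [Finset.sum_const_nat]
        intro w hw
        rw [Finset.mem_compl, mem_partialRows] at hw
        have hall : ∀ x, (x, w) ∈ s := by
          by_contra h'
          push Not at h'
          exact hw ⟨hempty w, h'⟩
        unfold rowCount
        simp [hall]
      rw [Finset.card_compl, ZMod.card] at h3
      rw [← h3]
      exact Finset.sum_le_sum_of_subset (Finset.subset_univ _)
    -- The nonpartial rows are full and hold K > 2 * N₀ particles each, so they are fewer than half
    -- of the rows. With all K columns partial this gives the bound: from K > L if L ≥ 6, and from K
    -- ≥ 9 if L is 4 or 5.
    have hlt : 2 * (L - (partialRows s).card) < L := by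
      by_contra h
      push Not at h
      have h4 := Nat.mul_le_mul_right K h
      nlinarith
    omega

end Isoperimetry

end Kawasaki

/-! ### Degrees at a strip and local frames. -/

namespace Kawasaki

/-- Admissible sizes of the torus and of the strip. -/
structure Sizes (K L N₀ : ℕ) : Prop where
  lt : L < K
  lt_four_mul : L < 4 * N₀
  two_mul_lt : 2 * N₀ < K
  four_le : 4 ≤ L
  width : 4 ≤ N₀ ∨ (N₀ = 3 ∧ L ≤ 9)

theorem Sizes.three_le {K L N₀ : ℕ} (h : Sizes K L N₀) : 3 ≤ N₀ := by
  rcases h.width with h | h <;> omega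

theorem val_add_one_cases {M : ℕ} [NeZero M] (hM : 2 ≤ M) (a : ZMod M) :
    (a + 1).val = if a.val + 1 = M then 0 else a.val + 1 := by
  have : Fact (1 < M) := ⟨by omega⟩
  have := ZMod.val_lt a
  rw [ZMod.val_add, ZMod.val_one]
  split_ifs with h
  · rw [h, Nat.mod_self]
  · exact Nat.mod_eq_of_lt (by omega)

theorem val_sub_one_cases {M : ℕ} [NeZero M] (hM : 2 ≤ M) (a : ZMod M) :
    (a - 1).val = if a.val = 0 then M - 1 else a.val - 1 := by
  have h := val_add_one_cases hM (a - 1)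
  rw [sub_add_cancel] at h
  have := ZMod.val_lt (a - 1)
  split_ifs at h ⊢ <;> omega

section Deg

variable {K L : ℕ}

theorem deg_mono {s t : Finset (Site K L)} (h : s ⊆ t) (x : Site K L) : deg s x ≤ deg t x := by
  have key : ∀ y, (if y ∈ s then 1 else 0 : ℕ) ≤ if y ∈ t then 1 else 0 := by
    intro y
    by_cases h1 : y ∈ s
    · simp [h1, h h1]
    · simp [h1]
  unfold deg
  have h1 := key (x + e₁)
  have h2 := key (x - e₁)
  have h3 := key (x + e₂)
  have h4 := key (x - e₂)
  omega

open scoped Classical in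
theorem deg_le_deg_erase (hK : 3 ≤ K) (hL : 3 ≤ L) (s : Finset (Site K L)) (a x : Site K L) :
    deg s x ≤ deg (s.erase a) x + if Nb x a then 1 else 0 := by
  by_cases ha : a ∈ s
  · split_ifs with h
    · exact (deg_erase_of_nb hK hL ha h).ge
    · have h' : ∀ y, Nb x y → (y ∈ s.erase a ↔ y ∈ s) := by
        intro y hy
        rw [Finset.mem_erase, and_iff_right]
        rintro rfl
        exact h hy
      unfold deg
      rw [← if_congr (h' _ (.inl rfl)) rfl rfl, ← if_congr (h' _ (.inr (.inl rfl))) rfl rfl,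
        ← if_congr (h' _ (.inr (.inr (.inl rfl)))) rfl rfl,
        ← if_congr (h' _ (.inr (.inr (.inr rfl)))) rfl rfl]
      omega
  · rw [Finset.erase_eq_of_notMem ha]
    exact Nat.le_add_right _ _

open scoped Classical in
theorem deg_insert_le (hK : 3 ≤ K) (hL : 3 ≤ L) (s : Finset (Site K L)) (a x : Site K L) :
    deg (insert a s) x ≤ deg s x + if Nb x a then 1 else 0 :=
  (deg_le_deg_erase hK hL _ a x).trans
    (Nat.add_le_add_right (deg_mono (Finset.erase_insert_subset a s) x) _)

end Deg

variable {K L N₀ : ℕ} [NeZero K] [NeZero L] {k : ZMod K}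

theorem mem_strip_add_e₁ (hK : 2 ≤ K) {x : Site K L} : x + e₁ ∈ stripSet K L N₀ k ↔
    (if (x.1 - k).val + 1 = K then 0 else (x.1 - k).val + 1) < N₀ := by
  rw [mem_stripSet, ← val_add_one_cases hK]
  have : (x + e₁).1 - k = x.1 - k + 1 := by simp [e₁]; ring
  rw [this]

theorem mem_strip_sub_e₁ (hK : 2 ≤ K) {x : Site K L} : x - e₁ ∈ stripSet K L N₀ k ↔
    (if (x.1 - k).val = 0 then K - 1 else (x.1 - k).val - 1) < N₀ := by
  rw [mem_stripSet, ← val_sub_one_cases hK]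
  have : (x - e₁).1 - k = x.1 - k - 1 := by simp [e₁]; ring
  rw [this]

theorem mem_strip_add_e₂ {x : Site K L} :
    x + e₂ ∈ stripSet K L N₀ k ↔ x ∈ stripSet K L N₀ k := by
  rw [mem_stripSet, mem_stripSet]
  simp [e₂]

theorem mem_strip_sub_e₂ {x : Site K L} :
    x - e₂ ∈ stripSet K L N₀ k ↔ x ∈ stripSet K L N₀ k := by
  rw [mem_stripSet, mem_stripSet]
  simp [e₂]

/-- Both vertical neighbours and at least one horizontal neighbour belong to the strip. -/
theorem three_le_deg_strip (h : Sizes K L N₀) {x : Site K L} (hx : x ∈ stripSet K L N₀ k) :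
    3 ≤ deg (stripSet K L N₀ k) x := by
  have h1 := h.three_le
  have h2 := h.two_mul_lt
  unfold deg
  rw [if_pos (mem_strip_add_e₂.2 hx), if_pos (mem_strip_sub_e₂.2 hx)]
  rw [mem_stripSet] at hx
  have hor : x + e₁ ∈ stripSet K L N₀ k ∨ x - e₁ ∈ stripSet K L N₀ k := by
    rw [mem_strip_add_e₁ (by omega), mem_strip_sub_e₁ (by omega)]
    split_ifs <;> omega
  rcases hor with h | h <;> rw [if_pos h] <;> omega

/-- Vertical neighbours are outside as well, and the gap between the two sides of the strip has more
than one column, so at most one horizontal neighbour is inside. -/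
theorem deg_strip_le_one (h : Sizes K L N₀) {x : Site K L} (hx : x ∉ stripSet K L N₀ k) :
    deg (stripSet K L N₀ k) x ≤ 1 := by
  have h1 := h.three_le
  have h2 := h.two_mul_lt
  unfold deg
  rw [if_neg (mt mem_strip_add_e₂.1 hx), if_neg (mt mem_strip_sub_e₂.1 hx)]
  rw [mem_stripSet] at hx
  have hlt := ZMod.val_lt (x.1 - k)
  have hor : ¬ (x + e₁ ∈ stripSet K L N₀ k ∧ x - e₁ ∈ stripSet K L N₀ k) := by
    rw [mem_strip_add_e₁ (by omega), mem_strip_sub_e₁ (by omega)]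
    split_ifs <;> omega
  by_cases h3 : x + e₁ ∈ stripSet K L N₀ k
  · rw [if_pos h3, if_neg fun h4 => hor ⟨h3, h4⟩]
  · rw [if_neg h3]
    split_ifs <;> omega

theorem cut_stripSet (h : Sizes K L N₀) : cut (stripSet K L N₀ k) = L := by
  have h1 := h.three_le
  have h2 := h.two_mul_lt
  have hN : N₀ ≤ K := by omega
  refine le_antisymm ?_ (isoperimetry h.lt h.lt_four_mul h.two_mul_lt h.four_le h.width
    (card_stripSet hN k)).1
  unfold cut exits
  have hver : (stripSet K L N₀ k).filter (fun x => x + e₂ ∉ stripSet K L N₀ k) = ∅ := by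
    rw [Finset.filter_eq_empty_iff]
    intro x hx
    rw [not_not]
    exact mem_strip_add_e₂.2 hx
  rw [hver, Finset.card_empty, add_zero]
  have hsub : (stripSet K L N₀ k).filter (fun x => x + e₁ ∉ stripSet K L N₀ k) ⊆
      ({k + ((N₀ - 1 : ℕ) : ZMod K)} : Finset (ZMod K)) ×ˢ (Finset.univ : Finset (ZMod L)) := by
    intro x hx
    rw [Finset.mem_filter, mem_stripSet, mem_strip_add_e₁ (by omega)] at hx
    rw [Finset.mem_product, Finset.mem_singleton]
    refine ⟨?_, Finset.mem_univ _⟩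
    have hv : (x.1 - k).val = N₀ - 1 := by
      obtain ⟨h3, h4⟩ := hx
      split_ifs at h4 <;> omega
    rw [← hv, ZMod.natCast_zmod_val]
    ring
  refine (Finset.card_le_card hsub).trans ?_
  rw [Finset.card_product, Finset.card_singleton, Finset.card_univ, ZMod.card, one_mul]

/-- The first jump out of a strip costs three. -/
theorem cut_of_move_strip (h : Sizes K L N₀) {t : Finset (Site K L)}
    (hm : Move (stripSet K L N₀ k) t) : L + 3 ≤ cut t := by
  obtain ⟨p, hp, q, hq, hpq, rfl⟩ := hm
  have h1 := cut_jump (by have := h.lt; have := h.four_le; omega) (by have := h.four_le; omega)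
    hp hq hpq
  have h2 := three_le_deg_strip h hp
  have h3 := deg_strip_le_one h hq
  rw [cut_stripSet h] at h1
  omega

section Frame

omit [NeZero K] [NeZero L]

/-- The site with coordinates `(i, j)` in the frame at `p` with axes `(α, 0)` and `(0, β)`. -/
def pt (p : Site K L) (α : ZMod K) (β : ZMod L) (i j : ℤ) : Site K L :=
  (p.1 + i * α, p.2 + j * β)

variable {p : Site K L} {α : ZMod K} {β : ZMod L}

theorem intCast_ne_zero {M : ℕ} {i : ℤ} (h0 : i ≠ 0) (h : |i| < M) : (i : ZMod M) ≠ 0 := by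
  intro h'
  rw [ZMod.intCast_zmod_eq_zero_iff_dvd] at h'
  exact h0 (Int.eq_zero_of_abs_lt_dvd h' h)

theorem pt_inj (hα : α = 1 ∨ α = -1) (hβ : β = 1 ∨ β = -1) {i j i' j' : ℤ}
    (hi : |i - i'| < K) (hj : |j - j'| < L) (h : pt p α β i j = pt p α β i' j') :
    i = i' ∧ j = j' := by
  have h1 : ((i - i' : ℤ) : ZMod K) = 0 := by
    have := congrArg Prod.fst h
    simp only [pt] at this
    push_cast
    rcases hα with rfl | rfl
    · linear_combination this
    · linear_combination -this
  have h2 : ((j - j' : ℤ) : ZMod L) = 0 := by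
    have := congrArg Prod.snd h
    simp only [pt] at this
    push_cast
    rcases hβ with rfl | rfl
    · linear_combination this
    · linear_combination -this
  constructor
  · by_contra hne
    exact intCast_ne_zero (sub_ne_zero.2 hne) hi h1
  · by_contra hne
    exact intCast_ne_zero (sub_ne_zero.2 hne) hj h2

theorem pt_zero : pt p α β 0 0 = p := by simp [pt]

theorem nb_pt (hα : α = 1 ∨ α = -1) (hβ : β = 1 ∨ β = -1) {i j : ℤ} {y : Site K L} :
    Nb (pt p α β i j) y ↔ y = pt p α β (i + 1) j ∨ y = pt p α β (i - 1) j ∨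
      y = pt p α β i (j + 1) ∨ y = pt p α β i (j - 1) := by
  have h1 : pt p α β (i + 1) j = pt p α β i j + (α, 0) := by
    ext <;> simp [pt]; ring
  have h2 : pt p α β (i - 1) j = pt p α β i j - (α, 0) := by
    ext <;> simp [pt]; ring
  have h3 : pt p α β i (j + 1) = pt p α β i j + (0, β) := by
    ext <;> simp [pt]; ring
  have h4 : pt p α β i (j - 1) = pt p α β i j - (0, β) := by
    ext <;> simp [pt]; ring
  rw [h1, h2, h3, h4]
  unfold Nb
  have ha : ∀ z : Site K L, z + (-1, 0) = z - e₁ := fun z => by ext <;> simp [e₁, sub_eq_add_neg]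
  have hb : ∀ z : Site K L, z - (-1, 0) = z + e₁ := fun z => by ext <;> simp [e₁]
  have hc : ∀ z : Site K L, z + (0, -1) = z - e₂ := fun z => by ext <;> simp [e₂, sub_eq_add_neg]
  have hd : ∀ z : Site K L, z - (0, -1) = z + e₂ := fun z => by ext <;> simp [e₂]
  rcases hα with rfl | rfl <;> rcases hβ with rfl | rfl <;> 
    (try simp only [ha, hb, hc, hd]) <;> (try simp only [e₁, e₂]) <;> tauto

theorem deg_pt (hα : α = 1 ∨ α = -1) (hβ : β = 1 ∨ β = -1) (s : Finset (Site K L)) (i j : ℤ) :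
    deg s (pt p α β i j) = ((if pt p α β (i + 1) j ∈ s then 1 else 0) +
      if pt p α β (i - 1) j ∈ s then 1 else 0) + ((if pt p α β i (j + 1) ∈ s then 1 else 0) +
      if pt p α β i (j - 1) ∈ s then 1 else 0) := by
  have h1 : pt p α β (i + 1) j = pt p α β i j + (α, 0) := by
    ext <;> simp [pt]; ring
  have h2 : pt p α β (i - 1) j = pt p α β i j - (α, 0) := by
    ext <;> simp [pt]; ring
  have h3 : pt p α β i (j + 1) = pt p α β i j + (0, β) := by
    ext <;> simp [pt]; ring
  have h4 : pt p α β i (j - 1) = pt p α β i j - (0, β) := by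
    ext <;> simp [pt]; ring
  rw [h1, h2, h3, h4]
  unfold deg
  have ha : ∀ z : Site K L, z + (-1, 0) = z - e₁ := fun z => by ext <;> simp [e₁, sub_eq_add_neg]
  have hb : ∀ z : Site K L, z - (-1, 0) = z + e₁ := fun z => by ext <;> simp [e₁]
  have hc : ∀ z : Site K L, z + (0, -1) = z - e₂ := fun z => by ext <;> simp [e₂, sub_eq_add_neg]
  have hd : ∀ z : Site K L, z - (0, -1) = z + e₂ := fun z => by ext <;> simp [e₂]
  have he : ((1, 0) : Site K L) = e₁ := rfl
  have he' : ((0, 1) : Site K L) = e₂ := rfl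
  rcases hα with rfl | rfl <;> rcases hβ with rfl | rfl <;> 
    simp only [ha, hb, hc, hd, he, he'] <;>
    split_ifs <;> rfl

end Frame

end Kawasaki

/-! ### Confinement of low-energy paths to the states near a strip. -/

namespace Kawasaki

variable {K L N₀ : ℕ} [NeZero K] [NeZero L] {k : ZMod K}

section Frame

variable {p : Site K L} {α : ZMod K} {β : ZMod L}

/-- The assumptions place p in a boundary column with the first axis pointing outwards. Three
columns inside and three outside are controlled, which N₀ ≥ 3 and K > 2 * N₀ allow; this covers
every site needed in the local analysis. -/
theorem mem_strip_pt (h : Sizes K L N₀) (hα : α = 1 ∨ α = -1) (hp : p ∈ stripSet K L N₀ k)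
    (hq : pt p α β 1 0 ∉ stripSet K L N₀ k) {i j : ℤ} (hi : -2 ≤ i) (hi' : i ≤ 3) :
    pt p α β i j ∈ stripSet K L N₀ k ↔ i ≤ 0 := by
  have h1 := h.three_le
  have h2 := h.two_mul_lt
  have hlt := ZMod.val_lt (p.1 - k)
  rw [mem_stripSet] at hp hq ⊢
  have key : ∀ x : ZMod K, ((p.1 - k).val : ZMod K) + x = p.1 - k + x := by
    intro x
    rw [ZMod.natCast_zmod_val]
  have hval : ∀ n : ℤ, 0 ≤ n → n < K → ((n : ZMod K)).val = n.toNat := by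
    intro n hn hn'
    obtain ⟨m, rfl⟩ := Int.eq_ofNat_of_zero_le hn
    rw [Int.cast_natCast, ZMod.val_cast_of_lt (by omega)]
    rfl
  rcases hα with rfl | rfl
  · have hcol : ∀ i : ℤ, (pt p (1 : ZMod K) β i j).1 - k = (((p.1 - k).val + i : ℤ) : ZMod K) := by
      intro i
      push_cast
      rw [key]
      simp only [pt]
      ring
    have hcol' : (pt p (1 : ZMod K) β 1 0).1 - k = (((p.1 - k).val + 1 : ℤ) : ZMod K) := by
      push_cast
      rw [key]
      simp only [pt]
      push_cast
      ring
    rw [hcol', hval _ (by omega) (by omega)] at hq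
    rw [hcol, hval _ (by omega) (by omega)]
    omega
  · have hcol : ∀ i : ℤ, (pt p (-1 : ZMod K) β i j).1 - k =
        (((p.1 - k).val - i : ℤ) : ZMod K) := by
      intro i
      push_cast
      rw [sub_eq_add_neg (((p.1 - k).val : ℕ) : ZMod K), key]
      simp only [pt]
      ring
    have hcol' : (pt p (-1 : ZMod K) β 1 0).1 - k = (((p.1 - k).val - 1 : ℤ) : ZMod K) := by
      push_cast
      rw [sub_eq_add_neg (((p.1 - k).val : ℕ) : ZMod K), key]
      simp only [pt]
      push_cast
      ring
    have h0 : (p.1 - k).val = 0 := by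
      by_contra hne
      rw [hcol', hval _ (by omega) (by omega)] at hq
      omega
    rw [hcol, h0]
    by_cases hi0 : i ≤ 0
    · rw [hval _ (by push_cast; omega) (by push_cast; omega)]
      push_cast
      omega
    · have : (((0 : ℕ) - i : ℤ) : ZMod K) = ((K - i : ℤ) : ZMod K) := by
        push_cast
        simp
      rw [this, hval _ (by omega) (by omega)]
      omega

omit [NeZero K] [NeZero L] in
/-- Two neighbouring sites have no common neighbour. -/
theorem not_nb_of_nb (h : Sizes K L N₀) {x p q : Site K L} (hpq : Nb p q) (hp : Nb x p)
    (hq : Nb x q) : False := by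
  have h4 := h.four_le
  have h5 := h.lt
  rw [← pt_zero (p := x) (α := 1) (β := 1), nb_pt (.inl rfl) (.inl rfl)] at hp hq
  rcases hp with rfl | rfl | rfl | rfl <;> rw [nb_pt (.inl rfl) (.inl rfl)] at hpq <;>
  rcases hq with rfl | rfl | rfl | rfl <;> rcases hpq with hpq | hpq | hpq | hpq <;>
  · have := pt_inj (.inl rfl) (.inl rfl) (abs_lt.2 ⟨by omega, by omega⟩)
      (abs_lt.2 ⟨by omega, by omega⟩) hpq
    omega

end Frame

/-- The states near the strip: at most one particle is outside of the strip, or exactly two and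
one of them sits next to a hole of the strip. -/
def Near (N₀ : ℕ) (k : ZMod K) (s : Finset (Site K L)) : Prop :=
  (s \ stripSet K L N₀ k).card ≤ 1 ∨ ((s \ stripSet K L N₀ k).card = 2 ∧
    ∃ p ∈ stripSet K L N₀ k \ s, ∃ q ∈ s \ stripSet K L N₀ k, Nb p q)

theorem near_strip : Near N₀ k (stripSet K L N₀ k) := .inl (by simp)

/-- The shape of a state of low energy with two particles outside of the strip, one of them next
to a hole. -/
theorem shape_of_pair (h : Sizes K L N₀) {s : Finset (Site K L)} {p a q b : Site K L}
    (hp : p ∈ stripSet K L N₀ k) (ha : a ∈ stripSet K L N₀ k) (hq : q ∉ stripSet K L N₀ k)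
    (hb : b ∉ stripSet K L N₀ k) (hpa : a ≠ p) (hqb : b ≠ q) (hpq : Nb p q)
    (hs : s = insert b (insert q (((stripSet K L N₀ k).erase p).erase a))) (hc : cut s ≤ L + 3) :
    cut s = L + 3 ∧ ∃ α : ZMod K, ∃ β : ZMod L, (α = 1 ∨ α = -1) ∧ (β = 1 ∨ β = -1) ∧
      q = pt p α β 1 0 ∧ a = pt p α β 0 1 ∧ b = pt p α β 1 (-1) := by
  have h4 := h.four_le
  have h5 := h.lt
  have h6 := h.three_le
  have h7 := h.two_mul_lt
  obtain ⟨α, hα, hqα⟩ : ∃ α : ZMod K, (α = 1 ∨ α = -1) ∧ ∀ β : ZMod L, q = pt p α β 1 0 := by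
    rcases hpq with rfl | rfl | rfl | rfl
    · exact ⟨1, .inl rfl, fun β => by ext <;> simp [pt, e₁]⟩
    · exact ⟨-1, .inr rfl, fun β => by simp [pt, e₁, sub_eq_add_neg, Prod.ext_iff]⟩
    · exact absurd (mem_strip_add_e₂.2 hp) hq
    · exact absurd (mem_strip_sub_e₂.2 hp) hq
  set S := stripSet K L N₀ k with hS
  have hmem : ∀ β : ZMod L, ∀ i j : ℤ, -2 ≤ i → i ≤ 3 → (pt p α β i j ∈ S ↔ i ≤ 0) :=
    fun β i j hi hi' => mem_strip_pt h hα hp (by rw [← hqα β]; exact hq) hi hi'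
  -- The energy ledger: removing p costs at least 1, removing a at least 0, adding q costs 2 because
  -- its only strip neighbour p is gone, and adding b at least 0. The total is at least 3, so every
  -- bound is attained.
  have c0 : cut S = L := cut_stripSet h
  have c1 := cut_insert (K := K) (L := L) (by omega) (by omega) (Finset.notMem_erase p S)
  have c2 := cut_insert (K := K) (L := L) (by omega) (by omega) (Finset.notMem_erase a (S.erase p))
  have c3 := cut_insert (K := K) (L := L) (by omega) (by omega) (s := (S.erase p).erase a) (q := q)
    (fun h' => hq (Finset.mem_of_mem_erase (Finset.mem_of_mem_erase h')))
  have c4 := cut_insert (K := K) (L := L) (by omega) (by omega)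
    (s := insert q ((S.erase p).erase a)) (q := b) (by
      rw [Finset.mem_insert]
      rintro (h' | h')
      · exact hqb h'
      · exact hb (Finset.mem_of_mem_erase (Finset.mem_of_mem_erase h')))
  rw [← hs] at c4
  rw [Finset.insert_erase hp, deg_erase_self (by omega) (by omega)] at c1
  rw [Finset.insert_erase (Finset.mem_erase.2 ⟨hpa, ha⟩), deg_erase_self (by omega) (by omega)] at c2
  have dp : 3 ≤ deg S p := three_le_deg_strip h hp
  have dq : deg ((S.erase p).erase a) q = 0 := by
    have h1 : deg S q ≤ 1 := deg_strip_le_one h hq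
    have h2 := deg_erase_of_nb (by omega) (by omega) hp hpq.symm
    have h3 := deg_mono (Finset.erase_subset a (S.erase p)) q
    omega
  have da : 3 ≤ deg S a := three_le_deg_strip h ha
  have da' := deg_le_deg_erase (by omega) (by omega) S p a
  have db : deg S b ≤ 1 := deg_strip_le_one h hb
  have db' := deg_insert_le (by omega) (by omega) ((S.erase p).erase a) q b
  have db2 := deg_mono ((Finset.erase_subset a (S.erase p)).trans (Finset.erase_subset p S)) b
  have hap : Nb a p := by
    by_contra hn
    rw [if_neg hn] at da'
    split_ifs at db' <;> omega
  have hbq : Nb b q := by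
    by_contra hn
    rw [if_neg hn] at db'
    split_ifs at da' <;> omega
  rw [if_pos hap] at da'
  rw [if_pos hbq] at db'
  have hdb : deg ((S.erase p).erase a) b = 1 := by omega
  have hda : deg S a = 3 := by
    have := deg_erase_of_nb (by omega) (by omega) hp hap
    omega
  refine ⟨by omega, ?_⟩
  obtain ⟨β, hβ, haβ⟩ : ∃ β : ZMod L, (β = 1 ∨ β = -1) ∧ a = pt p α β 0 1 := by
    have := hap.symm
    rw [← pt_zero (p := p) (α := α) (β := 1), nb_pt hα (.inl rfl)] at this
    rcases this with h' | h' | h' | h'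
    · have h8 : a = pt p α 1 1 0 := by simpa using h'
      rw [h8] at ha
      exact absurd ((hmem 1 1 0 (by norm_num) (by norm_num)).1 ha) (by norm_num)
    -- One column further inside, a would have degree 4 in the strip instead of 3.
    · exfalso
      have h8 : a = pt p α 1 (-1) 0 := by simpa using h'
      rw [h8, deg_pt hα (.inl rfl)] at hda
      simp [hmem 1] at hda
    · exact ⟨1, .inl rfl, by simpa using h'⟩
    · exact ⟨-1, .inr rfl, by rw [h']; simp [pt]⟩
  refine ⟨α, β, hα, hβ, hqα β, haβ, ?_⟩
  have := hbq.symm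
  rw [hqα β, nb_pt hα hβ] at this
  rcases this with rfl | rfl | rfl | rfl
  · exfalso
    have h9 : deg ((S.erase p).erase a) (pt p α β (1 + 1) 0) ≤ deg S (pt p α β (1 + 1) 0) := db2
    rw [hdb, deg_pt hα hβ] at h9
    simp [hmem β] at h9
  · exact absurd ((hmem β _ _ (by norm_num) (by norm_num)).2 (by norm_num)) hb
  -- Here b would face the hole a and have no strip neighbour left.
  · exfalso
    have h9 : Nb (pt p α β 1 (0 + 1)) a := by
      rw [nb_pt hα hβ, haβ]
      exact .inr (.inl (by norm_num))
    have h10 := deg_erase_of_nb (s := S) (by omega) (by omega) ha h9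
    have h11 : deg ((S.erase p).erase a) (pt p α β 1 (0 + 1)) ≤
        deg (S.erase a) (pt p α β 1 (0 + 1)) := deg_mono (by
      rw [Finset.erase_right_comm]
      exact Finset.erase_subset _ _) _
    omega
  · norm_num

theorem card_sdiff_eq (h : Sizes K L N₀) {s : Finset (Site K L)} (hs : s.card = L * N₀) :
    (stripSet K L N₀ k \ s).card = (s \ stripSet K L N₀ k).card := by
  have h1 := card_stripSet (L := L) (show N₀ ≤ K by have := h.two_mul_lt; omega) k
  have h2 := Finset.card_sdiff_add_card_inter (stripSet K L N₀ k) s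
  have h3 := Finset.card_sdiff_add_card_inter s (stripSet K L N₀ k)
  rw [Finset.inter_comm] at h3
  omega

/-- No jump of low energy leaves the states near a strip. -/
theorem Near.move (h : Sizes K L N₀) {s t : Finset (Site K L)} (hcard : s.card = L * N₀)
    (hn : Near N₀ k s) (hm : Move s t) (hs : cut s ≤ L + 3) (ht : cut t ≤ L + 3) :
    Near N₀ k t := by
  have h4 := h.four_le
  have h5 := h.lt
  obtain ⟨z, hz, w, hw, hzw, rfl⟩ := hm
  have hzw' : z ≠ w := hzw.ne (by omega) (by omega)
  have hjump := cut_jump (by omega) (by omega) hz hw hzw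
  unfold Near at hn ⊢
  set S := stripSet K L N₀ k with hS
  have hsub : insert w (s.erase z) \ S ⊆ insert w ((s \ S).erase z) := by
    intro x
    simp only [Finset.mem_sdiff, Finset.mem_insert, Finset.mem_erase]
    tauto
  have hsub' : w ∈ S → insert w (s.erase z) \ S ⊆ (s \ S).erase z := by
    intro hw' x
    simp only [Finset.mem_sdiff, Finset.mem_insert, Finset.mem_erase]
    rintro ⟨rfl | ⟨h1, h2⟩, h3⟩
    · exact absurd hw' h3
    · exact ⟨h1, h2, h3⟩
  have hle1 := Finset.card_le_card hsub
  have hle2 := Finset.card_insert_le w ((s \ S).erase z)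
  have hle3 := Finset.card_erase_le (s := s \ S) (a := z)
  rcases hn with hn | ⟨hn, p, hp, q, hq, hpq⟩
  · by_cases hlt : (insert w (s.erase z) \ S).card ≤ 1
    · exact .inl hlt
    · have hwS : w ∉ S := by
        intro hw'
        have := Finset.card_le_card (hsub' hw')
        omega
      -- The number of particles outside has just become 2, so the jump leads out of the strip. The
      -- vacated site z is then the hole next to w.
      have hzS : z ∈ S := by
        by_contra hz'
        have := Finset.card_erase_add_one (Finset.mem_sdiff.2 ⟨hz, hz'⟩)
        omega
      refine .inr ⟨by omega, z, ?_, w, ?_, hzw⟩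
      · simp [hzS, hzw']
      · simp [hwS]
  · have hholes := card_sdiff_eq (k := k) h hcard
    rw [← hS] at hholes
    obtain ⟨a, ha⟩ : ∃ a, (S \ s).erase p = {a} := by
      rw [← Finset.card_eq_one, Finset.card_erase_of_mem hp]
      omega
    obtain ⟨b, hb⟩ : ∃ b, (s \ S).erase q = {b} := by
      rw [← Finset.card_eq_one, Finset.card_erase_of_mem hq]
      omega
    have haS : a ∈ (S \ s).erase p := ha ▸ Finset.mem_singleton_self a
    have hbS : b ∈ (s \ S).erase q := hb ▸ Finset.mem_singleton_self b
    rw [Finset.mem_erase, Finset.mem_sdiff] at haS hbS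
    have hSs : ∀ x, x ∈ S → (x ∉ s ↔ x = p ∨ x = a) := by
      intro x hx
      have h1 : x ∈ S \ s ↔ x = p ∨ x = a := by
        rw [← Finset.insert_erase hp, ha]
        simp
      rw [← h1]
      simp [hx]
    have hsS : ∀ x, x ∉ S → (x ∈ s ↔ x = q ∨ x = b) := by
      intro x hx
      have h1 : x ∈ s \ S ↔ x = q ∨ x = b := by
        rw [← Finset.insert_erase hq, hb]
        simp
      rw [← h1]
      simp [hx]
    rw [Finset.mem_sdiff] at hp hq
    have hseq : s = insert b (insert q ((S.erase p).erase a)) := by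
      ext x
      simp only [Finset.mem_insert, Finset.mem_erase]
      by_cases hx : x ∈ S
      · have h1 := hSs x hx
        have h2 : x ≠ q := by rintro rfl; exact hq.2 hx
        have h3 : x ≠ b := by rintro rfl; exact hbS.2.2 hx
        clear * - h1 h2 h3 hx
        tauto
      · have h1 := hsS x hx
        clear * - h1 hx
        tauto
    obtain ⟨hcut, α, β, hα, hβ, hqe, hae, hbe⟩ := shape_of_pair h hp.1 haS.2.1 hq.2 hbS.2.2 haS.1
      hbS.1 hpq hseq hs
    -- The state is already at the maximal allowed cut L + 3, so the jump must not raise the energy.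
    -- All cases below except a jump into the strip from outside violate this.
    have hdeg : deg s z + 1 ≤ deg s w := by omega
    have hmemS : ∀ i j : ℤ, -2 ≤ i → i ≤ 3 → (pt p α β i j ∈ S ↔ i ≤ 0) :=
      fun i j hi hi' => mem_strip_pt h hα hp.1 (by rw [← hqe]; exact hq.2) hi hi'
    -- The ranges of i and j keep all differences of coordinates below the side lengths, so that the
    -- frame does not wrap around; rows are tight at L = 4, hence the two bounds for j.
    have hmem : ∀ i j : ℤ, -2 ≤ i → i ≤ 3 → -2 ≤ j → (j ≤ 2 ∨ j ≤ 3 ∧ i ≤ 0) →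
        (pt p α β i j ∈ s ↔ (i ≤ 0 ∧ ¬ (i = 0 ∧ (j = 0 ∨ j = 1))) ∨
          (i = 1 ∧ (j = 0 ∨ j = -1))) := by
      intro i j hi hi' hj hj'
      have hinj : ∀ i' j' : ℤ, 0 ≤ i' → i' ≤ 1 → -1 ≤ j' → j' ≤ 1 → (i' = 0 → 0 ≤ j') →
          (i ≤ 0 ↔ i' ≤ 0) → (pt p α β i j = pt p α β i' j' ↔ i = i' ∧ j = j') := by
        intro i' j' h1 h2 h3 h4 h5 h6
        constructor
        · intro h
          exact pt_inj hα hβ (abs_lt.2 ⟨by omega, by omega⟩) (abs_lt.2 ⟨by omega, by omega⟩) h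
        · rintro ⟨rfl, rfl⟩
          rfl
      by_cases h0 : i ≤ 0
      · have h1 := hSs _ ((hmemS i j hi hi').2 h0)
        have h2 := hinj 0 0 (by omega) (by omega) (by omega) (by omega) (by omega) (by omega)
        have h3 := hinj 0 1 (by omega) (by omega) (by omega) (by omega) (by omega) (by omega)
        rw [pt_zero] at h2
        rw [hae, h2, h3] at h1
        rw [← not_iff_not, h1]
        omega
      · have h1 := hsS _ (mt (hmemS i j hi hi').1 h0)
        have h2 := hinj 1 0 (by omega) (by omega) (by omega) (by omega) (by omega) (by omega)
        have h3 := hinj 1 (-1) (by omega) (by omega) (by omega) (by omega) (by omega) (by omega)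
        rw [hbe, hqe, h2, h3] at h1
        rw [h1]
        omega
    have hpa : Nb p a := by
      rw [hae]
      nth_rw 1 [← pt_zero (p := p) (α := α) (β := β)]
      rw [nb_pt hα hβ]
      simp
    have hqb : Nb q b := by
      rw [hqe, hbe, nb_pt hα hβ]
      simp
    by_cases hwS : w ∈ S
    · by_cases hzS : z ∈ S
      · exfalso
        rcases (hSs w hwS).1 hw with rfl | rfl
        · have hd : deg s w = 3 := by
            rw [← pt_zero (p := w) (α := α) (β := β), deg_pt hα hβ]
            simp [hmem]
          rw [← pt_zero (p := w) (α := α) (β := β)] at hzw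
          have hz' := hzw.symm
          rw [nb_pt hα hβ] at hz'
          rcases hz' with rfl | rfl | rfl | rfl
          · rw [hmemS _ _ (by norm_num) (by norm_num)] at hzS
            omega
          · rw [hd, deg_pt hα hβ] at hdeg
            simp [hmem] at hdeg
          · simp [hmem] at hz
          · rw [hd, deg_pt hα hβ] at hdeg
            simp [hmem] at hdeg
        · have hd : deg s w ≤ 2 := by
            rw [hae, deg_pt hα hβ]
            simp [hmem]
          have hz' := hzw.symm
          rw [hae, nb_pt hα hβ] at hz'
          rcases hz' with rfl | rfl | rfl | rfl
          · rw [hmemS _ _ (by norm_num) (by norm_num)] at hzS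
            omega
          · have : 2 ≤ deg s (pt p α β (0 - 1) 1) := by
              rw [deg_pt hα hβ]
              simp [hmem]
            omega
          · have : 2 ≤ deg s (pt p α β 0 (1 + 1)) := by
              rw [deg_pt hα hβ]
              simp [hmem]
            omega
          · simp [hmem] at hz
      · have h1 := Finset.card_le_card (hsub' hwS)
        rw [Finset.card_erase_of_mem (Finset.mem_sdiff.2 ⟨hz, hzS⟩)] at h1
        exact .inl (by omega)
    · exfalso
      have hwd : deg s w ≤ 2 := by
        have h1 := deg_strip_le_one h hwS
        have h2 := deg_insert_le (by omega) (by omega) ((S.erase p).erase a) q w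
        have h3 := deg_insert_le (by omega) (by omega) (insert q ((S.erase p).erase a)) b w
        have h6 := deg_mono ((Finset.erase_subset a (S.erase p)).trans (Finset.erase_subset p S)) w
        rw [← hseq] at h3
        rw [← hS] at h1
        split_ifs at h2 h3 with h7 h8 h8
        -- A site outside gains at most one from the neighbouring particles q and b, since the torus
        -- has no triangles; its degree is thus at most 2.
        · exact (not_nb_of_nb h hqb h7 h8).elim
        all_goals omega
      by_cases hzS : z ∈ S
      · have h1 : 3 ≤ deg S z := three_le_deg_strip h hzS
        have h2 := deg_le_deg_erase (by omega) (by omega) S p z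
        have h3 := deg_le_deg_erase (by omega) (by omega) (S.erase p) a z
        have h6 : deg ((S.erase p).erase a) z ≤ deg s z := deg_mono (by
          conv_rhs => rw [hseq]
          exact (Finset.subset_insert _ _).trans (Finset.subset_insert _ _)) z
        split_ifs at h2 h3 with h7 h8 h8
        · exact not_nb_of_nb h hpa h7 h8
        all_goals omega
      · rcases (hsS z hzS).1 hz with rfl | rfl
        · have hz' := hzw
          rw [hqe, nb_pt hα hβ] at hz'
          have hd : deg s z = 1 := by
            rw [hqe, deg_pt hα hβ]
            simp [hmem]
          have hd' : deg s w ≤ 1 := by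
            rcases hz' with rfl | rfl | rfl | rfl
            · rw [deg_pt hα hβ]
              simp [hmem]
            · exact absurd ((hmemS _ _ (by norm_num) (by norm_num)).2 (by norm_num)) hwS
            · rw [deg_pt hα hβ]
              simp [hmem]
            · exact absurd ((hmem _ _ (by norm_num) (by norm_num) (by norm_num) (by norm_num)).2
                (by norm_num)) hw
          omega
        · have hd : 2 ≤ deg s z := by
            rw [hbe, deg_pt hα hβ]
            simp [hmem]
          omega

/-- The states joined to the strip at low energy are near the strip. -/
theorem near_of_chain (h : Sizes K L N₀) {s t : Finset (Site K L)} (hcard : s.card = L * N₀)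
    (hs : cut s ≤ L + 3) (hn : Near N₀ k s)
    (hc : Relation.ReflTransGen (fun a b => Move a b ∧ cut b ≤ L + 3) s t) : Near N₀ k t := by
  have : t.card = L * N₀ ∧ cut t ≤ L + 3 ∧ Near N₀ k t := by
    induction hc with
    | refl => exact ⟨hcard, hs, hn⟩
    | tail _ h1 ih =>
      exact ⟨h1.1.card_eq.trans ih.1, h1.2, ih.2.2.move h ih.1 h1.1 ih.2.1 h1.2⟩
  exact this.2.2

end Kawasaki

set_option linter.unusedSectionVars false

/-! ### Regions in coordinates, criteria for not being near, and transport. -/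

namespace Kawasaki

variable {K L N₀ : ℕ} [NeZero K] [NeZero L] {κ : ZMod K}

/-- The site in row `v` and in the `u`-th column to the right of the column `κ`. -/
def site (κ : ZMod K) (u v : ℕ) : Site K L := (κ + u, v)

/-- The position of the column of `x` relative to the column `κ`. -/
def col (κ : ZMod K) (x : Site K L) : ℕ := (x.1 - κ).val

open scoped Classical in
/-- The set of the sites whose coordinates relative to the column `κ` satisfy `P`. -/
noncomputable def region (L : ℕ) [NeZero L] (κ : ZMod K) (P : ℕ → ℕ → Prop) : Finset (Site K L) :=
  Finset.univ.filter fun x => P (col κ x) x.2.val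

theorem mem_region {P : ℕ → ℕ → Prop} {x : Site K L} :
    x ∈ region L κ P ↔ P (col κ x) x.2.val := by
  simp [region]

theorem col_lt (x : Site K L) : col κ x < K := ZMod.val_lt _

theorem row_lt (x : Site K L) : x.2.val < L := ZMod.val_lt _

theorem col_site {u v : ℕ} (hu : u < K) : col κ (site κ u v : Site K L) = u := by
  unfold col site
  rw [show κ + (u : ZMod K) - κ = u by ring, ZMod.val_cast_of_lt hu]

theorem row_site {u v : ℕ} (hv : v < L) : (site κ u v : Site K L).2.val = v :=
  ZMod.val_cast_of_lt hv

theorem site_mem_region {P : ℕ → ℕ → Prop} {u v : ℕ} (hu : u < K) (hv : v < L) :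
    (site κ u v : Site K L) ∈ region L κ P ↔ P u v := by
  rw [mem_region, col_site hu, row_site hv]

theorem site_col_row (x : Site K L) : site κ (col κ x) x.2.val = x := by
  unfold site col
  rw [ZMod.natCast_zmod_val, ZMod.natCast_zmod_val]
  ext <;> simp

theorem site_inj {u v u' v' : ℕ} (hu : u < K) (hv : v < L) (hu' : u' < K) (hv' : v' < L)
    (h : (site κ u v : Site K L) = site κ u' v') : u = u' ∧ v = v' := by
  have h1 := congrArg (col κ) h
  have h2 := congrArg (fun x : Site K L => x.2.val) h
  simp only [row_site hv, row_site hv'] at h2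
  rw [col_site hu, col_site hu'] at h1
  exact ⟨h1, h2⟩

theorem eq_site_iff {x : Site K L} {u v : ℕ} (hu : u < K) (hv : v < L) :
    x = site κ u v ↔ col κ x = u ∧ x.2.val = v := by
  constructor
  · rintro rfl
    exact ⟨col_site hu, row_site hv⟩
  · rintro ⟨rfl, rfl⟩
    exact (site_col_row x).symm

theorem region_congr {P Q : ℕ → ℕ → Prop} (h : ∀ u v, u < K → v < L → (P u v ↔ Q u v)) :
    region L κ P = region L κ Q := by
  ext x
  rw [mem_region, mem_region, h _ _ (col_lt x) (row_lt x)]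

theorem region_succ (hK : 2 ≤ K) {P Q : ℕ → ℕ → Prop}
    (h : ∀ u v, u < K → v < L → (P u v ↔ Q (if u = 0 then K - 1 else u - 1) v)) :
    region L κ P = region L (κ + 1) Q := by
  ext x
  rw [mem_region, mem_region, h _ _ (col_lt x) (row_lt x)]
  have := val_sub_one_cases hK (x.1 - κ)
  unfold col
  rw [← this, sub_sub]

theorem site_period (v : ℕ) : (site κ K v : Site K L) = site κ 0 v := by
  simp [site]

theorem site_period' (u : ℕ) : (site κ u L : Site K L) = site κ u 0 := by
  simp [site]

theorem nb_site_col (u v : ℕ) : Nb (site κ u v : Site K L) (site κ (u + 1) v) := by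
  left
  ext <;> simp [site, e₁, add_assoc]

theorem nb_site_row (u v : ℕ) : Nb (site κ u v : Site K L) (site κ u (v + 1)) := by
  right; right; left
  ext <;> simp [site, e₂]

theorem col_add_e₁ (hK : 2 ≤ K) (x : Site K L) :
    col κ (x + e₁) = if col κ x + 1 = K then 0 else col κ x + 1 := by
  unfold col
  rw [← val_add_one_cases hK]
  congr 1
  simp [e₁]
  ring

theorem row_add_e₂ (hL : 2 ≤ L) (x : Site K L) :
    (x + e₂).2.val = if x.2.val + 1 = L then 0 else x.2.val + 1 := by
  rw [← val_add_one_cases hL]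
  simp [e₂]

theorem Nb.row_eq_or {x y : Site K L} (hK : 2 ≤ K) (h : Nb x y) :
    (x.2 = y.2 ∧ (col κ y = (if col κ x + 1 = K then 0 else col κ x + 1) ∨
      col κ x = if col κ y + 1 = K then 0 else col κ y + 1)) ∨ col κ x = col κ y := by
  rcases h with rfl | rfl | rfl | rfl
  · exact .inl ⟨by simp [e₁], .inl (col_add_e₁ hK x)⟩
  · refine .inl ⟨by simp [e₁], .inr ?_⟩
    rw [← col_add_e₁ hK]
    simp
  · exact .inr (by simp [col, e₂])
  · exact .inr (by simp [col, e₂])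

/-- The second alternative describes the part of the strip that wraps around past the column K - 1.
-/
theorem mem_strip_iff_col {l : ZMod K} (hN : N₀ < K) {x : Site K L} :
    x ∈ stripSet K L N₀ l ↔ ((l - κ).val ≤ col κ x ∧ col κ x < (l - κ).val + N₀) ∨
      col κ x + K < (l - κ).val + N₀ := by
  rw [mem_stripSet]
  have h1 := ZMod.val_lt (l - κ)
  have h2 := col_lt (κ := κ) x
  have h3 : x.1 - l = (x.1 - κ) - (l - κ) := by ring
  by_cases hle : (l - κ).val ≤ col κ x
  · rw [h3, ZMod.val_sub hle]
    unfold col at *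
    omega
  · have h4 : (x.1 - l).val = col κ x + K - (l - κ).val := by
      have : x.1 - l = ((col κ x + K - (l - κ).val : ℕ) : ZMod K) := by
        rw [Nat.cast_sub (by omega)]
        push_cast
        unfold col
        rw [ZMod.natCast_zmod_val, ZMod.natCast_zmod_val]
        simp
      rw [this, ZMod.val_cast_of_lt (by omega)]
    rw [h4]
    omega

/-- A bound on the cut of a set whose rows are intervals and with at most two vertical exits. -/
theorem cut_region_le (hK : 2 ≤ K) (hL : 2 ≤ L) {P : ℕ → ℕ → Prop} (f : ℕ → ℕ) (u₁ v₁ u₂ v₂ : ℕ)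
    (hrow : ∀ u v, u < K → v < L → P u v → ¬ P (if u + 1 = K then 0 else u + 1) v → u = f v)
    (hcol : ∀ u v, u < K → v < L → P u v → ¬ P u (if v + 1 = L then 0 else v + 1) →
      (u = u₁ ∧ v = v₁) ∨ (u = u₂ ∧ v = v₂)) : cut (region L κ P) ≤ L + 2 := by
  unfold cut exits
  refine Nat.add_le_add ?_ ?_
  · have : (Finset.univ : Finset (ZMod L)).card = L := by rw [Finset.card_univ, ZMod.card]
    conv_rhs => rw [← this]
    refine Finset.card_le_card_of_injOn (fun x => x.2) (fun _ _ => Finset.mem_univ _) ?_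
    intro x hx y hy hxy
    have hval : ∀ z : Site K L, z ∈ (region L κ P).filter (fun x => x + e₁ ∉ region L κ P) →
        col κ z = f z.2.val := by
      intro z hz
      rw [Finset.mem_filter, mem_region, mem_region, col_add_e₁ hK] at hz
      have h2 : (z + e₁).2 = z.2 := by simp [e₁]
      rw [h2] at hz
      exact hrow _ _ (col_lt z) (row_lt z) hz.1 hz.2
    have h1 := hval x hx
    have h2 := hval y hy
    have h3 : x.2 = y.2 := hxy
    rw [← site_col_row (κ := κ) x, ← site_col_row (κ := κ) y, h1, h2, h3]
  · refine (Finset.card_le_card (t := {site κ u₁ v₁, site κ u₂ v₂}) ?_).trans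
      (Finset.card_le_two)
    intro z hz
    rw [Finset.mem_filter, mem_region, mem_region, row_add_e₂ hL] at hz
    have h2 : col κ (z + e₂) = col κ z := by simp [col, e₂]
    rw [h2] at hz
    rw [Finset.mem_insert, Finset.mem_singleton, ← site_col_row (κ := κ) z]
    rcases hcol _ _ (col_lt z) (row_lt z) hz.1 hz.2 with ⟨h3, h4⟩ | ⟨h3, h4⟩ <;> rw [h3, h4] <;> simp

section NotNear

variable {P : ℕ → ℕ → Prop} {l : ZMod K}

/-- The columns of the strip at distance `d` to the right. -/
def InStrip (K N₀ d u : ℕ) : Prop := (d ≤ u ∧ u < d + N₀) ∨ u + K < d + N₀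

theorem two_le_card_sdiff (hN : N₀ < K) {u v u' v' : ℕ} (hu : u < K) (hv : v < L) (hu' : u' < K)
    (hv' : v' < L) (hP : P u v) (hP' : P u' v') (hs : ¬ InStrip K N₀ (l - κ).val u)
    (hs' : ¬ InStrip K N₀ (l - κ).val u') (hne : u ≠ u' ∨ v ≠ v') :
    1 < (region L κ P \ stripSet K L N₀ l).card := by
  rw [Finset.one_lt_card]
  have hmem : ∀ {u v : ℕ}, u < K → v < L → P u v → ¬ InStrip K N₀ (l - κ).val u →
      (site κ u v : Site K L) ∈ region L κ P \ stripSet K L N₀ l := by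
    intro u v hu hv hP hs
    rw [Finset.mem_sdiff, site_mem_region hu hv, mem_strip_iff_col (κ := κ) hN, col_site hu]
    exact ⟨hP, hs⟩
  refine ⟨_, hmem hu hv hP hs, _, hmem hu' hv' hP' hs', fun h => ?_⟩
  have := site_inj hu hv hu' hv' h
  omega

theorem three_le_card_sdiff (hN : N₀ < K) {u v u' v' u'' v'' : ℕ} (hu : u < K) (hv : v < L)
    (hu' : u' < K) (hv' : v' < L) (hu'' : u'' < K) (hv'' : v'' < L) (hP : P u v) (hP' : P u' v')
    (hP'' : P u'' v'') (hs : ¬ InStrip K N₀ (l - κ).val u) (hs' : ¬ InStrip K N₀ (l - κ).val u')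
    (hs'' : ¬ InStrip K N₀ (l - κ).val u'') (h1 : u ≠ u' ∨ v ≠ v') (h2 : u ≠ u'' ∨ v ≠ v'')
    (h3 : u' ≠ u'' ∨ v' ≠ v'') : ¬ Near N₀ l (region L κ P) := by
  have hmem : ∀ {u v : ℕ}, u < K → v < L → P u v → ¬ InStrip K N₀ (l - κ).val u →
      (site κ u v : Site K L) ∈ region L κ P \ stripSet K L N₀ l := by
    intro u v hu hv hP hs
    rw [Finset.mem_sdiff, site_mem_region hu hv, mem_strip_iff_col (κ := κ) hN, col_site hu]
    exact ⟨hP, hs⟩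
  have h : 2 < (region L κ P \ stripSet K L N₀ l).card := by
    rw [Finset.two_lt_card]
    refine ⟨_, hmem hu hv hP hs, _, hmem hu' hv' hP' hs', _, hmem hu'' hv'' hP'' hs'',
      fun h => ?_, fun h => ?_, fun h => ?_⟩
    · have := site_inj hu hv hu' hv' h
      omega
    · have := site_inj hu hv hu'' hv'' h
      omega
    · have := site_inj hu' hv' hu'' hv'' h
      omega
  unfold Near
  omega

theorem not_near_of_two (hK : 2 ≤ K) (hN : N₀ < K) {u v u' v' : ℕ} (hu : u < K) (hv : v < L) (hu' : u' < K)
    (hv' : v' < L) (hP : P u v) (hP' : P u' v') (hs : ¬ InStrip K N₀ (l - κ).val u)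
    (hs' : ¬ InStrip K N₀ (l - κ).val u') (hne : u ≠ u' ∨ v ≠ v')
    (hadj : ∀ a b w, a < K → b < K → w < L → InStrip K N₀ (l - κ).val a →
      ¬ InStrip K N₀ (l - κ).val b → ¬ P a w → P b w →
      (b = if a + 1 = K then 0 else a + 1) ∨ (a = if b + 1 = K then 0 else b + 1) → False) :
    ¬ Near N₀ l (region L κ P) := by
  have h := two_le_card_sdiff hN hu hv hu' hv' hP hP' hs hs' hne
  rintro (h1 | ⟨-, p, hp, q, hq, hpq⟩)
  · omega
  · rw [Finset.mem_sdiff, mem_region, mem_strip_iff_col (κ := κ) hN] at hp hq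
    rcases hpq.row_eq_or (κ := κ) hK with ⟨h1, h2⟩ | h1
    · rw [← h1] at hq
      exact hadj _ _ _ (col_lt p) (col_lt q) (row_lt p) hp.1 hq.2 hp.2 hq.1 h2
    · rw [h1] at hp
      exact hq.2 hp.1

/-- A full column outside of the strip, up to one hole. -/
theorem not_near_of_col (hN : N₀ < K) (hL : 4 ≤ L) {u b : ℕ} (hu : u < K)
    (hs : ¬ InStrip K N₀ (l - κ).val u) (hP : ∀ v, v < L → v ≠ b → P u v) :
    ¬ Near N₀ l (region L κ P) := by
  -- Since L ≥ 4, three of the rows 0, 1, 2, 3 avoid the hole at b, and three particles outside are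
  -- too many.
  have key : ∀ i j m : ℕ, i < j → j < m → m < 4 → i ≠ b → j ≠ b → m ≠ b →
      ¬ Near N₀ l (region L κ P) := fun i j m h1 h2 h3 h4 h5 h6 =>
    three_le_card_sdiff hN hu (by omega) hu (by omega) hu (by omega) (hP i (by omega) h4)
      (hP j (by omega) h5) (hP m (by omega) h6) hs hs hs (by omega) (by omega) (by omega)
  by_cases h0 : b = 0
  · exact key 1 2 3 (by omega) (by omega) (by omega) (by omega) (by omega) (by omega)
  by_cases h1 : b = 1
  · exact key 0 2 3 (by omega) (by omega) (by omega) (by omega) (by omega) (by omega)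
  by_cases h2 : b = 2
  · exact key 0 1 3 (by omega) (by omega) (by omega) (by omega) (by omega) (by omega)
  · exact key 0 1 2 (by omega) (by omega) (by omega) (by omega) (by omega) (by omega)

end NotNear

/-! ### Paths -/

/-- The jumps of energy at most four above the strips, to a state which is near no other strips
than those in `A`. -/
def Bridge (N₀ : ℕ) (A : ZMod K → Prop) (s t : Finset (Site K L)) : Prop :=
  Relation.ReflTransGen
    (fun a b => Move a b ∧ cut b ≤ L + 4 ∧ ∀ l, ¬ A l → ¬ Near N₀ l b) s t

/-- The nearest-neighbour paths in the region `D`. -/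
def Route (κ : ZMod K) (D : ℕ → ℕ → Prop) (x y : Site K L) : Prop :=
  Relation.ReflTransGen (fun a b : Site K L => Nb a b ∧ D (col κ a) a.2.val ∧ D (col κ b) b.2.val)
    x y

theorem Route.symm {D : ℕ → ℕ → Prop} {x y : Site K L} (h : Route κ D x y) : Route κ D y x := by
  induction h with
  | refl => exact .refl
  | tail _ h1 ih => exact .head ⟨h1.1.symm, h1.2.2, h1.2.1⟩ ih

theorem Route.trans {D : ℕ → ℕ → Prop} {x y z : Site K L} (h : Route κ D x y)
    (h' : Route κ D y z) : Route κ D x z :=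
  Relation.ReflTransGen.trans h h'

theorem route_row {D : ℕ → ℕ → Prop} {u u' v : ℕ} (hle : u ≤ u') (hu : u' < K) (hv : v < L)
    (h : ∀ a, u ≤ a → a ≤ u' → D a v) : Route κ D (site κ u v : Site K L) (site κ u' v) := by
  obtain ⟨n, rfl⟩ := Nat.exists_eq_add_of_le hle
  induction n with
  | zero => exact .refl
  | succ n ih =>
    refine .tail (ih (by omega) (by omega) fun a h1 h2 => h a h1 (by omega))
      ⟨nb_site_col _ _, ?_, ?_⟩
    · rw [col_site (by omega), row_site hv]
      exact h _ (by omega) (by omega)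
    · rw [col_site hu, row_site hv]
      exact h _ (by omega) (by omega)

theorem route_around {D : ℕ → ℕ → Prop} {v : ℕ} (hv : v < L) (h : D (K - 1) v) (h' : D 0 v) :
    Route κ D (site κ (K - 1) v : Site K L) (site κ 0 v) := by
  have hK := NeZero.pos K
  refine .single ⟨?_, ?_, ?_⟩
  · have := nb_site_col (L := L) (κ := κ) (K - 1) v
    rwa [Nat.sub_add_cancel hK, site_period] at this
  · rwa [col_site (by omega), row_site hv]
  · rwa [col_site hK, row_site hv]

theorem route_up {D : ℕ → ℕ → Prop} {u v : ℕ} (hu : u < K) (hv : v < L) (h : D u v)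
    (h' : D u (if v + 1 = L then 0 else v + 1)) :
    Route κ D (site κ u v : Site K L) (site κ u (if v + 1 = L then 0 else v + 1)) := by
  refine .single ⟨?_, ?_, ?_⟩
  · have := nb_site_row (L := L) (κ := κ) u v
    split_ifs with h1
    · rwa [h1, site_period'] at this
    · exact this
  · rwa [col_site hu, row_site hv]
  · rwa [col_site hu, row_site (by split_ifs <;> omega)]

theorem region_insert {P : ℕ → ℕ → Prop} (x : Site K L) :
    insert x (region L κ P) = region L κ fun u v => P u v ∨ (u = col κ x ∧ v = x.2.val) := by
  ext y
  rw [Finset.mem_insert, mem_region, mem_region, or_comm]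
  nth_rw 1 [← site_col_row (κ := κ) x, eq_site_iff (col_lt x) (row_lt x)]

theorem region_erase {P : ℕ → ℕ → Prop} (x : Site K L) :
    (region L κ P).erase x = region L κ fun u v => P u v ∧ ¬ (u = col κ x ∧ v = x.2.val) := by
  ext y
  rw [Finset.mem_erase, mem_region, mem_region, and_comm, ne_eq]
  nth_rw 1 [← site_col_row (κ := κ) x, eq_site_iff (col_lt x) (row_lt x)]

/-- A particle is transported along a route. -/
theorem Route.bridge_insert (hK : 2 ≤ K) (hL : 2 ≤ L) {A : ZMod K → Prop} {P D : ℕ → ℕ → Prop}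
    (hcut : cut (region L κ P) ≤ L + 2) (hDP : ∀ u v, u < K → v < L → D u v → ¬ P u v)
    (hA : ∀ l, ¬ A l → ∀ a b, a < K → b < L → D a b →
      ¬ Near N₀ l (region L κ fun u v => P u v ∨ (u = a ∧ v = b)))
    {x y : Site K L} (h : Route κ D x y) :
    Bridge N₀ A (insert x (region L κ P)) (insert y (region L κ P)) := by
  have hnot : ∀ z : Site K L, D (col κ z) z.2.val → z ∉ region L κ P := by
    intro z hz
    rw [mem_region]
    exact hDP _ _ (col_lt z) (row_lt z) hz
  induction h with
  | refl => exact .refl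
  | @tail b c _ h1 ih =>
    obtain ⟨hbc, hb, hc⟩ := h1
    refine .tail ih ⟨⟨b, Finset.mem_insert_self _ _, c, ?_, hbc, ?_⟩, ?_, fun l hl => ?_⟩
    · rw [Finset.mem_insert, not_or]
      exact ⟨(hbc.ne hK hL).symm, hnot c hc⟩
    · rw [Finset.erase_insert (hnot b hb)]
    -- A lone extra particle costs at most 2, on top of a base set of cut at most L + 2.
    · have := cut_insert hK hL (hnot c hc)
      omega
    · rw [region_insert]
      exact hA l hl _ _ (col_lt c) (row_lt c) hc

theorem deg_le_four (s : Finset (Site K L)) (x : Site K L) : deg s x ≤ 4 := by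
  unfold deg
  split_ifs <;> omega

/-- A hole is transported along a route. -/
theorem Route.bridge_erase (hK : 2 ≤ K) (hL : 2 ≤ L) {A : ZMod K → Prop} {P D : ℕ → ℕ → Prop}
    (hcut : cut (region L κ P) ≤ L + 2) (hDP : ∀ u v, u < K → v < L → D u v → P u v)
    (hA : ∀ l, ¬ A l → ∀ a b, a < K → b < L → D a b →
      ¬ Near N₀ l (region L κ fun u v => P u v ∧ ¬ (u = a ∧ v = b)))
    {x y : Site K L} (h : Route κ D x y) :
    Bridge N₀ A ((region L κ P).erase x) ((region L κ P).erase y) := by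
  have hmem : ∀ z : Site K L, D (col κ z) z.2.val → z ∈ region L κ P := by
    intro z hz
    rw [mem_region]
    exact hDP _ _ (col_lt z) (row_lt z) hz
  induction h with
  | refl => exact .refl
  | @tail b c _ h1 ih =>
    obtain ⟨hbc, hb, hc⟩ := h1
    have hne := hbc.ne hK hL
    refine .tail ih ⟨⟨c, Finset.mem_erase.2 ⟨hne.symm, hmem c hc⟩, b, Finset.notMem_erase _ _,
      hbc.symm, ?_⟩, ?_, fun l hl => ?_⟩
    · rw [Finset.erase_right_comm, Finset.insert_erase (Finset.mem_erase.2 ⟨hne, hmem b hb⟩)]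
    · have h1 := cut_insert hK hL (Finset.notMem_erase c (region L κ P))
      rw [Finset.insert_erase (hmem c hc)] at h1
      -- Removing a site of degree at most 4 also costs at most 2.
      have := deg_le_four ((region L κ P).erase c) c
      omega
    · rw [region_erase]
      exact hA l hl _ _ (col_lt c) (row_lt c) hc

end Kawasaki

set_option linter.unusedSectionVars false

/-! ### Windows: moving one column of a strip to its other side. -/

namespace Kawasaki

variable {K L N₀ : ℕ} [NeZero K] [NeZero L] {κ : ZMod K}

/-- The strip with the lowest `s` particles of its left column moved to its right side. -/
def InWindow (N₀ s u v : ℕ) : Prop := (1 ≤ u ∧ u < N₀) ∨ (u = 0 ∧ s ≤ v) ∨ (u = N₀ ∧ v < s)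

/-- The window of shift `s`. -/
noncomputable def window (L N₀ : ℕ) [NeZero L] (κ : ZMod K) (s : ℕ) : Finset (Site K L) :=
  region L κ (InWindow N₀ s)

theorem window_zero (h : Sizes K L N₀) : window L N₀ κ 0 = stripSet K L N₀ κ := by
  have := h.three_le
  ext x
  unfold window
  rw [mem_region, mem_stripSet]
  unfold InWindow col
  omega

theorem window_last (h : Sizes K L N₀) : window L N₀ κ L = stripSet K L N₀ (κ + 1) := by
  have h1 := h.three_le
  have h2 := h.two_mul_lt
  have h3 : stripSet K L N₀ (κ + 1) = region L (κ + 1) fun u _ => u < N₀ := by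
    ext x
    rw [mem_region, mem_stripSet]
    rfl
  rw [h3]
  refine region_succ (by omega) fun u v hu hv => ?_
  unfold InWindow
  split_ifs <;> omega

theorem val_sub_ne_zero {l : ZMod K} (h : l ≠ κ) : (l - κ).val ≠ 0 := by
  rw [ne_eq, ZMod.val_eq_zero, sub_eq_zero]
  exact h

theorem val_sub_ne_one (hK : 2 ≤ K) {l : ZMod K} (h : l ≠ κ + 1) : (l - κ).val ≠ 1 := by
  intro h1
  have : Fact (1 < K) := ⟨by omega⟩
  rw [← ZMod.val_one K] at h1
  exact h (by rw [← ZMod.val_injective K h1]; ring)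

/-- Moving one particle from the left to the right side of the window. -/
theorem window_step (h : Sizes K L N₀) {A : ZMod K → Prop} {s : ℕ} (hs : s < L)
    (hA : s < 2 → A κ) (hA' : L < s + 3 → A (κ + 1)) :
    Bridge N₀ A (window L N₀ κ s) (window L N₀ κ (s + 1)) := by
  have h1 := h.three_le
  have h2 := h.two_mul_lt
  have h3 := h.four_le
  have h4 := h.lt
  -- The particle goes left across the period and reaches the right side through the empty part of
  -- its own row.
  have hroute : Route κ (fun u v => v = s ∧ (u = 0 ∨ N₀ ≤ u)) (site κ 0 s : Site K L)
      (site κ N₀ s) := by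
    refine Route.symm (Route.trans (y := site κ (K - 1) s) ?_ ?_)
    · exact route_row (by omega) (by omega) hs fun a _ _ => ⟨rfl, by omega⟩
    · exact route_around hs ⟨rfl, by omega⟩ ⟨rfl, by omega⟩
  have key := hroute.bridge_insert (N₀ := N₀) (A := A) (by omega) (by omega)
    (P := fun u v => (1 ≤ u ∧ u < N₀) ∨ (u = 0 ∧ s < v) ∨ (u = N₀ ∧ v < s)) ?_ ?_ ?_
  · rw [region_insert, region_insert, col_site (by omega), col_site (by omega), row_site hs] at key
    rw [row_site hs] at key
    convert key using 1
    · refine region_congr fun u v hu hv => ?_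
      unfold InWindow
      omega
    · refine region_congr fun u v hu hv => ?_
      unfold InWindow
      omega
  · refine cut_region_le (by omega) (by omega)
      (fun v => if v < s then N₀ else N₀ - 1) 0 (L - 1) N₀ (s - 1) ?_ ?_
    · intro u v hu hv hP hn
      split_ifs at hn ⊢ <;> omega
    · intro u v hu hv hP hn
      split_ifs at hn ⊢ <;> omega
  · intro u v hu hv hD
    omega
  · intro l hl a b ha hb hD
    -- Two settled particles in column N₀ keep the state away from the strip at κ once s ≥ 2. Two
    -- waiting particles in column 0 keep it away from the strip at κ + 1 while s + 3 ≤ L. Every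
    -- other strip misses one of the full columns 1 and N₀ - 1.
    have hd := ZMod.val_lt (l - κ)
    by_cases hl0 : l = κ
    · have hs2 : 2 ≤ s := by
        by_contra hlt
        exact hl (hl0 ▸ hA (by omega))
      have hd0 : (l - κ).val = 0 := by rw [hl0, sub_self, ZMod.val_zero]
      by_cases ha0 : a = 0
      · refine not_near_of_two (κ := κ) (u := N₀) (v := 0) (u' := N₀) (v' := 1) (by omega)
          (by omega) (by omega) (by omega) (by omega) (by omega) (by omega) (by omega) ?_ ?_
          (by omega) ?_
        · unfold InStrip; omega
        · unfold InStrip; omega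
        · intro x y w hx hy hw
          unfold InStrip
          split_ifs <;> omega
      · refine three_le_card_sdiff (κ := κ) (u := N₀) (v := 0) (u' := N₀) (v' := 1) (u'' := a)
          (v'' := b) (by omega) (by omega) (by omega) (by omega) (by omega) (by omega) (by omega)
          (by omega) (by omega) (by omega) ?_ ?_ ?_ (by omega) (by omega) (by omega) <;>
        · unfold InStrip; omega
    by_cases hl1 : l = κ + 1
    · have hs2 : s + 3 ≤ L := by
        by_contra hlt
        exact hl (hl1 ▸ hA' (by omega))
      have hd1 : (l - κ).val = 1 := by
        have : Fact (1 < K) := ⟨by omega⟩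
        rw [hl1, add_sub_cancel_left, ZMod.val_one]
      by_cases ha0 : a = N₀
      · refine not_near_of_two (κ := κ) (u := 0) (v := L - 1) (u' := 0) (v' := L - 2) (by omega)
          (by omega) (by omega) (by omega) (by omega) (by omega) (by omega) (by omega) ?_ ?_
          (by omega) ?_
        · unfold InStrip; omega
        · unfold InStrip; omega
        · intro x y w hx hy hw
          unfold InStrip
          split_ifs <;> omega
      · refine three_le_card_sdiff (κ := κ) (u := 0) (v := L - 1) (u' := 0) (v' := L - 2)
          (u'' := a)
          (v'' := b) (by omega) (by omega) (by omega) (by omega) (by omega) (by omega) (by omega)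
          (by omega) (by omega) (by omega) ?_ ?_ ?_ (by omega) (by omega) (by omega) <;>
        · unfold InStrip; omega
    · have hd0 := val_sub_ne_zero hl0
      have hd1 := val_sub_ne_one (by omega) hl1
      by_cases hin : InStrip K N₀ (l - κ).val 1
      · refine not_near_of_col (κ := κ) (u := N₀ - 1) (b := L) (by omega) h3 (by omega) ?_ ?_
        · unfold InStrip at hin ⊢; omega
        · intro v _ _; omega
      · refine not_near_of_col (κ := κ) (u := 1) (b := L) (by omega) h3 (by omega) hin ?_
        intro v _ _; omega

theorem window_steps (h : Sizes K L N₀) {A : ZMod K → Prop} {s n : ℕ} (hs : s + n ≤ L)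
    (hA : s < 2 → A κ) (hA' : L < s + n + 2 → A (κ + 1)) :
    Bridge N₀ A (window L N₀ κ s) (window L N₀ κ (s + n)) := by
  induction n with
  | zero => exact .refl
  | succ n ih =>
    exact (ih (by omega) fun h1 => hA' (by omega)).trans
      (window_step h (s := s + n) (by omega) (fun h1 => hA (by omega)) fun h1 => hA' (by omega))

/-- The two stray particles or the two holes used for the passage near the strip at `κ` keep a
distance from its defects. -/
theorem not_near_center (h : Sizes K L N₀) {P : ℕ → ℕ → Prop} {u v u' v' : ℕ} (hu : u < K)
    (hv : v < L) (hu' : u' < K) (hv' : v' < L) (hP : P u v) (hP' : P u' v') (hs : N₀ ≤ u)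
    (hs' : N₀ ≤ u') (hne : u ≠ u' ∨ v ≠ v')
    (hadj : ∀ b w, w < L → b < K → P b w → (b = N₀ → ¬ P (N₀ - 1) w → False) ∧
      (b = K - 1 → ¬ P 0 w → False)) :
    ¬ Near N₀ κ (region L κ P) := by
  have h1 := h.three_le
  have h2 := h.two_mul_lt
  have hd : (κ - κ).val = 0 := by rw [sub_self, ZMod.val_zero]
  refine not_near_of_two (κ := κ) (by omega) (by omega) hu hv hu' hv' hP hP' ?_ ?_ hne ?_
  · unfold InStrip; omega
  · unfold InStrip; omega
  · intro a b w ha hb hw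
    rw [hd]
    unfold InStrip
    intro h3 h4 h5 h6 h7
    have h8 := hadj b w hw hb h6
    have h9 : (b = N₀ ∧ a = N₀ - 1) ∨ (b = K - 1 ∧ a = 0) := by
      split_ifs at h7 <;> omega
    rcases h9 with ⟨h9, rfl⟩ | ⟨h9, rfl⟩
    · exact h8.1 h9 h5
    · exact h8.2 h9 h5

end Kawasaki

set_option linter.unusedSectionVars false

/-! ### The detour around an intermediate strip. -/

namespace Kawasaki

variable {K L N₀ : ℕ} [NeZero K] [NeZero L] {κ : ZMod K}

/-- A strip other than the ones at `κ` and `κ - 1` misses one of the columns `0` and `N₀ - 2`. -/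
theorem not_near_of_cols (h : Sizes K L N₀) {P : ℕ → ℕ → Prop} {l : ZMod K} {b : ℕ}
    (h0 : (l - κ).val ≠ 0) (hlast : (l - κ).val ≠ K - 1) (hP : ∀ v, v < L → v ≠ b → P 0 v)
    (hP' : ∀ v, v < L → v ≠ b → P (N₀ - 2) v) : ¬ Near N₀ l (region L κ P) := by
  have h1 := h.three_le
  have h2 := h.two_mul_lt
  have h3 := h.four_le
  have hd := ZMod.val_lt (l - κ)
  by_cases hin : InStrip K N₀ (l - κ).val 0
  · refine not_near_of_col (κ := κ) (u := N₀ - 2) (b := b) (by omega) h3 (by omega) ?_ hP'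
    unfold InStrip at hin ⊢; omega
  · exact not_near_of_col (κ := κ) (u := 0) (b := b) (by omega) h3 (by omega) hin hP

/-- The first particle passes from the left to the right. -/
theorem first_particle (h : Sizes K L N₀) (A : ZMod K → Prop) :
    Bridge N₀ A
      (region L κ fun u v => u + 2 ≤ N₀ ∨ (u = K - 1 ∧ L ≤ v + 2) ∨ (u = N₀ - 1 ∧ v + 2 < L))
      (region L κ fun u v => u + 2 ≤ N₀ ∨ (u = K - 1 ∧ v + 2 = L) ∨ (u = N₀ - 1 ∧ v + 2 < L) ∨
        (u = N₀ ∧ v = 1)) := by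
  have h1 := h.three_le
  have h2 := h.two_mul_lt
  have h3 := h.four_le
  have h4 := h.lt
  -- The particle changes rows in column N₀ + 1 and enters column N₀ only in rows 0 and 1. There the
  -- strip is intact, so it never faces the holes in rows L - 2 and L - 1.
  have hroute : Route κ (fun u v => (N₀ + 1 ≤ u ∧ ¬ (u = K - 1 ∧ v + 2 = L)) ∨ (u = N₀ ∧ v < 2))
      (site κ (K - 1) (L - 1) : Site K L) (site κ N₀ 1) := by
    have r1 : Route κ (fun u v => (N₀ + 1 ≤ u ∧ ¬ (u = K - 1 ∧ v + 2 = L)) ∨ (u = N₀ ∧ v < 2))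
        (site κ (N₀ + 1) (L - 1) : Site K L) (site κ (K - 1) (L - 1)) :=
      route_row (by omega) (by omega) (by omega) fun a _ _ => by omega
    have r2 := route_up (κ := κ) (K := K) (L := L) (u := N₀ + 1) (v := L - 1)
      (D := fun u v => (N₀ + 1 ≤ u ∧ ¬ (u = K - 1 ∧ v + 2 = L)) ∨ (u = N₀ ∧ v < 2)) (by omega)
      (by omega) (by omega) (by omega)
    rw [if_pos (by omega)] at r2
    have r3 := route_up (κ := κ) (K := K) (L := L) (u := N₀ + 1) (v := 0)
      (D := fun u v => (N₀ + 1 ≤ u ∧ ¬ (u = K - 1 ∧ v + 2 = L)) ∨ (u = N₀ ∧ v < 2)) (by omega)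
      (by omega) (by omega) (by omega)
    rw [if_neg (by omega)] at r3
    have r4 : Route κ (fun u v => (N₀ + 1 ≤ u ∧ ¬ (u = K - 1 ∧ v + 2 = L)) ∨ (u = N₀ ∧ v < 2))
        (site κ N₀ 1 : Site K L) (site κ (N₀ + 1) 1) :=
      route_row (by omega) (by omega) (by omega) fun a _ _ => by omega
    exact r1.symm.trans (r2.trans (r3.trans r4.symm))
  have key := hroute.bridge_insert (N₀ := N₀) (A := A) (by omega) (by omega)
    (P := fun u v => u + 2 ≤ N₀ ∨ (u = K - 1 ∧ v + 2 = L) ∨ (u = N₀ - 1 ∧ v + 2 < L)) ?_ ?_ ?_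
  · rw [region_insert, region_insert, col_site (by omega), col_site (by omega),
      row_site (by omega), row_site (by omega)] at key
    convert key using 1
    · exact region_congr fun u v hu hv => by omega
    · exact region_congr fun u v hu hv => by omega
  · refine cut_region_le (by omega) (by omega)
      (fun v => if v + 2 < L then N₀ - 1 else N₀ - 2) (K - 1) (L - 2) (N₀ - 1) (L - 3) ?_ ?_
    · intro u v hu hv hP hn
      split_ifs at hn ⊢ <;> omega
    · intro u v hu hv hP hn
      split_ifs at hn ⊢ <;> omega
  · intro u v hu hv hD
    omega
  · intro l hl a b ha hb hD
    have hd := ZMod.val_lt (l - κ)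
    by_cases hd0 : (l - κ).val = 0
    · rw [ZMod.val_eq_zero, sub_eq_zero] at hd0
      subst hd0
      refine not_near_center h (u := K - 1) (v := L - 2) (u' := a) (v' := b) (by omega)
        (by omega) ha hb (by omega) (by omega) (by omega) (by omega) (by omega) ?_
      intro y w hw hy hP
      constructor <;> omega
    by_cases hdl : (l - κ).val = K - 1
    · by_cases haK : a = K - 1
      · refine not_near_of_two (κ := κ) (u := N₀ - 1) (v := 0) (u' := N₀ - 1) (v' := 1) (by omega)
          (by omega) (by omega) (by omega) (by omega) (by omega) (by omega) (by omega) ?_ ?_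
          (by omega) ?_
        · unfold InStrip; omega
        · unfold InStrip; omega
        · intro x y w hx hy hw
          unfold InStrip
          split_ifs <;> omega
      · refine three_le_card_sdiff (κ := κ) (u := N₀ - 1) (v := 0) (u' := N₀ - 1) (v' := 1)
          (u'' := a)
          (v'' := b) (by omega) (by omega) (by omega) (by omega) (by omega) (by omega) (by omega)
          (by omega) (by omega) (by omega) ?_ ?_ ?_ (by omega) (by omega) (by omega) <;>
        · unfold InStrip; omega
    · exact not_near_of_cols h (b := L) hd0 hdl (fun v _ _ => by omega) fun v _ _ => by omega

/-- The second particle passes from the left to the right. -/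
theorem second_particle (h : Sizes K L N₀) (A : ZMod K → Prop) :
    Bridge N₀ A
      (region L κ fun u v => u + 2 ≤ N₀ ∨ (u = K - 1 ∧ v + 2 = L) ∨ (u = N₀ - 1 ∧ v + 2 < L) ∨
        (u = N₀ ∧ v = 1))
      (region L κ fun u v => u + 2 ≤ N₀ ∨ (u = N₀ - 1 ∧ v + 2 < L) ∨ (u = N₀ ∧ v < 2)) := by
  have h1 := h.three_le
  have h2 := h.two_mul_lt
  have h3 := h.four_le
  have h4 := h.lt
  -- Again column N₀ is entered only at the end, in row 0, while the first particle waits in row 1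
  -- in front of an occupied site.
  have hroute : Route κ (fun u v => N₀ + 1 ≤ u ∨ (u = N₀ ∧ v = 0))
      (site κ (K - 1) (L - 2) : Site K L) (site κ N₀ 0) := by
    have r1 : Route κ (fun u v => N₀ + 1 ≤ u ∨ (u = N₀ ∧ v = 0))
        (site κ (N₀ + 1) (L - 2) : Site K L) (site κ (K - 1) (L - 2)) :=
      route_row (by omega) (by omega) (by omega) fun a _ _ => by omega
    have r2 := route_up (κ := κ) (K := K) (L := L) (u := N₀ + 1) (v := L - 2)
      (D := fun u v => N₀ + 1 ≤ u ∨ (u = N₀ ∧ v = 0)) (by omega)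
      (by omega) (by omega) (by omega)
    rw [if_neg (by omega)] at r2
    have r3 := route_up (κ := κ) (K := K) (L := L) (u := N₀ + 1) (v := L - 2 + 1)
      (D := fun u v => N₀ + 1 ≤ u ∨ (u = N₀ ∧ v = 0)) (by omega)
      (by omega) (by omega) (by omega)
    rw [if_pos (by omega)] at r3
    have r4 : Route κ (fun u v => N₀ + 1 ≤ u ∨ (u = N₀ ∧ v = 0))
        (site κ N₀ 0 : Site K L) (site κ (N₀ + 1) 0) :=
      route_row (by omega) (by omega) (by omega) fun a _ _ => by omega
    exact r1.symm.trans (r2.trans (r3.trans r4.symm))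
  have key := hroute.bridge_insert (N₀ := N₀) (A := A) (by omega) (by omega)
    (P := fun u v => u + 2 ≤ N₀ ∨ (u = N₀ - 1 ∧ v + 2 < L) ∨ (u = N₀ ∧ v = 1)) ?_ ?_ ?_
  · rw [region_insert, region_insert, col_site (by omega), col_site (by omega),
      row_site (by omega), row_site (by omega)] at key
    convert key using 1
    · exact region_congr fun u v hu hv => by omega
    · exact region_congr fun u v hu hv => by omega
  · refine cut_region_le (by omega) (by omega)
      (fun v => if v = 1 then N₀ else if v + 2 < L then N₀ - 1 else N₀ - 2) (N₀ - 1) (L - 3) N₀ 1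
      ?_ ?_
    · intro u v hu hv hP hn
      split_ifs at hn ⊢ <;> omega
    · intro u v hu hv hP hn
      split_ifs at hn ⊢ <;> omega
  · intro u v hu hv hD
    omega
  · intro l hl a b ha hb hD
    have hd := ZMod.val_lt (l - κ)
    by_cases hd0 : (l - κ).val = 0
    · rw [ZMod.val_eq_zero, sub_eq_zero] at hd0
      subst hd0
      refine not_near_center h (u := N₀) (v := 1) (u' := a) (v' := b) (by omega)
        (by omega) ha hb (by omega) (by omega) (by omega) (by omega) (by omega) ?_
      intro y w hw hy hP
      constructor <;> omega
    by_cases hdl : (l - κ).val = K - 1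
    · refine three_le_card_sdiff (κ := κ) (u := N₀ - 1) (v := 0) (u' := N₀ - 1) (v' := 1)
        (u'' := N₀)
        (v'' := 1) (by omega) (by omega) (by omega) (by omega) (by omega) (by omega) (by omega)
        (by omega) (by omega) (by omega) ?_ ?_ ?_ (by omega) (by omega) (by omega) <;>
      · unfold InStrip; omega
    · exact not_near_of_cols h (b := L) hd0 hdl (fun v _ _ => by omega) fun v _ _ => by omega

/-- The first hole passes from the right to the left. -/
theorem first_hole (h : Sizes K L N₀) (A : ZMod K → Prop) :
    Bridge N₀ A
      (region L κ fun u v => u + 2 ≤ N₀ ∨ (u = N₀ - 1 ∧ v + 2 < L) ∨ (u = N₀ ∧ v < 2))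
      (region L κ fun u v => (u < N₀ ∧ ¬ (u = N₀ - 1 ∧ v + 2 = L) ∧ ¬ (u = 0 ∧ v = 1)) ∨
        (u = N₀ ∧ v < 2)) := by
  have h1 := h.three_le
  have h2 := h.two_mul_lt
  have h3 := h.four_le
  have h4 := h.lt
  -- The hole leaves column N₀ - 1 in row L - 1 at once. The two outside particles are in rows 0 and
  -- 1 of column N₀, so neither ever faces a hole.
  have hroute : Route κ (fun u v => u + 2 ≤ N₀ ∨ (u = N₀ - 1 ∧ v + 1 = L))
      (site κ (N₀ - 1) (L - 1) : Site K L) (site κ 0 1) := by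
    have r1 : Route κ (fun u v => u + 2 ≤ N₀ ∨ (u = N₀ - 1 ∧ v + 1 = L))
        (site κ 0 (L - 1) : Site K L) (site κ (N₀ - 1) (L - 1)) :=
      route_row (by omega) (by omega) (by omega) fun a _ _ => by omega
    have r2 := route_up (κ := κ) (K := K) (L := L) (u := 0) (v := L - 1)
      (D := fun u v => u + 2 ≤ N₀ ∨ (u = N₀ - 1 ∧ v + 1 = L)) (by omega)
      (by omega) (by omega) (by omega)
    rw [if_pos (by omega)] at r2
    have r3 := route_up (κ := κ) (K := K) (L := L) (u := 0) (v := 0)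
      (D := fun u v => u + 2 ≤ N₀ ∨ (u = N₀ - 1 ∧ v + 1 = L)) (by omega)
      (by omega) (by omega) (by omega)
    rw [if_neg (by omega)] at r3
    exact r1.symm.trans (r2.trans r3)
  have key := hroute.bridge_erase (N₀ := N₀) (A := A) (by omega) (by omega)
    (P := fun u v => u + 2 ≤ N₀ ∨ (u = N₀ - 1 ∧ v + 2 ≠ L) ∨ (u = N₀ ∧ v < 2)) ?_ ?_ ?_
  · rw [region_erase, region_erase, col_site (by omega), col_site (by omega),
      row_site (by omega), row_site (by omega)] at key
    convert key using 1
    · exact region_congr fun u v hu hv => by omega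
    · exact region_congr fun u v hu hv => by omega
  · refine cut_region_le (by omega) (by omega)
      (fun v => if v < 2 then N₀ else if v + 2 = L then N₀ - 2 else N₀ - 1) (N₀ - 1) (L - 3) N₀ 1
      ?_ ?_
    · intro u v hu hv hP hn
      split_ifs at hn ⊢ <;> omega
    · intro u v hu hv hP hn
      split_ifs at hn ⊢ <;> omega
  · intro u v hu hv hD
    omega
  · intro l hl a b ha hb hD
    have hd := ZMod.val_lt (l - κ)
    by_cases hd0 : (l - κ).val = 0
    · rw [ZMod.val_eq_zero, sub_eq_zero] at hd0
      subst hd0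
      refine not_near_center h (u := N₀) (v := 0) (u' := N₀) (v' := 1) (by omega)
        (by omega) (by omega) (by omega) (by omega) (by omega) (by omega) (by omega) (by omega) ?_
      intro y w hw hy hP
      constructor <;> omega
    by_cases hdl : (l - κ).val = K - 1
    · refine three_le_card_sdiff (κ := κ) (u := N₀ - 1) (v := 0) (u' := N₀ - 1) (v' := 1)
        (u'' := N₀)
        (v'' := 1) (by omega) (by omega) (by omega) (by omega) (by omega) (by omega) (by omega)
        (by omega) (by omega) (by omega) ?_ ?_ ?_ (by omega) (by omega) (by omega) <;>
      · unfold InStrip; omega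
    · exact not_near_of_cols h (b := b) hd0 hdl (fun v _ _ => by omega) fun v _ _ => by omega

/-- The second hole passes from the right to the left. -/
theorem second_hole (h : Sizes K L N₀) (A : ZMod K → Prop) :
    Bridge N₀ A
      (region L κ fun u v => (u < N₀ ∧ ¬ (u = N₀ - 1 ∧ v + 2 = L) ∧ ¬ (u = 0 ∧ v = 1)) ∨
        (u = N₀ ∧ v < 2))
      (region L κ (InWindow N₀ 2)) := by
  have h1 := h.three_le
  have h2 := h.two_mul_lt
  have h3 := h.four_le
  have h4 := h.lt
  have hroute : Route κ (fun u v => (u + 2 ≤ N₀ ∧ ¬ (u = 0 ∧ v = 1)) ∨ (u = N₀ - 1 ∧ v + 2 = L))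
      (site κ (N₀ - 1) (L - 2) : Site K L) (site κ 0 0) := by
    have r1 : Route κ (fun u v => (u + 2 ≤ N₀ ∧ ¬ (u = 0 ∧ v = 1)) ∨ (u = N₀ - 1 ∧ v + 2 = L))
        (site κ 0 (L - 2) : Site K L) (site κ (N₀ - 1) (L - 2)) :=
      route_row (by omega) (by omega) (by omega) fun a _ _ => by omega
    have r2 := route_up (κ := κ) (K := K) (L := L) (u := 0) (v := L - 2)
      (D := fun u v => (u + 2 ≤ N₀ ∧ ¬ (u = 0 ∧ v = 1)) ∨ (u = N₀ - 1 ∧ v + 2 = L)) (by omega)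
      (by omega) (by omega) (.inl ⟨by omega, by rw [if_neg (by omega)]; omega⟩)
    rw [if_neg (by omega)] at r2
    have r3 := route_up (κ := κ) (K := K) (L := L) (u := 0) (v := L - 2 + 1)
      (D := fun u v => (u + 2 ≤ N₀ ∧ ¬ (u = 0 ∧ v = 1)) ∨ (u = N₀ - 1 ∧ v + 2 = L)) (by omega)
      (by omega) (by omega) (.inl ⟨by omega, by rw [if_pos (by omega)]; omega⟩)
    rw [if_pos (by omega)] at r3
    exact r1.symm.trans (r2.trans r3)
  have key := hroute.bridge_erase (N₀ := N₀) (A := A) (by omega) (by omega)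
    (P := fun u v => (u < N₀ ∧ ¬ (u = 0 ∧ v = 1)) ∨ (u = N₀ ∧ v < 2)) ?_ ?_ ?_
  · rw [region_erase, region_erase, col_site (by omega), col_site (by omega),
      row_site (by omega), row_site (by omega)] at key
    convert key using 1
    · exact region_congr fun u v hu hv => by omega
    · exact region_congr fun u v hu hv => by unfold InWindow; omega
  · refine cut_region_le (by omega) (by omega)
      (fun v => if v < 2 then N₀ else N₀ - 1) 0 0 N₀ 1
      ?_ ?_
    · intro u v hu hv hP hn
      by_cases hc : u + 1 = K
      · omega
      · rw [if_neg hc] at hn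
        split_ifs <;> omega
    · intro u v hu hv hP hn
      by_cases hc : v + 1 = L
      · rw [if_pos hc] at hn
        omega
      · rw [if_neg hc] at hn
        omega
  · intro u v hu hv hD
    omega
  · intro l hl a b ha hb hD
    have hd := ZMod.val_lt (l - κ)
    by_cases hd0 : (l - κ).val = 0
    · rw [ZMod.val_eq_zero, sub_eq_zero] at hd0
      subst hd0
      refine not_near_center h (u := N₀) (v := 0) (u' := N₀) (v' := 1) (by omega)
        (by omega) (by omega) (by omega) (by omega) (by omega) (by omega) (by omega) (by omega) ?_
      intro y w hw hy hP
      constructor <;> omega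
    by_cases hdl : (l - κ).val = K - 1
    · refine three_le_card_sdiff (κ := κ) (u := N₀ - 1) (v := 0) (u' := N₀ - 1) (v' := 1)
        (u'' := N₀)
        (v'' := 1) (by omega) (by omega) (by omega) (by omega) (by omega) (by omega) (by omega)
        (by omega) (by omega) (by omega) ?_ ?_ ?_ (by omega) (by omega) (by omega) <;>
      · unfold InStrip; omega
    by_cases hd1 : (l - κ).val = 1
    · by_cases ha0 : a = 0
      · have key : ∀ i j : ℕ, i < j → j < 4 → i ≠ 1 → j ≠ 1 → i ≠ b → j ≠ b →
            ¬ Near N₀ l (region L κ fun u v =>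
              ((u < N₀ ∧ ¬ (u = 0 ∧ v = 1)) ∨ (u = N₀ ∧ v < 2)) ∧ ¬ (u = a ∧ v = b)) := by
          intro i j h5 h6 h7 h8 h9 h10
          refine not_near_of_two (κ := κ) (u := 0) (v := i) (u' := 0) (v' := j) (by omega)
            (by omega) (by omega) (by omega) (by omega) (by omega) (by omega) (by omega) ?_ ?_
            (by omega) ?_
          · unfold InStrip; omega
          · unfold InStrip; omega
          · intro x y w hx hy hw
            unfold InStrip
            split_ifs <;> omega
        by_cases hb0 : b = 0
        · exact key 2 3 (by omega) (by omega) (by omega) (by omega) (by omega) (by omega)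
        by_cases hb2 : b = 2
        · exact key 0 3 (by omega) (by omega) (by omega) (by omega) (by omega) (by omega)
        · exact key 0 2 (by omega) (by omega) (by omega) (by omega) (by omega) (by omega)
      · refine not_near_of_col (κ := κ) (u := 0) (b := 1) (by omega) h3 (by omega) ?_ ?_
        · unfold InStrip; omega
        · intro v _ _; omega
    · by_cases hin : InStrip K N₀ (l - κ).val 1
      · refine not_near_of_col (κ := κ) (u := N₀ - 1) (b := b) (by omega) h3 (by omega) ?_ ?_
        · unfold InStrip at hin ⊢; omega
        · intro v _ _; omega
      · refine not_near_of_col (κ := κ) (u := 1) (b := b) (by omega) h3 (by omega) hin ?_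
        intro v _ _; omega

/-- The passage by the strip at `κ + 1`. -/
theorem bypass (h : Sizes K L N₀) (A : ZMod K → Prop) :
    -- No strip at all is approached, so the set A is arbitrary and the detour can be repeated as
    -- often as needed.
    Bridge N₀ A (window L N₀ κ (L - 2)) (window L N₀ (κ + 1) 2) := by
  have h1 := h.three_le
  have h2 := h.two_mul_lt
  have h3 := h.four_le
  have hstart : window L N₀ κ (L - 2) = region L (κ + 1) fun u v =>
      u + 2 ≤ N₀ ∨ (u = K - 1 ∧ L ≤ v + 2) ∨ (u = N₀ - 1 ∧ v + 2 < L) := by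
    refine region_succ (by omega) fun u v hu hv => ?_
    unfold InWindow
    split_ifs <;> omega
  rw [hstart]
  exact (first_particle h A).trans ((second_particle h A).trans
    ((first_hole h A).trans (second_hole h A)))

/-- Any two strips are joined by a path which is near no third strip. -/
theorem bridge_strips (h : Sizes K L N₀) {k k' : ZMod K} (hne : k ≠ k') :
    Bridge N₀ (fun l => l = k ∨ l = k') (stripSet K L N₀ k) (stripSet K L N₀ k') := by
  have h3 := h.four_le
  have h4 := h.lt
  have hwin : ∀ n : ℕ, Bridge N₀ (fun l => l = k ∨ l = k') (stripSet K L N₀ k)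
      (window L N₀ (k + (n : ZMod K)) (L - 2)) := by
    intro n
    induction n with
    | zero =>
      have := window_steps h (κ := k) (A := fun l => l = k ∨ l = k') (s := 0) (n := L - 2)
        (by omega) (fun _ => .inl rfl) (by omega)
      rw [window_zero h, Nat.zero_add] at this
      simpa using this
    | succ n ih =>
      -- Between shifts 2 and L - 2 no strip is near, so the conditions on A are vacuous.
      have h5 := window_steps h (κ := k + (n : ZMod K) + 1) (A := fun l => l = k ∨ l = k') (s := 2)
        (n := L - 4) (by omega) (by omega) (by omega)
      rw [show 2 + (L - 4) = L - 2 by omega] at h5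
      have h6 := (ih.trans (bypass h _)).trans h5
      rwa [add_assoc, ← Nat.cast_succ] at h6
  have h5 := val_sub_ne_zero (κ := k) hne.symm
  have h6 := hwin ((k' - k).val - 1)
  have h7 : k + (((k' - k).val - 1 : ℕ) : ZMod K) + 1 = k' := by
    rw [Nat.cast_sub (by omega), ZMod.natCast_zmod_val]
    push_cast
    ring
  have h8 := window_steps h (κ := k + (((k' - k).val - 1 : ℕ) : ZMod K)) (A := fun l => l = k ∨ l = k')
    (s := L - 2) (n := 2) (by omega) (by omega) (fun _ => .inr h7)
  rw [show L - 2 + 2 = L by omega, window_last h, h7] at h8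
  exact h6.trans h8

end Kawasaki

set_option linter.unusedSectionVars false

namespace Kawasaki

variable {K L N₀ : ℕ} [NeZero K] [NeZero L] {κ : ZMod K}

theorem not_near_window (h : Sizes K L N₀) (l : ZMod K) : ¬ Near N₀ l (window L N₀ κ 2) := by
  have h1 := h.three_le
  have h2 := h.two_mul_lt
  have h3 := h.four_le
  have h4 := h.lt
  unfold window
  by_cases hl0 : l = κ
  · subst hl0
    refine not_near_center h (u := N₀) (v := 0) (u' := N₀) (v' := 1) (by omega) (by omega)
      (by omega) (by omega) ?_ ?_ (by omega) (by omega) (by omega) ?_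
    · unfold InWindow; omega
    · unfold InWindow; omega
    · intro y w hw hy
      unfold InWindow
      omega
  · have hd0 := val_sub_ne_zero hl0
    have hd := ZMod.val_lt (l - κ)
    by_cases hd1 : (l - κ).val = 1
    · refine not_near_of_two (κ := κ) (u := 0) (v := L - 1) (u' := 0) (v' := L - 2) (by omega)
        (by omega) (by omega) (by omega) (by omega) (by omega) ?_ ?_ ?_ ?_ (by omega) ?_
      · unfold InWindow; omega
      · unfold InWindow; omega
      · unfold InStrip; omega
      · unfold InStrip; omega
      · intro x y w hx hy hw
        unfold InStrip InWindow
        split_ifs <;> omega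
    · by_cases hin : InStrip K N₀ (l - κ).val 1
      · refine not_near_of_col (κ := κ) (u := N₀ - 1) (b := L) (by omega) h3 (by omega) ?_ ?_
        · unfold InStrip at hin ⊢; omega
        · intro v _ _; unfold InWindow; omega
      · refine not_near_of_col (κ := κ) (u := 1) (b := L) (by omega) h3 (by omega) hin ?_
        intro v _ _; unfold InWindow; omega

theorem cut_window_le (h : Sizes K L N₀) : cut (window L N₀ κ 2) ≤ L + 2 := by
  have h1 := h.three_le
  have h2 := h.two_mul_lt
  have h3 := h.four_le
  refine cut_region_le (by omega) (by omega) (fun v => if v < 2 then N₀ else N₀ - 1) 0 (L - 1) N₀ 1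
    ?_ ?_
  · intro u v hu hv
    unfold InWindow
    intro hP hn
    split_ifs at hn ⊢ <;> omega
  · intro u v hu hv
    unfold InWindow
    intro hP hn
    split_ifs at hn ⊢ <;> omega

/-- A state other than the strips, without empty rows, has energy at least two above the strips. -/
theorem two_le_cut (h : Sizes K L N₀) {s : Finset (Site K L)} (hs : s.card = L * N₀)
    (hrow : ∀ y, ∃ x, (x, y) ∈ s) (hstrip : ∀ k, s ≠ stripSet K L N₀ k) : L + 2 ≤ cut s := by
  have h1 := isoperimetry h.lt h.lt_four_mul h.two_mul_lt h.four_le h.width hs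
  by_contra hlt
  rcases h1.2 (by omega) with ⟨k, hk⟩ | ⟨-, -, y, hy⟩
  · exact hstrip k hk
  · obtain ⟨x, hx⟩ := hrow y
    exact hy x hx

theorem exists_mem_row_region {P : ℕ → ℕ → Prop} {u : ℕ} (hu : u < K) (h : ∀ v, v < L → P u v)
    (y : ZMod L) : ∃ x, (x, y) ∈ region L κ P := by
  refine ⟨κ + u, ?_⟩
  have h1 : (κ + (u : ZMod K), y) = (site κ u y.val : Site K L) := by
    simp [site]
  rw [h1, site_mem_region hu (ZMod.val_lt y)]
  exact h _ (ZMod.val_lt y)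

theorem exists_mem_row_strip (h : Sizes K L N₀) (k : ZMod K) (y : ZMod L) :
    ∃ x, (x, y) ∈ stripSet K L N₀ k := by
  refine ⟨k, ?_⟩
  rw [mem_stripSet, sub_self, ZMod.val_zero]
  have := h.three_le
  omega

theorem cut_window (h : Sizes K L N₀) {s : Finset (Site K L)} (hs : s = window L N₀ κ 2)
    (hcard : s.card = L * N₀) : cut s = L + 2 := by
  have h1 := h.three_le
  have h2 := h.two_mul_lt
  subst hs
  refine le_antisymm (cut_window_le h) (two_le_cut h hcard ?_ ?_)
  · refine exists_mem_row_region (u := 1) (by omega) fun v hv => ?_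
    unfold InWindow
    omega
  · intro k hk
    have := not_near_window h (κ := κ) k
    rw [hk] at this
    exact this near_strip

theorem one_le_deg {s : Finset (Site K L)} {p q : Site K L} (h : Nb q p) (hp : p ∈ s) :
    1 ≤ deg s q := by
  unfold deg
  rcases h with rfl | rfl | rfl | rfl <;> rw [if_pos hp] <;> omega

theorem deg_le_three {s : Finset (Site K L)} {p q : Site K L} (h : Nb q p) (hp : p ∉ s) :
    deg s q ≤ 3 := by
  unfold deg
  rcases h with rfl | rfl | rfl | rfl <;> rw [if_neg hp] <;> split_ifs <;> omega

/-- Two jumps lead from a strip to a state whose energy is higher by two. -/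
theorem exists_bump (h : Sizes K L N₀) (k : ZMod K) : ∃ s t : Finset (Site K L),
    Move (stripSet K L N₀ k) s ∧ Move s t ∧ cut s ≤ L + 3 ∧ cut t = L + 2 := by
  have h1 := h.three_le
  have h2 := h.two_mul_lt
  have h3 := h.four_le
  have h4 := h.lt
  have hstrip : stripSet K L N₀ k = region L k fun u _ => u < N₀ := by
    ext x
    rw [mem_region, mem_stripSet]
    rfl
  have hp : (site k (N₀ - 1) 0 : Site K L) ∈ stripSet K L N₀ k := by
    rw [hstrip, site_mem_region (by omega) (by omega)]
    omega
  have hq : (site k N₀ 0 : Site K L) ∉ stripSet K L N₀ k := by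
    rw [hstrip, site_mem_region (by omega) (by omega)]
    omega
  have hpq : Nb (site k (N₀ - 1) 0 : Site K L) (site k N₀ 0) := by
    have := nb_site_col (L := L) (κ := k) (N₀ - 1) 0
    rwa [Nat.sub_add_cancel (by omega)] at this
  have hs : insert (site k N₀ 0) ((stripSet K L N₀ k).erase (site k (N₀ - 1) 0)) =
      region L k fun u v => (u < N₀ ∧ ¬ (u = N₀ - 1 ∧ v = 0)) ∨ (u = N₀ ∧ v = 0) := by
    rw [hstrip, region_erase, region_insert, col_site (by omega), col_site (by omega),
      row_site (by omega)]
    rw [row_site (by omega)]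
  have ht : insert (site k N₀ 1) ((insert (site k N₀ 0)
      ((stripSet K L N₀ k).erase (site k (N₀ - 1) 0))).erase (site k N₀ 0)) =
      region L k fun u v => (u < N₀ ∧ ¬ (u = N₀ - 1 ∧ v = 0)) ∨ (u = N₀ ∧ v = 1) := by
    rw [hs, region_erase, region_insert, col_site (by omega),
      row_site (by omega), row_site (by omega), col_site (by omega)]
    exact region_congr fun u v hu hv => by omega
  have hm1 : Move (stripSet K L N₀ k)
      (insert (site k N₀ 0) ((stripSet K L N₀ k).erase (site k (N₀ - 1) 0))) :=
    ⟨_, hp, _, hq, hpq, rfl⟩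
  have hm2 : Move (insert (site k N₀ 0) ((stripSet K L N₀ k).erase (site k (N₀ - 1) 0)))
      (insert (site k N₀ 1) ((insert (site k N₀ 0)
      ((stripSet K L N₀ k).erase (site k (N₀ - 1) 0))).erase (site k N₀ 0))) := by
    refine ⟨_, Finset.mem_insert_self _ _, _, ?_, nb_site_row _ _, rfl⟩
    rw [hs, site_mem_region (by omega) (by omega)]
    omega
  refine ⟨_, _, hm1, hm2, ?_, le_antisymm ?_ (two_le_cut h ?_ ?_ ?_)⟩
  · have hj := cut_jump (by omega) (by omega) hp hq hpq
    rw [cut_stripSet h] at hj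
    have := one_le_deg hpq.symm hp
    have := deg_le_three hpq hq
    omega
  · rw [ht]
    refine cut_region_le (by omega) (by omega)
      (fun v => if v = 0 then N₀ - 2 else if v = 1 then N₀ else N₀ - 1) (N₀ - 1) (L - 1) N₀ 1 ?_ ?_
    · intro u v hu hv hP hn
      by_cases hc : u + 1 = K
      · omega
      · rw [if_neg hc] at hn
        split_ifs <;> omega
    · intro u v hu hv hP hn
      by_cases hc : v + 1 = L
      · rw [if_pos hc] at hn
        omega
      · rw [if_neg hc] at hn
        omega
  · rw [hm2.card_eq, hm1.card_eq, card_stripSet (by omega)]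
  · rw [ht]
    exact exists_mem_row_region (u := 0) (by omega) fun v hv => by omega
  · intro l hl
    rw [ht] at hl
    have h5 : (site k (N₀ - 1) (L - 1) : Site K L) ∈ stripSet K L N₀ l := by
      rw [← hl, site_mem_region (by omega) (by omega)]
      omega
    rw [← mem_strip_add_e₂] at h5
    have h6 : (site k (N₀ - 1) (L - 1) : Site K L) + e₂ = site k (N₀ - 1) 0 := by
      rw [← site_period', ← Nat.sub_add_cancel (show 1 ≤ L by omega)]
      ext <;> simp [site, e₂]
    rw [h6, ← hl, site_mem_region (by omega) (by omega)] at h5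
    omega

/-! ### The landscape -/

/-- Chains of sets of occupied sites lift to configurations. -/
theorem exists_lift {N : ℕ} {R : Finset (Site K L) → Finset (Site K L) → Prop}
    (hR : ∀ s t, R s t → Move s t) {η : Config K L N} {t : Finset (Site K L)}
    (h : Relation.ReflTransGen R (occ η) t) : ∃ ξ : Config K L N, occ ξ = t ∧
      Relation.ReflTransGen (fun a b : Config K L N => R (occ a) (occ b)) η ξ := by
  induction h with
  | refl => exact ⟨η, rfl, .refl⟩
  | @tail b c _ hbc ih =>
    obtain ⟨ξ, rfl, hξ⟩ := ih
    refine ⟨ofOcc c ((hR _ _ hbc).card_eq.trans (card_occ ξ)), occ_ofOcc _ _, hξ.tail ?_⟩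
    rw [occ_ofOcc]
    exact hbc

/-- The energy of the strips. -/
def groundEnergy (L N₀ : ℕ) : ℝ := L - 2 * (L * N₀ : ℕ)

theorem energy_eq_iff (h : Sizes K L N₀) (η : Config K L (L * N₀)) (n : ℕ) :
    hamiltonian K L (L * N₀) η = groundEnergy L N₀ + n ↔ cut (occ η) = L + n := by
  have := h.lt
  have := h.four_le
  rw [hamiltonian_eq (by omega) (by omega)]
  unfold groundEnergy
  rw [← Nat.cast_inj (R := ℝ)]
  push_cast
  constructor <;> intro h <;> linarith

theorem energy_le_iff (h : Sizes K L N₀) (η : Config K L (L * N₀)) (n : ℕ) :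
    hamiltonian K L (L * N₀) η ≤ groundEnergy L N₀ + n ↔ cut (occ η) ≤ L + n := by
  have := h.lt
  have := h.four_le
  rw [hamiltonian_eq (by omega) (by omega)]
  unfold groundEnergy
  rw [← Nat.cast_le (α := ℝ)]
  push_cast
  constructor <;> intro h <;> linarith

theorem joined_iff (h : Sizes K L N₀) {η ξ : Config K L (L * N₀)} (n : ℕ) :
    Metastable.Joined (exchangeGraph K L (L * N₀)) (hamiltonian K L (L * N₀)) (groundEnergy L N₀ + n) η ξ ↔
      cut (occ η) ≤ L + n ∧
        Relation.ReflTransGen (fun s t => Move s t ∧ cut t ≤ L + n) (occ η) (occ ξ) := by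
  have := h.lt
  have := h.four_le
  unfold Metastable.Joined
  rw [energy_le_iff h]
  simp only [energy_le_iff h, exchange_adj (K := K) (L := L) (by omega) (by omega)]
  refine and_congr_right fun _ => ⟨fun h' => Relation.ReflTransGen.lift occ (fun _ _ => id) _ _ h',
    fun h' => ?_⟩
  obtain ⟨ζ, hζ, hc⟩ := exists_lift (fun _ _ h => h.1) h'
  rwa [occ_injective hζ] at hc

theorem near_of_joined (h : Sizes K L N₀) {hN : N₀ ≤ K} {k : ZMod K} {η : Config K L (L * N₀)}
    (hj : Metastable.Joined (exchangeGraph K L (L * N₀)) (hamiltonian K L (L * N₀)) (groundEnergy L N₀ + 3)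
      (strip K L N₀ hN k) η) : Near N₀ k (occ η) := by
  have h1 := (joined_iff h 3).1 hj
  rw [occ_strip] at h1
  exact near_of_chain h (card_stripSet hN k) h1.1 near_strip h1.2

theorem exists_row_of_chain (h : Sizes K L N₀) (hN : 4 ≤ N₀) {s t : Finset (Site K L)}
    (hs : s.card = L * N₀) (hc : cut s ≤ L + 4) (hrow : ∀ y, ∃ x, (x, y) ∈ s)
    (hst : Relation.ReflTransGen (fun s t => Move s t ∧ cut t ≤ L + 4) s t) :
    ∀ y, ∃ x, (x, y) ∈ t := by
  have : t.card = L * N₀ ∧ cut t ≤ L + 4 ∧ ∀ y, ∃ x, (x, y) ∈ t := by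
    induction hst with
    | refl => exact ⟨hs, hc, hrow⟩
    | @tail b c _ hbc ih =>
      refine ⟨hbc.1.card_eq.trans ih.1, hbc.2, ?_⟩
      by_contra hne
      push Not at hne
      obtain ⟨y, hy⟩ := hne
      have := cut_of_emptying h.lt h.lt_four_mul h.two_mul_lt h.four_le h.width ih.1 hN ih.2.2
        hbc.1 hy
      have := ih.2.1
      omega
  exact this.2.2

theorem not_near_strip_of_ne (h : Sizes K L N₀) {k k' : ZMod K} (hne : k ≠ k') :
    ¬ Near N₀ k' (stripSet K L N₀ k) := by
  have h1 := h.three_le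
  have h2 := h.two_mul_lt
  have hstrip : stripSet K L N₀ k = region L k fun u _ => u < N₀ := by
    ext x
    rw [mem_region, mem_stripSet]
    rfl
  have h5 := val_sub_ne_zero (κ := k) hne.symm
  have h6 := ZMod.val_lt (k' - k)
  rw [hstrip]
  by_cases hin : InStrip K N₀ (k' - k).val 0
  · refine not_near_of_col (κ := k) (u := N₀ - 1) (b := L) (by omega) h.four_le (by omega) ?_ ?_
    · unfold InStrip at hin ⊢; omega
    · intro v _ _; omega
  · exact not_near_of_col (κ := k) (u := 0) (b := L) (by omega) h.four_le (by omega) hin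
      fun v _ _ => by omega

theorem stripLandscape (h : Sizes K L N₀) (hN : N₀ ≤ K) :
    Metastable.StripLandscape (exchangeGraph K L (L * N₀)) (hamiltonian K L (L * N₀))
      (fun k : ZMod K => strip K L N₀ hN k) (groundEnergy L N₀) := by
  have h1 := h.three_le
  have h2 := h.two_mul_lt
  have h3 := h.four_le
  have h4 := h.lt
  have hiso := fun η : Config K L (L * N₀) => isoperimetry h.lt h.lt_four_mul h.two_mul_lt
    h.four_le h.width (card_occ η)
  have hcut : ∀ k : ZMod K, cut (occ (strip K L N₀ hN k)) = L := by
    intro k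
    rw [occ_strip, cut_stripSet h]
  have hsep : ∀ k k' : ZMod K, k ≠ k' → ¬ Metastable.Joined (exchangeGraph K L (L * N₀))
      (hamiltonian K L (L * N₀)) (groundEnergy L N₀ + 3) (strip K L N₀ hN k)
      (strip K L N₀ hN k') := by
    intro k k' hne hj
    have := near_of_joined h hj
    rw [occ_strip] at this
    exact not_near_strip_of_ne h hne.symm this
  refine ⟨?_, ?_, ?_, ?_, ?_, ?_, ?_, ?_, hsep, ?_⟩
  · intro η
    refine ⟨cut (occ η) - L, (energy_eq_iff h η _).2 ?_⟩
    have := (hiso η).1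
    omega
  · intro k k' hk
    by_contra hne
    have hk' : strip K L N₀ hN k = strip K L N₀ hN k' := hk
    refine hsep k k' hne ?_
    rw [← hk']
    refine Metastable.Joined.refl ((energy_le_iff h _ 3).2 ?_)
    rw [hcut]
    omega
  · intro η
    have h5 := energy_eq_iff h η 0
    rw [Nat.cast_zero, add_zero, add_zero] at h5
    rw [h5]
    constructor
    · intro hc
      rcases (hiso η).2 (by omega) with ⟨k, hk⟩ | ⟨h6, -⟩
      · exact ⟨k, occ_injective (by rw [hk, occ_strip])⟩
      · omega
    · rintro ⟨k, rfl⟩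
      exact hcut k
  · intro k η hadj
    rw [exchange_adj (by omega) (by omega), occ_strip] at hadj
    have h5 := cut_of_move_strip h hadj
    by_contra hlt
    have h6 : cut (occ η) = L + (cut (occ η) - L) := by omega
    rw [← energy_eq_iff h] at h6
    have h7 : (3 : ℝ) ≤ ((cut (occ η) - L : ℕ) : ℝ) := by
      exact_mod_cast (show 3 ≤ cut (occ η) - L by omega)
    exact hlt (by rw [h6]; linarith)
  · intro k η hj hη
    have h5 := (energy_eq_iff h η 1).1 (by exact_mod_cast hη)
    have h6 := (joined_iff h 4).1 hj
    rcases (hiso η).2 (by omega) with ⟨k', hk⟩ | ⟨-, h7, y, hy⟩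
    · rw [hk, cut_stripSet h] at h5
      omega
    · rw [occ_strip] at h6
      obtain ⟨x, hx⟩ := exists_row_of_chain h h7 (card_stripSet hN k) h6.1
        (exists_mem_row_strip h k) h6.2 y
      exact hy x hx
  · unfold groundEnergy
    have h5 : (4 : ℝ) ≤ L := by exact_mod_cast h3
    have h6 : (3 : ℝ) ≤ N₀ := by exact_mod_cast h1
    push_cast
    nlinarith
  · obtain ⟨s, t, hs, ht, hcs, hct⟩ := exists_bump h (0 : ZMod K)
    rw [← occ_strip hN] at hs
    obtain ⟨ξ, hξ, hc⟩ := exists_lift (R := fun s t => Move s t ∧ cut t ≤ L + 3)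
      (fun _ _ h => h.1) (η := strip K L N₀ hN 0) (t := t)
      (.tail (.single ⟨hs, hcs⟩) ⟨ht, by omega⟩)
    refine ⟨0, ξ, ?_, ?_⟩
    · exact_mod_cast (energy_eq_iff h ξ 2).2 (by rw [hξ]; exact hct)
    · refine (joined_iff h 3).2 ⟨by rw [hcut]; omega, ?_⟩
      exact Relation.ReflTransGen.lift occ (fun _ _ => id) _ _ hc
  · have h5 := window_steps h (κ := (0 : ZMod K)) (A := fun _ => True) (s := 0) (n := 2) (by omega)
      (fun _ => trivial) (fun _ => trivial)
    rw [window_zero h, ← occ_strip hN] at h5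
    obtain ⟨ξ, hξ, hc⟩ := exists_lift (fun _ _ h => h.1) h5
    rw [Nat.zero_add] at hξ
    refine ⟨0, ξ, ?_, ?_, fun k' hj => ?_⟩
    · exact_mod_cast (energy_eq_iff h ξ 2).2 (cut_window h hξ (card_occ ξ))
    · refine (joined_iff h 4).2 ⟨by rw [hcut]; omega, ?_⟩
      exact Relation.ReflTransGen.lift (p := fun s t => Move s t ∧ cut t ≤ L + 4) occ
        (fun _ _ h => ⟨h.1, h.2.1⟩) _ _ hc
    · have := near_of_joined h hj
      rw [hξ] at this
      exact not_near_window h k' this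
  · intro k k' hne
    have h5 := bridge_strips h hne
    rw [← occ_strip hN] at h5
    obtain ⟨ξ, hξ, hc⟩ := exists_lift (fun _ _ h => h.1) h5
    have hξ' : ξ = strip K L N₀ hN k' := occ_injective (by rw [hξ, occ_strip])
    rw [hξ'] at hc
    refine Relation.ReflTransGen.mono (fun a b hab => ⟨?_, ?_, ?_⟩) _ _ hc
    · exact (exchange_adj (by omega) (by omega)).2 hab.1
    · exact_mod_cast (energy_le_iff h b 4).2 hab.2.1
    · intro l hlk hlk' hj
      exact hab.2.2 l (by simp [hlk, hlk']) (near_of_joined h hj)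

end Kawasaki
theorem theorem3p7 (K L N₀ : ℕ) [NeZero K] [NeZero L]
    (hKL : L < K) (hLN : L < 4 * N₀) (hNK : 2 * N₀ < K)
    (hL : 4 ≤ L) (hN : 4 ≤ N₀ ∨ (N₀ = 3 ∧ L ≤ 9)) :
    (∀ h ∈ Set.Icc (1 : ℕ) 3, (Metastable.starPlateaux (Kawasaki.exchangeGraph K L (L * N₀))
        (Kawasaki.hamiltonian K L (L * N₀)) h).Nontrivial) ∧
    ∀ k k' : ZMod K, k ≠ k' →
      {Kawasaki.strip K L N₀ (by omega) k} ∈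
        Metastable.starPlateaux (Kawasaki.exchangeGraph K L (L * N₀))
          (Kawasaki.hamiltonian K L (L * N₀)) 3 ∧
      {Kawasaki.strip K L N₀ (by omega) k'} ∈
        Metastable.starPlateaux (Kawasaki.exchangeGraph K L (L * N₀))
          (Kawasaki.hamiltonian K L (L * N₀)) 3 ∧
      0 < Metastable.starRate (Kawasaki.exchangeGraph K L (L * N₀))
          (Kawasaki.hamiltonian K L (L * N₀)) 3
          {Kawasaki.strip K L N₀ (by omega) k} {Kawasaki.strip K L N₀ (by omega) k'} := by
  have : Fact (1 < K) := ⟨by omega⟩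
  exact (Kawasaki.stripLandscape ⟨hKL, hLN, hNK, hL, hN⟩ (by omega)).hierarchy
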